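/- Let $c>0$ and $n\in\{2,3,\dots,\infty\}$. Let $\Omega\subseteq\mathbb R^2$ be open, let $g(t,x,u,u_t)$ be a non-singular function, that is, of class $C^n$ on $\Omega\times\mathbb R^2$, and let $Q_1,Q_2,Q_0\in C^\infty(\Omega)$. The expression $Q=Q_1(t,x)u_t+Q_2(t,x)u_x+Q_0(t,x)u$ is called a multiplier on $\Omega$ of the wave equation $u_{tt}+g(t,x,u,u_t)=c^2u_{xx}$ if there are continuously differentiable functions $T,\Psi$ of $t,x,u,u_t$ and finitely many $x$-derivatives of $u$ and $u_t$ such that $(u_{tt}-c^2u_{xx}+g)\,Q=D_tT+D_x\Psi$ holds on $\Omega$ identically in $u$ (for all smooth $u$, not only for solutions). Write $\Box=\partial_t^2-c^2\partial_x^2$. A point $p\in\Omega$ is called generic if $(Q_1,Q_2)(p)\ne(0,0)$ and each of $Q_1$, $Q_2$, $Q_2^2-c^2Q_1^2$ either is non-zero at $p$ or vanishes identically near $p$. (A) Suppose $Q$ is a multiplier on $\Omega$. Then the set of generic points is dense in the set where $(Q_1,Q_2,Q_0)\neq 0$, and each generic point has an open neighbourhood on which, up to a non-zero constant factor in $Q$,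 one of the following four cases holds. Here $f$ is a $C^n$ function of two real arguments (on $J\times\mathbb R$ with $J\subseteq\mathbb R$ open, the first argument taking values in $J$) and $a,b,b_0,k$ are smooth. (i) $g=a'(t)u_t+f(t,u)$ and $Q=e^{a(t)}u_x$. (ii) $g=a'(t)u_t+\tfrac14\big(a'(t)^2+2a''(t)\big)u+f\big(x,e^{a(t)/2}u\big)e^{-a(t)/2}$ and $Q=e^{a(t)}\big(u_t+\tfrac12a'(t)u\big)$. (iii) For a sign $\sigma=\pm1$ and $a=a(t,x)$, $k=k(t,x)$: $$g=(\Box a)u_t+ku+e^{\frac{3\sigma c a_x-a_t}{2}}f\big(x+\sigma ct,\;u\,e^{\frac{\sigma c a_x+a_t}{2}}\big),\qquad Q=e^{a_t-\sigma c a_x}\big(u_t-\sigma c u_x+\tfrac12(\Box a)u\big),$$ where, with $\partial=\partial_t-\sigma c\,\partial_x$, $$2\partial k-4\sigma c(\partial a_x)k+c(\partial a_x)\big(4c\,\Box a_x+\sigma(\Box a)^2+2\sigma\,\partial\Box a\big)-(\Box a)\,\partial\Box a-\Box^2a=0.$$ (iv) For $a,b,b_0,k$ functions of $(t,x)$ and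 with either $(C,S)=(\cosh(ca_x),\sinh(ca_x))$ or $(C,S)=(\sinh(ca_x),\cosh(ca_x))$: $$g=(\Box a)u_t+ku+e^{\frac{3b-4a_t}{2}}f\big(b_0,\;u\,e^{b/2}\big),\qquad Q=e^{a_t}\Big(C\big(u_t+\tfrac12(\Box a)u\big)+c\,S\,u_x\Big),$$ where $C\,b_{0,t}+cS\,b_{0,x}=0$, $\;C\,b_t+cS\,b_x=C\,\Box a$, and $$\begin{aligned}&2Ck_t+2cSk_x+4c(a_{tx}S+c\,a_{xx}C)k\\&-\big(c^2a_{xx}((\Box a)^2+2\Box a_t)-2c^2a_{tx}\Box a_x+\Box a\,\Box a_t+\Box^2a\big)C\\&-c\big(a_{tx}((\Box a)^2+2\Box a_t)-2c^2a_{xx}\Box a_x+\Box a\,\Box a_x\big)S=0.\end{aligned}$$ In this case the neighbourhood can be chosen such that $Q_1$ and $Q_2$ have no zeros on it. (B) Conversely, $f$ is arbitrary: on every open set on which $g$ and $Q$ have one of the forms (i)–(iv) (for any such $f$ and $a$, and any solutions $b,b_0,k$ of the stated equations, also where $Q_1$ or $Q_2$ vanishes), $Q$ is a multiplier. -/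

import Mathlib

open Set Filter Topology
open scoped ContDiff

noncomputable section

/-! Points of the `(t, x)`-plane are pairs `p : ℝ × ℝ` with `p.1 = t` and `p.2 = x`. -/

/-- The partial derivative with respect to `t`. -/
def dt (w : ℝ × ℝ → ℝ) : ℝ × ℝ → ℝ := fun p => deriv (fun s => w (s, p.2)) p.1

/-- The partial derivative with respect to `x`. -/
def dx (w : ℝ × ℝ → ℝ) : ℝ × ℝ → ℝ := fun p => deriv (fun y => w (p.1, y)) p.2

/-- The wave operator `w_tt - c² w_xx`. -/
def box (c : ℝ) (w : ℝ × ℝ → ℝ) : ℝ × ℝ → ℝ :=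
  fun p => dt (dt w) p - c ^ 2 * dx (dx w) p

/-- The coordinates `t`, `x`, `u`, `u_t` and the `x`-derivatives of `u` and `u_t` up to order `N`. -/
abbrev JetSpace (N : ℕ) : Type := (ℝ × ℝ) × (Fin (N + 1) → ℝ) × (Fin (N + 1) → ℝ)

/-- The values of `(t, x)`, `u, u_x, …, ∂_x^N u` and `u_t, u_tx, …, ∂_x^N u_t` at `p`. -/
def jet (N : ℕ) (u : ℝ × ℝ → ℝ) (p : ℝ × ℝ) : JetSpace N :=
  (p, (fun i => (dx^[(i : ℕ)] u) p), (fun i => (dx^[(i : ℕ)] (dt u)) p))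

/-- The expression `Q = Q₁ u_t + Q₂ u_x + Q₀ u`. -/
def multExpr (Q1 Q2 Q0 : ℝ × ℝ → ℝ) (u : ℝ × ℝ → ℝ) (p : ℝ × ℝ) : ℝ :=
  Q1 p * dt u p + Q2 p * dx u p + Q0 p * u p

/-- `Q = Q₁ u_t + Q₂ u_x + Q₀ u` is a conservation law multiplier on `Ω` of the wave equation
`u_tt + g(t, x, u, u_t) = c² u_xx`: there are a conserved density `T` and a spatial flux `Ψ`,
continuously differentiable functions of `t`, `x`, `u`, `u_t` and finitely many of their
`x`-derivatives, such that `(u_tt - c² u_xx + g) Q = D_t T + D_x Ψ` holds identically, that is for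
every smooth function `u` (not only for solutions). -/
def IsMultiplier (c : ℝ) (Ω : Set (ℝ × ℝ)) (g : (ℝ × ℝ) × ℝ × ℝ → ℝ)
    (Q1 Q2 Q0 : ℝ × ℝ → ℝ) : Prop :=
  ∃ (N : ℕ) (T Ψ : JetSpace N → ℝ),
    ContDiffOn ℝ 1 T (Ω ×ˢ univ) ∧ ContDiffOn ℝ 1 Ψ (Ω ×ˢ univ) ∧
    ∀ u : ℝ × ℝ → ℝ, ContDiff ℝ ∞ u → ∀ p ∈ Ω,
      (dt (dt u) p - c ^ 2 * dx (dx u) p + g (p, u p, dt u p)) * multExpr Q1 Q2 Q0 u p =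
        dt (fun q => T (jet N u q)) p + dx (fun q => Ψ (jet N u q)) p

/-- Case (i): `g = a'(t) u_t + f(t, u)` and `Q = κ e^{a(t)} u_x`. -/
def CaseI (n : ℕ∞) (V : Set (ℝ × ℝ)) (g : (ℝ × ℝ) × ℝ × ℝ → ℝ)
    (Q1 Q2 Q0 : ℝ × ℝ → ℝ) : Prop :=
  ∃ (κ : ℝ) (I : Set ℝ) (a : ℝ → ℝ) (f : ℝ × ℝ → ℝ), κ ≠ 0 ∧ IsOpen I ∧ (∀ p ∈ V, p.1 ∈ I) ∧
    ContDiffOn ℝ ∞ a I ∧ ContDiffOn ℝ n f (I ×ˢ univ) ∧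
    (∀ p ∈ V, ∀ u v : ℝ, g (p, u, v) = deriv a p.1 * v + f (p.1, u)) ∧
    ∀ p ∈ V, Q1 p = 0 ∧ Q2 p = κ * Real.exp (a p.1) ∧ Q0 p = 0

/-- Case (ii): `g = a'(t) u_t + ¼ (a'(t)² + 2 a''(t)) u + f(x, e^{a(t)/2} u) e^{-a(t)/2}` and
`Q = κ e^{a(t)} (u_t + ½ a'(t) u)`. -/
def CaseII (n : ℕ∞) (V : Set (ℝ × ℝ)) (g : (ℝ × ℝ) × ℝ × ℝ → ℝ)
    (Q1 Q2 Q0 : ℝ × ℝ → ℝ) : Prop :=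
  ∃ (κ : ℝ) (I J : Set ℝ) (a : ℝ → ℝ) (f : ℝ × ℝ → ℝ), κ ≠ 0 ∧ IsOpen I ∧ IsOpen J ∧
    (∀ p ∈ V, p.1 ∈ I ∧ p.2 ∈ J) ∧
    ContDiffOn ℝ ∞ a I ∧ ContDiffOn ℝ n f (J ×ˢ univ) ∧
    (∀ p ∈ V, ∀ u v : ℝ, g (p, u, v) =
      deriv a p.1 * v + 1 / 4 * (deriv a p.1 ^ 2 + 2 * deriv (deriv a) p.1) * u
        + f (p.2, Real.exp (a p.1 / 2) * u) * Real.exp (-(a p.1 / 2))) ∧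
    ∀ p ∈ V, Q1 p = κ * Real.exp (a p.1) ∧ Q2 p = 0 ∧
      Q0 p = κ * (Real.exp (a p.1) * (deriv a p.1 / 2))

/-- The first-order linear equation for `k` in case (iii), with the sign `σ = ±1`:
`2 ∂k - 4σc (∂a_x) k + c (∂a_x) (4c □a_x + σ (□a)² + 2σ ∂□a) - □a ∂□a - □□a = 0`, where
`∂ = ∂_t - σ c ∂_x` and `□ = ∂_t² - c² ∂_x²`. -/
def KEquationIII (c σ : ℝ) (V : Set (ℝ × ℝ)) (a k : ℝ × ℝ → ℝ) : Prop :=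
  ∀ p ∈ V,
    2 * (dt k p - σ * c * dx k p)
      - 4 * σ * c * (dt (dx a) p - σ * c * dx (dx a) p) * k p
      + c * (dt (dx a) p - σ * c * dx (dx a) p) *
          (4 * c * dx (box c a) p + σ * box c a p ^ 2
            + 2 * σ * (dt (box c a) p - σ * c * dx (box c a) p))
      - box c a p * (dt (box c a) p - σ * c * dx (box c a) p)
      - box c (box c a) p = 0

/-- Case (iii), with the sign `σ = ±1`:
`g = (□a) u_t + k u + e^{(3σc a_x - a_t)/2} f(x + σct, u e^{(σc a_x + a_t)/2})` and
`Q = κ e^{a_t - σc a_x} (u_t - σc u_x + ½ (□a) u)`. -/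
def CaseIII (n : ℕ∞) (c σ : ℝ) (V : Set (ℝ × ℝ)) (g : (ℝ × ℝ) × ℝ × ℝ → ℝ)
    (Q1 Q2 Q0 : ℝ × ℝ → ℝ) : Prop :=
  ∃ (κ : ℝ) (J : Set ℝ) (a k f : ℝ × ℝ → ℝ), κ ≠ 0 ∧ IsOpen J ∧
    (∀ p ∈ V, p.2 + σ * c * p.1 ∈ J) ∧
    ContDiffOn ℝ ∞ a V ∧ ContDiffOn ℝ ∞ k V ∧ ContDiffOn ℝ n f (J ×ˢ univ) ∧
    KEquationIII c σ V a k ∧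
    (∀ p ∈ V, ∀ u v : ℝ, g (p, u, v) =
      box c a p * v + k p * u
        + Real.exp ((3 * σ * c * dx a p - dt a p) / 2)
          * f (p.2 + σ * c * p.1, u * Real.exp ((σ * c * dx a p + dt a p) / 2))) ∧
    ∀ p ∈ V,
      Q1 p = κ * Real.exp (dt a p - σ * c * dx a p) ∧
      Q2 p = κ * (Real.exp (dt a p - σ * c * dx a p) * (-(σ * c))) ∧
      Q0 p = κ * (Real.exp (dt a p - σ * c * dx a p) * (1 / 2 * box c a p))

/-- The first-order linear equation for `k` in case (iv), where `C` and `S` stand for the two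
hyperbolic functions of `c a_x` and `□ = ∂_t² - c² ∂_x²`. -/
def KEquationIV (c : ℝ) (C S : ℝ → ℝ) (V : Set (ℝ × ℝ)) (a k : ℝ × ℝ → ℝ) : Prop :=
  ∀ p ∈ V,
    2 * C (c * dx a p) * dt k p + 2 * c * S (c * dx a p) * dx k p
      + 4 * c * (dt (dx a) p * S (c * dx a p) + c * dx (dx a) p * C (c * dx a p)) * k p
      - (c ^ 2 * dx (dx a) p * (box c a p ^ 2 + 2 * dt (box c a) p)
          - 2 * c ^ 2 * dt (dx a) p * dx (box c a) p
          + box c a p * dt (box c a) p + box c (box c a) p) * C (c * dx a p)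
      - c * (dt (dx a) p * (box c a p ^ 2 + 2 * dt (box c a) p)
          - 2 * c ^ 2 * dx (dx a) p * dx (box c a) p
          + box c a p * dx (box c a) p) * S (c * dx a p) = 0

/-- Case (iv), where `(C, S)` is `(cosh, sinh)` or `(sinh, cosh)`, evaluated at `c a_x`:
`g = (□a) u_t + k u + e^{(3b - 4a_t)/2} f(b₀, u e^{b/2})` and
`Q = κ e^{a_t} (C (u_t + ½ (□a) u) + c S u_x)`, with `C b₀_t + c S b₀_x = 0` and
`C b_t + c S b_x = C □a`. -/
def CaseIV (n : ℕ∞) (c : ℝ) (V : Set (ℝ × ℝ)) (g : (ℝ × ℝ) × ℝ × ℝ → ℝ)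
    (Q1 Q2 Q0 : ℝ × ℝ → ℝ) : Prop :=
  ∃ (C S : ℝ → ℝ) (κ : ℝ) (J : Set ℝ) (a b b0 k f : ℝ × ℝ → ℝ),
    ((C = Real.cosh ∧ S = Real.sinh) ∨ (C = Real.sinh ∧ S = Real.cosh)) ∧
    κ ≠ 0 ∧ IsOpen J ∧ (∀ p ∈ V, b0 p ∈ J) ∧
    ContDiffOn ℝ ∞ a V ∧ ContDiffOn ℝ ∞ b V ∧ ContDiffOn ℝ ∞ b0 V ∧ ContDiffOn ℝ ∞ k V ∧
    ContDiffOn ℝ n f (J ×ˢ univ) ∧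
    (∀ p ∈ V, C (c * dx a p) * dt b0 p + c * S (c * dx a p) * dx b0 p = 0) ∧
    (∀ p ∈ V, C (c * dx a p) * dt b p + c * S (c * dx a p) * dx b p =
      C (c * dx a p) * box c a p) ∧
    KEquationIV c C S V a k ∧
    (∀ p ∈ V, ∀ u v : ℝ, g (p, u, v) =
      box c a p * v + k p * u
        + Real.exp ((3 * b p - 4 * dt a p) / 2) * f (b0 p, u * Real.exp (b p / 2))) ∧
    ∀ p ∈ V,
      Q1 p = κ * (Real.exp (dt a p) * C (c * dx a p)) ∧
      Q2 p = κ * (Real.exp (dt a p) * (c * S (c * dx a p))) ∧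
      Q0 p = κ * (Real.exp (dt a p) * (C (c * dx a p) * (1 / 2 * box c a p)))

/-- `p` is a generic point for the coefficients: `Q₁` and `Q₂` do not both vanish at `p`, and each
of `Q₁`, `Q₂`, `Q₂² - c² Q₁²` is either nonzero at `p` or identically zero near `p`. -/
def IsGenericPointFor (c : ℝ) (Q1 Q2 : ℝ × ℝ → ℝ) (p : ℝ × ℝ) : Prop :=
  (Q1 p ≠ 0 ∨ Q2 p ≠ 0) ∧
  (Q1 p ≠ 0 ∨ ∀ᶠ q in 𝓝 p, Q1 q = 0) ∧
  (Q2 p ≠ 0 ∨ ∀ᶠ q in 𝓝 p, Q2 q = 0) ∧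
  (Q2 p ^ 2 - c ^ 2 * Q1 p ^ 2 ≠ 0 ∨ ∀ᶠ q in 𝓝 p, Q2 q ^ 2 - c ^ 2 * Q1 q ^ 2 = 0)

end

/-! ### Partial derivatives in the plane -/

section PartialDerivatives

variable {w w₁ w₂ : ℝ × ℝ → ℝ} {p : ℝ × ℝ} {V : Set (ℝ × ℝ)}

/-! Integration by parts turns `(u_tt - c² u_xx) Q` into a divergence plus a quadratic form in `u`,
`u_t`, `u_x` (`wave_mul_multExpr`). So for a multiplier, what remains of `(u_tt - c² u_xx + g) Q`,
namely `reducedLagrangian`, is itself a divergence. It depends on first-order jets only, whatever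
the order of `T` and `Ψ`. As `T` and `Ψ` are merely `C¹`, no Euler operator is applied to them.
Instead the integral of the remainder is unchanged by compactly supported variations of `u`, hence
the remainder satisfies the Euler–Lagrange equation for every `u`, and testing with quadratic
polynomials makes second derivatives free variables (`IsNullLagrangian.euler_lagrange`). The
coefficients of `u_tt`, `u_tx`, `u_xx` and the rest give the determining equations.

These say that, where `Q₁ ≠ 0` or where `Q₁` vanishes identically and `Q₂ ≠ 0`, `g = G u_t + h(t, x,
u)`. Here `Q₁`, `Q₂`, `Q₀`, `G` satisfy a linear first-order system (`DampingEquations`), and `h`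
satisfies an inhomogeneous linear transport equation along `Q₁ ∂_t + Q₂ ∂_x` (`SourceEquation`). For
`Q₁ ≠ 0` the latter is solved by characteristics: a particular solution `k u`, plus `e^M f(b₀, u
e^{b/2})` with `b₀` and `u e^{b/2}` invariant along the flow and `f` arbitrary
(`FlowBox.exists_canonical`). This needs a smooth flow box, built from Picard–Lindelöf and the
inverse function theorem.

The four cases come from solving the damping system. If `Q₁ = 0` or `Q₂ = 0`, the other coefficient
depends on `t` only. Otherwise the components `c Q₁ ± Q₂` are transported with speeds `∓c` and
growth rate `G`. If one of them vanishes, one transport equation yields `a`; if neither does, their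
logarithms form a closed pair whose potential is `a`. In both situations `□a = G`, and the signs of
the components decide between `cosh` and `sinh`.

Conversely, all four cases satisfy the same canonical equations, and from these a density and flux
are written down explicitly, without dividing by `Q₁` or `Q₂` (`isMultiplier_of_canonical`). Density
of generic points is a topological dichotomy applied three times, together with `2 Q₀ = Q₁_t -
Q₂_x`. -/

theorem hasDerivAt_slice_fst (h : DifferentiableAt ℝ w p) :
    HasDerivAt (fun s => w (s, p.2)) (fderiv ℝ w p (1, 0)) p.1 := by
  have h1 : HasDerivAt (fun s : ℝ => (s, p.2)) ((1 : ℝ), (0 : ℝ)) p.1 :=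
    (hasDerivAt_id p.1).prodMk (hasDerivAt_const p.1 p.2)
  exact HasFDerivAt.comp_hasDerivAt (f := fun s : ℝ => (s, p.2)) p.1 h.hasFDerivAt h1

theorem hasDerivAt_slice_snd (h : DifferentiableAt ℝ w p) :
    HasDerivAt (fun y => w (p.1, y)) (fderiv ℝ w p (0, 1)) p.2 := by
  have h1 : HasDerivAt (fun y : ℝ => (p.1, y)) ((0 : ℝ), (1 : ℝ)) p.2 :=
    (hasDerivAt_const p.2 p.1).prodMk (hasDerivAt_id p.2)
  exact HasFDerivAt.comp_hasDerivAt (f := fun y : ℝ => (p.1, y)) p.2 h.hasFDerivAt h1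

theorem dt_eq_fderiv (h : DifferentiableAt ℝ w p) : dt w p = fderiv ℝ w p (1, 0) :=
  (hasDerivAt_slice_fst h).deriv

theorem dx_eq_fderiv (h : DifferentiableAt ℝ w p) : dx w p = fderiv ℝ w p (0, 1) :=
  (hasDerivAt_slice_snd h).deriv

theorem hasDerivAt_dt (h : DifferentiableAt ℝ w p) :
    HasDerivAt (fun s => w (s, p.2)) (dt w p) p.1 := by
  rw [dt_eq_fderiv h]; exact hasDerivAt_slice_fst h

theorem hasDerivAt_dx (h : DifferentiableAt ℝ w p) :
    HasDerivAt (fun y => w (p.1, y)) (dx w p) p.2 := by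
  rw [dx_eq_fderiv h]; exact hasDerivAt_slice_snd h

theorem fderiv_apply_eq (h : DifferentiableAt ℝ w p) (a b : ℝ) :
    fderiv ℝ w p (a, b) = a * dt w p + b * dx w p := by
  rw [dt_eq_fderiv h, dx_eq_fderiv h]
  have : ((a, b) : ℝ × ℝ) = a • ((1 : ℝ), (0 : ℝ)) + b • ((0 : ℝ), (1 : ℝ)) := by simp
  rw [this, map_add, map_smul, map_smul, smul_eq_mul, smul_eq_mul]

theorem Filter.EventuallyEq.dt_eq (h : w₁ =ᶠ[𝓝 p] w₂) : dt w₁ p = dt w₂ p := by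
  apply Filter.EventuallyEq.deriv_eq
  have : Tendsto (fun s : ℝ => (s, p.2)) (𝓝 p.1) (𝓝 p) := by
    apply Continuous.tendsto' (by fun_prop); rfl
  exact this.eventually h

theorem Filter.EventuallyEq.dx_eq (h : w₁ =ᶠ[𝓝 p] w₂) : dx w₁ p = dx w₂ p := by
  apply Filter.EventuallyEq.deriv_eq
  have : Tendsto (fun y : ℝ => (p.1, y)) (𝓝 p.2) (𝓝 p) := by
    apply Continuous.tendsto' (by fun_prop); rfl
  exact this.eventually h

theorem Filter.EventuallyEq.eventuallyEq_dt (h : w₁ =ᶠ[𝓝 p] w₂) : dt w₁ =ᶠ[𝓝 p] dt w₂ := by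
  filter_upwards [h.eventuallyEq_nhds] with q hq using hq.dt_eq

theorem Filter.EventuallyEq.eventuallyEq_dx (h : w₁ =ᶠ[𝓝 p] w₂) : dx w₁ =ᶠ[𝓝 p] dx w₂ := by
  filter_upwards [h.eventuallyEq_nhds] with q hq using hq.dx_eq

theorem Set.EqOn.dt (hV : IsOpen V) (h : EqOn w₁ w₂ V) : EqOn (dt w₁) (dt w₂) V :=
  fun _ hp => (h.eventuallyEq_of_mem (hV.mem_nhds hp)).dt_eq

theorem Set.EqOn.dx (hV : IsOpen V) (h : EqOn w₁ w₂ V) : EqOn (dx w₁) (dx w₂) V :=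
  fun _ hp => (h.eventuallyEq_of_mem (hV.mem_nhds hp)).dx_eq

theorem Set.EqOn.box {c : ℝ} (hV : IsOpen V) (h : EqOn w₁ w₂ V) : EqOn (box c w₁) (box c w₂) V := by
  intro p hp
  simp only [_root_.box, ((h.dt hV).dt hV) hp, ((h.dx hV).dx hV) hp]

theorem ContDiffOn.dAt (hV : IsOpen V) {n : WithTop ℕ∞} (hn : n ≠ 0) (h : ContDiffOn ℝ n w V)
    (hp : p ∈ V) : DifferentiableAt ℝ w p :=
  (h.contDiffAt (hV.mem_nhds hp)).differentiableAt hn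

theorem ContDiffOn.smoothAt (hV : IsOpen V) (h : ContDiffOn ℝ ∞ w V) (hp : p ∈ V) :
    DifferentiableAt ℝ w p :=
  h.dAt hV (by simp) hp

theorem ContDiffOn.dt_of_le (hV : IsOpen V) {m n : WithTop ℕ∞} (hmn : m + 1 ≤ n)
    (h : ContDiffOn ℝ n w V) : ContDiffOn ℝ m (dt w) V := by
  have h1 : ContDiffOn ℝ m (fun p => fderiv ℝ w p (1, 0)) V :=
    (h.fderiv_of_isOpen hV hmn).clm_apply contDiffOn_const
  refine h1.congr fun q hq => dt_eq_fderiv (h.dAt hV ?_ hq)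
  rintro rfl
  simp at hmn

theorem ContDiffOn.dx_of_le (hV : IsOpen V) {m n : WithTop ℕ∞} (hmn : m + 1 ≤ n)
    (h : ContDiffOn ℝ n w V) : ContDiffOn ℝ m (dx w) V := by
  have h1 : ContDiffOn ℝ m (fun p => fderiv ℝ w p (0, 1)) V :=
    (h.fderiv_of_isOpen hV hmn).clm_apply contDiffOn_const
  refine h1.congr fun q hq => dx_eq_fderiv (h.dAt hV ?_ hq)
  rintro rfl
  simp at hmn

theorem ContDiffOn.dt (hV : IsOpen V) (h : ContDiffOn ℝ ∞ w V) : ContDiffOn ℝ ∞ (dt w) V :=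
  h.dt_of_le hV (by simp)

theorem ContDiffOn.dx (hV : IsOpen V) (h : ContDiffOn ℝ ∞ w V) : ContDiffOn ℝ ∞ (dx w) V :=
  h.dx_of_le hV (by simp)

theorem ContDiffOn.box {c : ℝ} (hV : IsOpen V) (h : ContDiffOn ℝ ∞ w V) :
    ContDiffOn ℝ ∞ (box c w) V :=
  ((h.dt hV).dt hV).sub (contDiffOn_const.mul ((h.dx hV).dx hV))

theorem ContDiff.dt (h : ContDiff ℝ ∞ w) : ContDiff ℝ ∞ (dt w) :=
  contDiffOn_univ.1 (h.contDiffOn.dt isOpen_univ)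

theorem ContDiff.dx (h : ContDiff ℝ ∞ w) : ContDiff ℝ ∞ (dx w) :=
  contDiffOn_univ.1 (h.contDiffOn.dx isOpen_univ)

theorem dt_dx_comm (hV : IsOpen V) (h : ContDiffOn ℝ ∞ w V) (hp : p ∈ V) :
    dt (dx w) p = dx (dt w) p := by
  have e1 : EqOn (dt w) (fun p => fderiv ℝ w p (1, 0)) V := fun q hq =>
    dt_eq_fderiv (h.smoothAt hV hq)
  have e2 : EqOn (dx w) (fun p => fderiv ℝ w p (0, 1)) V := fun q hq =>
    dx_eq_fderiv (h.smoothAt hV hq)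
  have hc := h.contDiffAt (hV.mem_nhds hp)
  have hd : DifferentiableAt ℝ (fderiv ℝ w) p :=
    (hc.fderiv_right (m := 1) (by norm_cast)).differentiableAt (by simp)
  have hs : IsSymmSndFDerivAt ℝ w p := hc.isSymmSndFDerivAt (by simp; norm_cast)
  rw [e1.dx hV hp, e2.dt hV hp, dt_eq_fderiv (hd.clm_apply (differentiableAt_const _)),
    dx_eq_fderiv (hd.clm_apply (differentiableAt_const _)),
    fderiv_clm_apply hd (differentiableAt_const _), fderiv_clm_apply hd (differentiableAt_const _)]
  simpa using hs (1, 0) (0, 1)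

theorem dt_add (h₁ : DifferentiableAt ℝ w₁ p) (h₂ : DifferentiableAt ℝ w₂ p) :
    dt (fun q => w₁ q + w₂ q) p = dt w₁ p + dt w₂ p :=
  ((hasDerivAt_dt h₁).add (hasDerivAt_dt h₂)).deriv

theorem dx_add (h₁ : DifferentiableAt ℝ w₁ p) (h₂ : DifferentiableAt ℝ w₂ p) :
    dx (fun q => w₁ q + w₂ q) p = dx w₁ p + dx w₂ p :=
  ((hasDerivAt_dx h₁).add (hasDerivAt_dx h₂)).deriv

theorem dt_sub (h₁ : DifferentiableAt ℝ w₁ p) (h₂ : DifferentiableAt ℝ w₂ p) :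
    dt (fun q => w₁ q - w₂ q) p = dt w₁ p - dt w₂ p :=
  ((hasDerivAt_dt h₁).sub (hasDerivAt_dt h₂)).deriv

theorem dx_sub (h₁ : DifferentiableAt ℝ w₁ p) (h₂ : DifferentiableAt ℝ w₂ p) :
    dx (fun q => w₁ q - w₂ q) p = dx w₁ p - dx w₂ p :=
  ((hasDerivAt_dx h₁).sub (hasDerivAt_dx h₂)).deriv

theorem dt_mul (h₁ : DifferentiableAt ℝ w₁ p) (h₂ : DifferentiableAt ℝ w₂ p) :
    dt (fun q => w₁ q * w₂ q) p = dt w₁ p * w₂ p + w₁ p * dt w₂ p :=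
  ((hasDerivAt_dt h₁).mul (hasDerivAt_dt h₂)).deriv

theorem dx_mul (h₁ : DifferentiableAt ℝ w₁ p) (h₂ : DifferentiableAt ℝ w₂ p) :
    dx (fun q => w₁ q * w₂ q) p = dx w₁ p * w₂ p + w₁ p * dx w₂ p :=
  ((hasDerivAt_dx h₁).mul (hasDerivAt_dx h₂)).deriv

theorem dt_const (k : ℝ) : dt (fun _ => k) p = 0 := (hasDerivAt_const p.1 k).deriv

theorem dx_const (k : ℝ) : dx (fun _ => k) p = 0 := (hasDerivAt_const p.2 k).deriv

theorem dt_comp_fst (f : ℝ → ℝ) : dt (fun q => f q.1) p = deriv f p.1 := rfl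

theorem dx_comp_fst (f : ℝ → ℝ) : dx (fun q => f q.1) p = 0 :=
  (hasDerivAt_const p.2 (f p.1)).deriv

theorem dt_comp_snd (f : ℝ → ℝ) : dt (fun q => f q.2) p = 0 :=
  (hasDerivAt_const p.1 (f p.2)).deriv

end PartialDerivatives

/-! ### Integrals depending smoothly on a parameter -/

section ParametricIntegral

variable {E : Type*} [NormedAddCommGroup E] [NormedSpace ℝ E]

/-- The integral is the value at `0` of the convolution of the indicator of `(0, 1]` with the
reflected integrand, and convolutions with a compactly supported smooth factor depend smoothly on a
parameter. A tube around `{p₀} × [0, 1]` and a cutoff supply the compact support. -/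
theorem contDiffAt_integral_unitInterval {U : Set (E × ℝ)} (hU : IsOpen U) {n : ℕ∞}
    {F : E × ℝ → ℝ} (hF : ContDiffOn ℝ n F U) {p₀ : E} (hp : ∀ θ ∈ Icc (0 : ℝ) 1, (p₀, θ) ∈ U) :
    ContDiffAt ℝ n (fun p => ∫ θ in (0 : ℝ)..1, F (p, θ)) p₀ := by
  obtain ⟨W, Θ, hW, hΘ, hpW, hIΘ, hWU⟩ := generalized_tube_lemma (s := {p₀}) isCompact_singleton
    (t := Icc (0 : ℝ) 1) isCompact_Icc hU
    (by rintro ⟨p, θ⟩ ⟨h1, h2⟩; obtain rfl : p = p₀ := h1; exact hp θ h2)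
  obtain ⟨ε, hε, hεΘ⟩ : ∃ ε > 0, Metric.cthickening ε (Icc (0 : ℝ) 1) ⊆ Θ :=
    isCompact_Icc.exists_cthickening_subset_open hΘ hIΘ
  have hball : Metric.closedBall (1 / 2 : ℝ) (1 / 2 + ε) ⊆ Θ := by
    refine Subset.trans ?_ hεΘ
    intro x hx
    rw [Real.closedBall_eq_Icc] at hx
    -- The point of `[0, 1]` nearest to `x`.
    have h0 : max 0 (min x 1) ∈ Icc (0 : ℝ) 1 :=
      ⟨le_max_left _ _, max_le zero_le_one (min_le_right _ _)⟩
    refine Metric.mem_cthickening_of_dist_le x _ ε _ h0 ?_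
    rw [Real.dist_eq, abs_le]
    have h1 := hx.1
    have h2 := hx.2
    rcases le_total x 1 with h | h <;> rcases le_total 0 x with h' | h' <;>
      simp only [min_eq_left h, min_eq_right h, max_eq_left, max_eq_right, zero_le_one, h'] <;>
      constructor <;> linarith
  -- Equal to `1` on `[0, 1]` and zero outside `[-ε, 1 + ε]`, where `F` is still defined.
  let χ : ContDiffBump (1 / 2 : ℝ) := ⟨1 / 2, 1 / 2 + ε, by norm_num, by linarith⟩
  let g : E → ℝ → ℝ := fun p y => χ (-y) * F (p, -y)
  have hg : ContDiffOn ℝ n (fun q : E × ℝ => χ q.2 * F q) (W ×ˢ univ) := by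
    intro q hq
    apply ContDiffAt.contDiffWithinAt
    by_cases h : q.2 ∈ Metric.closedBall (1 / 2 : ℝ) (1 / 2 + ε)
    · refine ContDiffAt.mul (χ.contDiff.contDiffAt.comp q contDiffAt_snd) ?_
      exact hF.contDiffAt (hU.mem_nhds (hWU ⟨hq.1, hball h⟩))
    · refine (contDiffAt_const (c := (0 : ℝ))).congr_of_eventuallyEq ?_
      have : ∀ᶠ r : E × ℝ in 𝓝 q, r.2 ∈ (Metric.closedBall (1 / 2 : ℝ) (1 / 2 + ε))ᶜ :=
        continuous_snd.continuousAt.preimage_mem_nhds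
          (Metric.isClosed_closedBall.isOpen_compl.mem_nhds h)
      filter_upwards [this] with r hr
      rw [χ.zero_of_le_dist, zero_mul]
      exact (not_le.1 (fun h => hr (Metric.mem_closedBall.2 h))).le
  have key := MeasureTheory.contDiffOn_convolution_right_with_param
    (μ := MeasureTheory.volume) (𝕜 := ℝ) (f := (Ioc (0 : ℝ) 1).indicator (fun _ => (1 : ℝ))) (n := n)
    (ContinuousLinearMap.mul ℝ ℝ) (g := g) (s := W)
    (k := Metric.closedBall (-(1 / 2) : ℝ) (1 / 2 + ε)) hW
    (isCompact_closedBall _ _) (by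
      intro p x _ hx
      simp only [g]
      rw [χ.zero_of_le_dist, zero_mul]
      have := not_le.1 (fun h => hx (Metric.mem_closedBall.2 h))
      rw [Real.dist_eq] at this ⊢
      change 1 / 2 + ε ≤ _
      rw [show -x - 1 / 2 = -(x - -(1 / 2)) by ring, abs_neg]
      exact this.le)
    ((MeasureTheory.locallyIntegrable_const _).indicator measurableSet_Ioc)
    (by
      have : ContDiffOn ℝ n (fun q : E × ℝ => (q.1, -q.2)) (W ×ˢ univ) := by fun_prop
      exact hg.comp this (fun q hq => ⟨hq.1, mem_univ _⟩))
  have key2 : ContDiffOn ℝ n (fun p : E => (p, (0 : ℝ))) W := by fun_prop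
  have key3 := key.comp key2 (fun q hq => ⟨hq, mem_univ _⟩)
  refine (key3.contDiffAt (hW.mem_nhds (hpW rfl))).congr_of_eventuallyEq (Eventually.of_forall ?_)
  intro p
  simp only [Function.comp_def, MeasureTheory.convolution, g]
  rw [intervalIntegral.integral_of_le zero_le_one,
    ← MeasureTheory.integral_indicator measurableSet_Ioc]
  congr 1
  ext θ
  by_cases hθ : θ ∈ Ioc (0 : ℝ) 1
  · have : χ θ = 1 := by
      apply χ.one_of_mem_closedBall
      change θ ∈ Metric.closedBall (1 / 2 : ℝ) (1 / 2)
      rw [Real.closedBall_eq_Icc]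
      constructor <;> linarith [hθ.1, hθ.2]
    simp [hθ, this]
  · simp [hθ]

/-- Moves a variable endpoint into the integrand, so that primitives become parametric integrals
over a fixed interval. -/
theorem integral_eq_mul_integral_unitInterval (f : ℝ → ℝ) (a b : ℝ) :
    ∫ s in a..b, f s = (b - a) * ∫ θ in (0 : ℝ)..1, f (a + θ * (b - a)) := by
  have := intervalIntegral.smul_integral_comp_add_mul f (a := 0) (b := 1) (b - a) a
  simp only [smul_eq_mul, mul_zero, add_zero, mul_one, add_sub_cancel] at this
  rw [← this]
  simp only [mul_comm]

/-- The primitive with respect to the last variable is as smooth as the integrand. -/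
theorem contDiffAt_primitive {U : Set (E × ℝ)} (hU : IsOpen U) {n : ℕ∞}
    {F : E × ℝ → ℝ} (hF : ContDiffOn ℝ n F U) {p₀ : E} {a t : ℝ}
    (hp : ∀ θ ∈ uIcc a t, (p₀, θ) ∈ U) :
    ContDiffAt ℝ n (fun q : E × ℝ => ∫ s in a..q.2, F (q.1, s)) (p₀, t) := by
  have he : (fun q : E × ℝ => ∫ s in a..q.2, F (q.1, s)) =
      fun q => (q.2 - a) * ∫ θ in (0 : ℝ)..1, F (q.1, a + θ * (q.2 - a)) :=
    funext fun q => integral_eq_mul_integral_unitInterval _ _ _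
  rw [he]
  have hc : ContDiff ℝ n (fun q : (E × ℝ) × ℝ => (q.1.1, a + q.2 * (q.1.2 - a))) := by fun_prop
  have h1 : ContDiffOn ℝ n (fun q : (E × ℝ) × ℝ => F (q.1.1, a + q.2 * (q.1.2 - a)))
      ((fun q : (E × ℝ) × ℝ => (q.1.1, a + q.2 * (q.1.2 - a))) ⁻¹' U) :=
    hF.comp hc.contDiffOn (fun q hq => hq)
  have := contDiffAt_integral_unitInterval (hU.preimage hc.continuous) h1 (p₀ := (p₀, t)) (by
    intro θ hθ
    refine hp _ ?_
    rcases le_total a t with h | h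
    · rw [uIcc_of_le h]
      constructor <;> nlinarith [hθ.1, hθ.2]
    · rw [uIcc_of_ge h]
      constructor <;> nlinarith [hθ.1, hθ.2])
  exact ContDiffAt.mul (by fun_prop) this

/-- Supplies the potential of the arbitrary function `f` that enters the conserved density. -/
theorem exists_primitive_snd {J : Set ℝ} (hJ : IsOpen J) {n : ℕ∞} {f : ℝ × ℝ → ℝ}
    (hf : ContDiffOn ℝ n f (J ×ˢ univ)) :
    ∃ F : ℝ × ℝ → ℝ, ContDiffOn ℝ n F (J ×ˢ univ) ∧
      ∀ y ∈ J, ∀ z, HasDerivAt (fun s => F (y, s)) (f (y, z)) z := by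
  refine ⟨fun q => ∫ s in (0 : ℝ)..q.2, f (q.1, s), fun q hq => ?_, fun y hy z => ?_⟩
  · exact (contDiffAt_primitive (hJ.prod isOpen_univ) hf
      (fun θ _ => ⟨hq.1, mem_univ _⟩)).contDiffWithinAt
  · have hc : Continuous fun s => f (y, s) :=
      hf.continuousOn.comp_continuous (by fun_prop) (fun s => ⟨hy, mem_univ _⟩)
    exact hc.integral_hasStrictDerivAt 0 z |>.hasDerivAt

end ParametricIntegral

/-! ### The energy–momentum identity and multipliers in canonical form -/

noncomputable section

/-- The density of the part of `(u_tt - c² u_xx) Q` that is a divergence. -/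
def waveDensity (c : ℝ) (Q1 Q2 Q0 u : ℝ × ℝ → ℝ) (q : ℝ × ℝ) : ℝ :=
  1 / 2 * Q1 q * dt u q ^ 2 + Q2 q * dt u q * dx u q + Q0 q * u q * dt u q
    - 1 / 2 * dt Q0 q * u q ^ 2 + 1 / 2 * c ^ 2 * Q1 q * dx u q ^ 2

/-- The flux of the part of `(u_tt - c² u_xx) Q` that is a divergence. -/
def waveFlux (c : ℝ) (Q1 Q2 Q0 u : ℝ × ℝ → ℝ) (q : ℝ × ℝ) : ℝ :=
  -(1 / 2 * Q2 q * dt u q ^ 2) - c ^ 2 * Q1 q * dt u q * dx u q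
    - 1 / 2 * c ^ 2 * Q2 q * dx u q ^ 2 - c ^ 2 * Q0 q * u q * dx u q
    + 1 / 2 * c ^ 2 * dx Q0 q * u q ^ 2

/-- Every product of a second derivative of `u` with a term of `Q` is a derivative of a quadratic
expression, up to terms in which a coefficient is differentiated. Those terms form the leftover
quadratic form, which contains no second derivatives of `u`. -/
theorem wave_mul_multExpr {c : ℝ} {V : Set (ℝ × ℝ)} (hV : IsOpen V) {Q1 Q2 Q0 u : ℝ × ℝ → ℝ}
    (h1 : ContDiffOn ℝ ∞ Q1 V) (h2 : ContDiffOn ℝ ∞ Q2 V) (h0 : ContDiffOn ℝ ∞ Q0 V)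
    (hu : ContDiffOn ℝ ∞ u V) {p : ℝ × ℝ} (hp : p ∈ V) :
    (dt (dt u) p - c ^ 2 * dx (dx u) p) * multExpr Q1 Q2 Q0 u p =
      dt (waveDensity c Q1 Q2 Q0 u) p + dx (waveFlux c Q1 Q2 Q0 u) p
      + 1 / 2 * (dx Q2 p - dt Q1 p - 2 * Q0 p) * dt u p ^ 2
      + c ^ 2 / 2 * (dx Q2 p - dt Q1 p + 2 * Q0 p) * dx u p ^ 2
      + (c ^ 2 * dx Q1 p - dt Q2 p) * dt u p * dx u p + 1 / 2 * box c Q0 p * u p ^ 2 := by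
  have at1 := hasDerivAt_dt (h1.smoothAt hV hp)
  have at2 := hasDerivAt_dt (h2.smoothAt hV hp)
  have at0 := hasDerivAt_dt (h0.smoothAt hV hp)
  have atu := hasDerivAt_dt (hu.smoothAt hV hp)
  have atv := hasDerivAt_dt ((hu.dt hV).smoothAt hV hp)
  have atw := hasDerivAt_dt ((hu.dx hV).smoothAt hV hp)
  have at0' := hasDerivAt_dt ((h0.dt hV).smoothAt hV hp)
  have ax1 := hasDerivAt_dx (h1.smoothAt hV hp)
  have ax2 := hasDerivAt_dx (h2.smoothAt hV hp)
  have ax0 := hasDerivAt_dx (h0.smoothAt hV hp)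
  have axu := hasDerivAt_dx (hu.smoothAt hV hp)
  have axv := hasDerivAt_dx ((hu.dt hV).smoothAt hV hp)
  have axw := hasDerivAt_dx ((hu.dx hV).smoothAt hV hp)
  have ax0' := hasDerivAt_dx ((h0.dx hV).smoothAt hV hp)
  have hT := (((((at1.const_mul (1 / 2)).mul (atv.pow 2)).add ((at2.mul atv).mul atw)).add
    ((at0.mul atu).mul atv)).sub ((at0'.const_mul (1 / 2)).mul (atu.pow 2))).add
    ((at1.const_mul (1 / 2 * c ^ 2)).mul (atw.pow 2))
  have hX := ((((((ax2.const_mul (1 / 2)).mul (axv.pow 2)).neg).sub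
    (((ax1.const_mul (c ^ 2)).mul axv).mul axw)).sub
    ((ax2.const_mul (1 / 2 * c ^ 2)).mul (axw.pow 2))).sub
    (((ax0.const_mul (c ^ 2)).mul axu).mul axw)).add
    ((ax0'.const_mul (1 / 2 * c ^ 2)).mul (axu.pow 2))
  have eT : dt (waveDensity c Q1 Q2 Q0 u) p = _ := hT.deriv
  have eX : dx (waveFlux c Q1 Q2 Q0 u) p = _ := hX.deriv
  rw [eT, eX]
  simp only [Prod.mk.eta, dt_dx_comm hV hu hp, multExpr, box, Nat.cast_ofNat, Nat.add_one_sub_one,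
    pow_one, Pi.mul_apply, Pi.pow_apply]
  ring

/-- The first determining equations of a multiplier: `2 Q₀ = Q₁_t - Q₂_x`, `Q₁ G = 2 Q₀` and
`Q₂ G = Q₂_t - c² Q₁_x`, where `G` is the coefficient of `u_t` in `g`. -/
structure DampingEquations (c : ℝ) (V : Set (ℝ × ℝ)) (Q1 Q2 Q0 G : ℝ × ℝ → ℝ) : Prop where
  smooth1 : ContDiffOn ℝ ∞ Q1 V
  smooth2 : ContDiffOn ℝ ∞ Q2 V
  smooth0 : ContDiffOn ℝ ∞ Q0 V
  smoothG : ContDiffOn ℝ ∞ G V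
  two_mul_Q0 : ∀ p ∈ V, 2 * Q0 p = dt Q1 p - dx Q2 p
  Q1_mul : ∀ p ∈ V, Q1 p * G p = 2 * Q0 p
  Q2_mul : ∀ p ∈ V, Q2 p * G p = dt Q2 p - c ^ 2 * dx Q1 p

/-- The equation for the coefficient `k` of the linear term of `g`. -/
def LinearTermEquation (c : ℝ) (V : Set (ℝ × ℝ)) (Q1 Q2 G k : ℝ × ℝ → ℝ) : Prop :=
  ∀ p ∈ V, 2 * Q1 p * dt k p + 2 * Q2 p * dx k p + 4 * dx Q2 p * k p =
    dx Q2 p * (G p ^ 2 + 2 * dt G p) + G p * dx G p * Q2 p + G p * dt G p * Q1 p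
      - 2 * c ^ 2 * dx Q1 p * dx G p + Q1 p * box c G p

namespace DampingEquations

variable {c : ℝ} {V : Set (ℝ × ℝ)} {Q1 Q2 Q0 G : ℝ × ℝ → ℝ}

theorem mono {W : Set (ℝ × ℝ)} (h : DampingEquations c V Q1 Q2 Q0 G) (hW : W ⊆ V) :
    DampingEquations c W Q1 Q2 Q0 G :=
  ⟨h.smooth1.mono hW, h.smooth2.mono hW, h.smooth0.mono hW, h.smoothG.mono hW,
    fun p hp => h.two_mul_Q0 p (hW hp), fun p hp => h.Q1_mul p (hW hp),
    fun p hp => h.Q2_mul p (hW hp)⟩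

/-- The source equation produces `□Q₀ - (G Q₀)_t`, while the equation for `k` is written in `Q₁`,
`Q₂`, `G` alone. To pass between them, put `Q₀ = ½ Q₁ G` and eliminate the second derivatives of
`Q₁` through `Q₁_tt - c² Q₁_xx = (Q₁ G)_t + (Q₂ G)_x`, a consequence of the damping equations. -/
theorem two_mul_box_sub (hV : IsOpen V) (h : DampingEquations c V Q1 Q2 Q0 G) {p : ℝ × ℝ}
    (hp : p ∈ V) :
    2 * (box c Q0 p - dt (fun q => G q * Q0 q) p) =
      dx Q2 p * (G p ^ 2 + 2 * dt G p) + G p * dx G p * Q2 p + G p * dt G p * Q1 p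
      - 2 * c ^ 2 * dx Q1 p * dx G p + Q1 p * box c G p := by
  obtain ⟨s1, s2, s0, sG, e1, e2, e3⟩ := h
  have d1 := fun {q} (hq : q ∈ V) => s1.smoothAt hV hq
  have d2 := fun {q} (hq : q ∈ V) => s2.smoothAt hV hq
  have dG := fun {q} (hq : q ∈ V) => sG.smoothAt hV hq
  have d1t := fun {q} (hq : q ∈ V) => (s1.dt hV).smoothAt hV hq
  have d1x := fun {q} (hq : q ∈ V) => (s1.dx hV).smoothAt hV hq
  have d2t := fun {q} (hq : q ∈ V) => (s2.dt hV).smoothAt hV hq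
  have d2x := fun {q} (hq : q ∈ V) => (s2.dx hV).smoothAt hV hq
  have dGt := fun {q} (hq : q ∈ V) => (sG.dt hV).smoothAt hV hq
  have dGx := fun {q} (hq : q ∈ V) => (sG.dx hV).smoothAt hV hq
  have E0 : EqOn Q0 (fun q => 1 / 2 * (Q1 q * G q)) V := fun q hq => by simp only [e2 q hq]; ring
  have E0t : EqOn (dt Q0) (fun q => 1 / 2 * (dt Q1 q * G q + Q1 q * dt G q)) V := fun q hq => by
    rw [E0.dt hV hq]
    exact (((hasDerivAt_dt (d1 hq)).mul (hasDerivAt_dt (dG hq))).const_mul (1 / 2)).deriv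
  have E0x : EqOn (dx Q0) (fun q => 1 / 2 * (dx Q1 q * G q + Q1 q * dx G q)) V := fun q hq => by
    rw [E0.dx hV hq]
    exact (((hasDerivAt_dx (d1 hq)).mul (hasDerivAt_dx (dG hq))).const_mul (1 / 2)).deriv
  have E0tt : dt (dt Q0) p = 1 / 2 * (dt (dt Q1) p * G p + 2 * dt Q1 p * dt G p
      + Q1 p * dt (dt G) p) := by
    rw [E0t.dt hV hp]
    refine ((((hasDerivAt_dt (d1t hp)).mul (hasDerivAt_dt (dG hp))).add
      ((hasDerivAt_dt (d1 hp)).mul (hasDerivAt_dt (dGt hp)))).const_mul (1 / 2)).deriv.trans ?_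
    simp only [Prod.mk.eta]
    ring
  have E0xx : dx (dx Q0) p = 1 / 2 * (dx (dx Q1) p * G p + 2 * dx Q1 p * dx G p
      + Q1 p * dx (dx G) p) := by
    rw [E0x.dx hV hp]
    refine ((((hasDerivAt_dx (d1x hp)).mul (hasDerivAt_dx (dG hp))).add
      ((hasDerivAt_dx (d1 hp)).mul (hasDerivAt_dx (dGx hp)))).const_mul (1 / 2)).deriv.trans ?_
    simp only [Prod.mk.eta]
    ring
  -- The damping equations as a first-order system for `(Q₁, Q₂)`; the `t`-derivative of the first
  -- and the `x`-derivative of the second share the term `Q₂_tx`.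
  have F1 : EqOn (dt Q1) (fun q => dx Q2 q + Q1 q * G q) V := fun q hq => by
    simp only [e2 q hq, e1 q hq]; ring
  have F2 : EqOn (dt Q2) (fun q => c ^ 2 * dx Q1 q + Q2 q * G q) V := fun q hq => by
    simp only [e3 q hq]; ring
  have F1t : dt (dt Q1) p = dx (dt Q2) p + dt Q1 p * G p + Q1 p * dt G p := by
    rw [F1.dt hV hp, ← dt_dx_comm hV s2 hp]
    refine ((hasDerivAt_dt (d2x hp)).add
      ((hasDerivAt_dt (d1 hp)).mul (hasDerivAt_dt (dG hp)))).deriv.trans ?_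
    simp only [Prod.mk.eta]
    ring
  have F2x : dx (dt Q2) p = c ^ 2 * dx (dx Q1) p + dx Q2 p * G p + Q2 p * dx G p := by
    rw [F2.dx hV hp]
    refine (((hasDerivAt_dx (d1x hp)).const_mul (c ^ 2)).add
      ((hasDerivAt_dx (d2 hp)).mul (hasDerivAt_dx (dG hp)))).deriv.trans ?_
    simp only [Prod.mk.eta]
    ring
  rw [dt_mul (dG hp) (s0.smoothAt hV hp)]
  simp only [box]
  rw [E0tt, E0xx, F1t, F2x, E0t hp, F1 hp, E0 hp]
  simp only [F1 hp]
  ring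

end DampingEquations
end

/-! ### Sufficiency: an explicit conserved density and flux. -/

noncomputable section

/-- `b₀` is constant along the flow of `Q₁ ∂_t + Q₂ ∂_x`, and `e^{b/2}`, `e^M` are the factors by
which `u` and the source term scale along it. -/
structure FlowEquations (V : Set (ℝ × ℝ)) (Q1 Q2 Q0 b0 b M : ℝ × ℝ → ℝ) : Prop where
  smooth_b0 : ContDiffOn ℝ ∞ b0 V
  smooth_b : ContDiffOn ℝ ∞ b V
  smooth_M : ContDiffOn ℝ ∞ M V
  flow_b0 : ∀ p ∈ V, Q1 p * dt b0 p + Q2 p * dx b0 p = 0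
  flow_b : ∀ p ∈ V, Q1 p * dt b p + Q2 p * dx b p = 2 * Q0 p
  flow_M : ∀ p ∈ V, Q1 p * dt M p + Q2 p * dx M p + dt Q1 p + dx Q2 p - Q0 p = 0

/-- Coefficients are arbitrary `C¹` functions on the jet space, so that only the polynomial
structure of the density is at stake here. -/
theorem contDiffOn_jet_density (c : ℝ) {S : Set (JetSpace 1)}
    {q1 q2 q0 q0t G k E F : JetSpace 1 → ℝ} (h1 : ContDiffOn ℝ 1 q1 S) (h2 : ContDiffOn ℝ 1 q2 S)
    (h0 : ContDiffOn ℝ 1 q0 S) (h0t : ContDiffOn ℝ 1 q0t S) (hG : ContDiffOn ℝ 1 G S)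
    (hk : ContDiffOn ℝ 1 k S) (hE : ContDiffOn ℝ 1 E S) (hF : ContDiffOn ℝ 1 F S) :
    ContDiffOn ℝ 1 (fun z => 1 / 2 * q1 z * z.2.2 0 ^ 2 + q2 z * z.2.2 0 * z.2.1 1
      + q0 z * z.2.1 0 * z.2.2 0 - 1 / 2 * q0t z * z.2.1 0 ^ 2
      + 1 / 2 * c ^ 2 * q1 z * z.2.1 1 ^ 2
      + (1 / 2 * (G z * q0 z) * z.2.1 0 ^ 2
        + q1 z * (1 / 2 * k z * z.2.1 0 ^ 2 + E z * F z))) S := by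
  fun_prop

theorem contDiffOn_jet_flux (c : ℝ) {S : Set (JetSpace 1)}
    {q1 q2 q0 q0x k E F : JetSpace 1 → ℝ} (h1 : ContDiffOn ℝ 1 q1 S) (h2 : ContDiffOn ℝ 1 q2 S)
    (h0 : ContDiffOn ℝ 1 q0 S) (h0x : ContDiffOn ℝ 1 q0x S)
    (hk : ContDiffOn ℝ 1 k S) (hE : ContDiffOn ℝ 1 E S) (hF : ContDiffOn ℝ 1 F S) :
    ContDiffOn ℝ 1 (fun z => -(1 / 2 * q2 z * z.2.2 0 ^ 2) - c ^ 2 * q1 z * z.2.2 0 * z.2.1 1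
      - 1 / 2 * c ^ 2 * q2 z * z.2.1 1 ^ 2 - c ^ 2 * q0 z * z.2.1 0 * z.2.1 1
      + 1 / 2 * c ^ 2 * q0x z * z.2.1 0 ^ 2
      + q2 z * (1 / 2 * k z * z.2.1 0 ^ 2 + E z * F z)) S := by
  fun_prop

/-- With `H = ½ k u² + e^{M - b/2} F(b₀, u e^{b/2})` and `F` a primitive of `f`, one has `H_u = k u
+ e^M f`. So the divergence of `(Q₁ H, Q₂ H)` contains `(k u + e^M f)(Q₁ u_t + Q₂ u_x)`. The flow
equations turn its other terms in `f` into `Q₀ u e^M f` and cancel those in `F`; the equation for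
`k` settles the terms in `u²`. The damping term `G u_t Q` cancels the quadratic form in `u_t`, `u_x`
and leaves `G Q₀ u u_t`, absorbed by `½ G Q₀ u²` in the density. Nothing is divided by `Q₁` or `Q₂`,
so their zeros do no harm. -/
theorem isMultiplier_of_canonical {c : ℝ} {V : Set (ℝ × ℝ)} (hV : IsOpen V) {n : ℕ∞} (hn : 1 ≤ n)
    {g : (ℝ × ℝ) × ℝ × ℝ → ℝ} {Q1 Q2 Q0 G b0 b M k f : ℝ × ℝ → ℝ} {J : Set ℝ} (hJ : IsOpen J)
    (hD : DampingEquations c V Q1 Q2 Q0 G) (hF : FlowEquations V Q1 Q2 Q0 b0 b M)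
    (hk : ContDiffOn ℝ ∞ k V) (hlin : LinearTermEquation c V Q1 Q2 G k)
    (hbJ : ∀ p ∈ V, b0 p ∈ J) (hf : ContDiffOn ℝ n f (J ×ˢ univ))
    (hg : ∀ p ∈ V, ∀ u v : ℝ, g (p, u, v) = G p * v + k p * u
      + Real.exp (M p) * f (b0 p, u * Real.exp (b p / 2))) :
    IsMultiplier c V g Q1 Q2 Q0 := by
  obtain ⟨F, hFs, hFd⟩ := exists_primitive_snd hJ (hf.of_le (m := ((1 : ℕ∞) : WithTop ℕ∞))
    (by exact_mod_cast hn))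
  have hbox := fun {p} (hp : p ∈ V) => hD.two_mul_box_sub hV hp
  obtain ⟨s1, s2, s0, sG, e1, e2, e3⟩ := hD
  obtain ⟨sb0, sb, sM, f0, fb, fM⟩ := hF
  -- Order `1` is needed for `u_x`; the coordinate `u_tx` does not occur.
  refine ⟨1,
    fun z => 1 / 2 * Q1 z.1 * z.2.2 0 ^ 2 + Q2 z.1 * z.2.2 0 * z.2.1 1
      + Q0 z.1 * z.2.1 0 * z.2.2 0 - 1 / 2 * dt Q0 z.1 * z.2.1 0 ^ 2
      + 1 / 2 * c ^ 2 * Q1 z.1 * z.2.1 1 ^ 2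
      + (1 / 2 * (G z.1 * Q0 z.1) * z.2.1 0 ^ 2 + Q1 z.1 * (1 / 2 * k z.1 * z.2.1 0 ^ 2
        + Real.exp (M z.1 - b z.1 / 2) * F (b0 z.1, z.2.1 0 * Real.exp (b z.1 / 2)))),
    fun z => -(1 / 2 * Q2 z.1 * z.2.2 0 ^ 2) - c ^ 2 * Q1 z.1 * z.2.2 0 * z.2.1 1
      - 1 / 2 * c ^ 2 * Q2 z.1 * z.2.1 1 ^ 2 - c ^ 2 * Q0 z.1 * z.2.1 0 * z.2.1 1
      + 1 / 2 * c ^ 2 * dx Q0 z.1 * z.2.1 0 ^ 2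
      + Q2 z.1 * (1 / 2 * k z.1 * z.2.1 0 ^ 2
        + Real.exp (M z.1 - b z.1 / 2) * F (b0 z.1, z.2.1 0 * Real.exp (b z.1 / 2))),
    ?_, ?_, ?_⟩
  all_goals
    have lift : ∀ {w : ℝ × ℝ → ℝ}, ContDiffOn ℝ ∞ w V →
        ContDiffOn ℝ 1 (fun z : JetSpace 1 => w z.1) (V ×ˢ univ) := fun h =>
      (h.of_le (by simp)).comp contDiffOn_fst (fun z hz => hz.1)
    have cF : ContDiffOn ℝ 1 (fun z : JetSpace 1 =>
        F (b0 z.1, z.2.1 0 * Real.exp (b z.1 / 2))) (V ×ˢ univ) := by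
      refine hFs.comp (t := J ×ˢ univ) ((lift sb0).prodMk
        (ContDiffOn.mul (by fun_prop) ((lift sb).div_const 2).exp)) ?_
      exact fun z hz => ⟨hbJ _ hz.1, mem_univ _⟩
    have cE : ContDiffOn ℝ 1 (fun z : JetSpace 1 => Real.exp (M z.1 - b z.1 / 2)) (V ×ˢ univ) :=
      ((lift sM).sub ((lift sb).div_const 2)).exp
    have c1 := lift s1
    have c2 := lift s2
    have c0 := lift s0
    have cG := lift sG
    have ck := lift hk
    have c0t := lift (s0.dt hV)
    have c0x := lift (s0.dx hV)
  · exact contDiffOn_jet_density c c1 c2 c0 c0t cG ck cE cF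
  · exact contDiffOn_jet_flux c c1 c2 c0 c0x ck cE cF
  intro u hu p hp
  have hu' : ContDiffOn ℝ ∞ u V := hu.contDiffOn
  have d1 := s1.smoothAt hV hp
  have d2 := s2.smoothAt hV hp
  have d0 := s0.smoothAt hV hp
  have dG := sG.smoothAt hV hp
  have db0 := sb0.smoothAt hV hp
  have db := sb.smoothAt hV hp
  have dM := sM.smoothAt hV hp
  have dk := hk.smoothAt hV hp
  have du := hu'.smoothAt hV hp
  set H : ℝ × ℝ → ℝ := fun q => 1 / 2 * k q * u q ^ 2
    + Real.exp (M q - b q / 2) * F (b0 q, u q * Real.exp (b q / 2)) with hH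
  have sFp := hFs.contDiffAt ((hJ.prod isOpen_univ).mem_nhds
    (show (b0 p, u p * Real.exp (b p / 2)) ∈ J ×ˢ univ from ⟨hbJ p hp, mem_univ _⟩))
  have dF : DifferentiableAt ℝ F (b0 p, u p * Real.exp (b p / 2)) :=
    sFp.differentiableAt (by simp)
  have cH : ContDiffOn ℝ 1 H V := by
    have one := fun {w : ℝ × ℝ → ℝ} (h : ContDiffOn ℝ ∞ w V) => h.of_le (m := 1) (by simp)
    have ce : ContDiffOn ℝ 1 (fun q => u q * Real.exp (b q / 2)) V :=
      (one hu').mul ((one sb).div_const 2).exp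
    have cF' : ContDiffOn ℝ 1 (fun q => F (b0 q, u q * Real.exp (b q / 2))) V :=
      hFs.comp ((one sb0).prodMk ce) (fun q hq => ⟨hbJ q hq, mem_univ _⟩)
    exact ((contDiffOn_const.mul (one hk)).mul ((one hu').pow 2)).add
      (((one sM).sub ((one sb).div_const 2)).exp.mul cF')
  have dH : DifferentiableAt ℝ H p := cH.dAt hV (by simp) hp
  have Fz : dx F (b0 p, u p * Real.exp (b p / 2)) = f (b0 p, u p * Real.exp (b p / 2)) :=
    (hFd _ (hbJ p hp) _).deriv
  have Ht : dt H p = 1 / 2 * dt k p * u p ^ 2 + k p * u p * dt u p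
      + Real.exp (M p - b p / 2) * ((dt M p - dt b p / 2) * F (b0 p, u p * Real.exp (b p / 2))
        + dt b0 p * dt F (b0 p, u p * Real.exp (b p / 2))
        + (dt u p * Real.exp (b p / 2) + u p * (Real.exp (b p / 2) * (dt b p / 2)))
          * f (b0 p, u p * Real.exp (b p / 2))) := by
    have hb2 := (hasDerivAt_dt db).div_const 2
    have hin := (hasDerivAt_dt db0).prodMk ((hasDerivAt_dt du).mul hb2.exp)
    have hFc := HasFDerivAt.comp_hasDerivAt (f := fun s => (b0 (s, p.2),
      u (s, p.2) * Real.exp (b (s, p.2) / 2))) p.1 dF.hasFDerivAt hin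
    have := ((((hasDerivAt_dt dk).const_mul (1 / 2)).mul ((hasDerivAt_dt du).pow 2)).add
      (((hasDerivAt_dt dM).sub hb2).exp.mul hFc)).deriv
    refine Eq.trans this ?_
    simp only [Prod.mk.eta, fderiv_apply_eq dF, Fz, Pi.sub_apply, Pi.pow_apply,
      Function.comp_apply]
    ring
  have Hx : dx H p = 1 / 2 * dx k p * u p ^ 2 + k p * u p * dx u p
      + Real.exp (M p - b p / 2) * ((dx M p - dx b p / 2) * F (b0 p, u p * Real.exp (b p / 2))
        + dx b0 p * dt F (b0 p, u p * Real.exp (b p / 2))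
        + (dx u p * Real.exp (b p / 2) + u p * (Real.exp (b p / 2) * (dx b p / 2)))
          * f (b0 p, u p * Real.exp (b p / 2))) := by
    have hb2 := (hasDerivAt_dx db).div_const 2
    have hin := (hasDerivAt_dx db0).prodMk ((hasDerivAt_dx du).mul hb2.exp)
    have hFc := HasFDerivAt.comp_hasDerivAt (f := fun s => (b0 (p.1, s),
      u (p.1, s) * Real.exp (b (p.1, s) / 2))) p.2 dF.hasFDerivAt hin
    have := ((((hasDerivAt_dx dk).const_mul (1 / 2)).mul ((hasDerivAt_dx du).pow 2)).add
      (((hasDerivAt_dx dM).sub hb2).exp.mul hFc)).deriv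
    refine Eq.trans this ?_
    simp only [Prod.mk.eta, fderiv_apply_eq dF, Fz, Pi.sub_apply, Pi.pow_apply,
      Function.comp_apply]
    ring
  have dw : DifferentiableAt ℝ (waveDensity c Q1 Q2 Q0 u) p := by
    have d0t := (s0.dt hV).smoothAt hV hp
    have dut := (hu'.dt hV).smoothAt hV hp
    have dux := (hu'.dx hV).smoothAt hV hp
    unfold waveDensity
    fun_prop
  have dψ : DifferentiableAt ℝ (waveFlux c Q1 Q2 Q0 u) p := by
    have d0x := (s0.dx hV).smoothAt hV hp
    have dut := (hu'.dt hV).smoothAt hV hp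
    have dux := (hu'.dx hV).smoothAt hV hp
    unfold waveFlux
    fun_prop
  have ET : dt (fun q => waveDensity c Q1 Q2 Q0 u q
      + (1 / 2 * (G q * Q0 q) * u q ^ 2 + Q1 q * H q)) p =
      dt (waveDensity c Q1 Q2 Q0 u) p + (1 / 2 * dt (fun q => G q * Q0 q) p * u p ^ 2
        + G p * Q0 p * u p * dt u p + dt Q1 p * H p + Q1 p * dt H p) := by
    refine ((hasDerivAt_dt dw).add
      ((((hasDerivAt_dt (dG.mul d0)).const_mul (1 / 2)).mul ((hasDerivAt_dt du).pow 2)).add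
        ((hasDerivAt_dt d1).mul (hasDerivAt_dt dH)))).deriv.trans ?_
    simp only [Prod.mk.eta, Pi.pow_apply, Pi.mul_apply]
    simp only [Pi.mul_def]
    ring
  have EX : dx (fun q => waveFlux c Q1 Q2 Q0 u q + Q2 q * H q) p =
      dx (waveFlux c Q1 Q2 Q0 u) p + (dx Q2 p * H p + Q2 p * dx H p) := by
    exact ((hasDerivAt_dx dψ).add ((hasDerivAt_dx d2).mul (hasDerivAt_dx dH))).deriv
  change _ = dt (fun q => waveDensity c Q1 Q2 Q0 u q
      + (1 / 2 * (G q * Q0 q) * u q ^ 2 + Q1 q * H q)) p +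
      dx (fun q => waveFlux c Q1 Q2 Q0 u q + Q2 q * H q) p
  rw [ET, EX, add_mul, wave_mul_multExpr hV s1 s2 s0 hu' hp, hg p hp, Ht, Hx]
  have hexp : Real.exp (M p) = Real.exp (M p - b p / 2) * Real.exp (b p / 2) := by
    rw [← Real.exp_add]; congr 1; ring
  simp only [multExpr, hH, hexp]
  set Fv := F (b0 p, u p * Real.exp (b p / 2))
  set fv := f (b0 p, u p * Real.exp (b p / 2))
  set Fy := dt F (b0 p, u p * Real.exp (b p / 2))
  set E := Real.exp (M p - b p / 2)
  set e := Real.exp (b p / 2)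
  -- The factors are those with which each defect occurs: `e1`–`e3` for the quadratic form in `u_t`,
  -- `u_x`, `hbox` and `hlin` for `u²`, and the flow equations for the terms in `F`, its first
  -- partial derivative and `f`.
  linear_combination (norm := ring1) (1 / 2 * dt u p ^ 2 + c ^ 2 / 2 * dx u p ^ 2) * e1 p hp
    + (dt u p ^ 2) * e2 p hp + dt u p * dx u p * e3 p hp
    + u p ^ 2 / 4 * hbox hp - u p ^ 2 / 4 * hlin p hp + u p ^ 2 / 2 * k p * e1 p hp
    + (E * Fv / 2 - E * e * fv * u p / 2) * fb p hp - E * Fv * fM p hp - E * Fy * f0 p hp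

end

/-! ### The four cases in canonical form -/

section Cases

variable {c : ℝ} {V : Set (ℝ × ℝ)} {Q1 Q2 Q0 : ℝ × ℝ → ℝ}

/-- The flow runs along `x`, so `t` is the invariant, and with `Q₀ = 0` neither `u` nor the source
is rescaled: `b = M = 0`, and `k = 0` suffices. -/
theorem caseI_equations (hV : IsOpen V) {κ : ℝ} {I : Set ℝ} {a : ℝ → ℝ}
    (hVI : ∀ p ∈ V, p.1 ∈ I) (ha : ContDiffOn ℝ ∞ a I)
    (hQ : ∀ p ∈ V, Q1 p = 0 ∧ Q2 p = κ * Real.exp (a p.1) ∧ Q0 p = 0) :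
    DampingEquations c V Q1 Q2 Q0 (fun q => deriv a q.1) ∧
      FlowEquations V Q1 Q2 Q0 (fun q => q.1) (fun _ => 0) (fun _ => 0) ∧
      LinearTermEquation c V Q1 Q2 (fun q => deriv a q.1) (fun _ => 0) := by
  have E1 : EqOn Q1 (fun _ => 0) V := fun p hp => (hQ p hp).1
  have E2 : EqOn Q2 (fun q => κ * Real.exp (a q.1)) V := fun p hp => (hQ p hp).2.1
  have E0 : EqOn Q0 (fun _ => 0) V := fun p hp => (hQ p hp).2.2
  have haV : ContDiffOn ℝ ∞ (fun q : ℝ × ℝ => a q.1) V :=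
    ha.comp contDiffOn_fst (fun p hp => hVI p hp)
  have dA := fun {q} (hq : q ∈ V) => haV.smoothAt hV hq
  have E1t := fun {q} (hq : q ∈ V) => (E1.dt hV hq).trans (dt_const 0)
  have E1x := fun {q} (hq : q ∈ V) => (E1.dx hV hq).trans (dx_const 0)
  have E2t : ∀ q ∈ V, dt Q2 q = κ * (Real.exp (a q.1) * deriv a q.1) := fun q hq => by
    rw [E2.dt hV hq]
    exact ((hasDerivAt_dt (dA hq)).exp.const_mul κ).deriv
  have E2x : ∀ q ∈ V, dx Q2 q = 0 := fun q hq => by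
    rw [E2.dx hV hq]
    exact dx_comp_fst (fun t => κ * Real.exp (a t))
  refine ⟨⟨contDiffOn_const.congr E1, (contDiffOn_const.mul haV.exp).congr E2,
    contDiffOn_const.congr E0, haV.dt hV, fun p hp => ?_, fun p hp => ?_, fun p hp => ?_⟩,
    ⟨contDiffOn_fst, contDiffOn_const, contDiffOn_const, fun p hp => ?_, fun p hp => ?_,
      fun p hp => ?_⟩, fun p hp => ?_⟩
  · simp [E0 hp, E1t hp, E2x p hp]
  · simp [E0 hp, E1 hp]
  · simp only [E2 hp, E2t p hp, E1x hp]; ring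
  · simp [E1 hp, dx_comp_fst (fun t => t)]
  · simp [E1 hp, E0 hp, dx_const]
  · simp [E1 hp, E0 hp, dx_const, dt_const, E1t hp, E2x p hp]
  · simp [E1 hp, E1x hp, E2x p hp, dx_comp_fst, dx_const]

/-- The flow runs along `t`, so `x` is the invariant; `b = a` and `M = -a/2` integrate the scaling
equations. The explicit coefficient of `u` is one solution of the equation for `k`; any other
differs from it by a term that `f` can absorb. -/
theorem caseII_equations (hV : IsOpen V) {κ : ℝ} {I : Set ℝ} {a : ℝ → ℝ}
    (hVI : ∀ p ∈ V, p.1 ∈ I) (ha : ContDiffOn ℝ ∞ a I)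
    (hQ : ∀ p ∈ V, Q1 p = κ * Real.exp (a p.1) ∧ Q2 p = 0 ∧
      Q0 p = κ * (Real.exp (a p.1) * (deriv a p.1 / 2))) :
    DampingEquations c V Q1 Q2 Q0 (fun q => deriv a q.1) ∧
      FlowEquations V Q1 Q2 Q0 (fun q => q.2) (fun q => a q.1) (fun q => -(a q.1 / 2)) ∧
      ContDiffOn ℝ ∞ (fun q : ℝ × ℝ => 1 / 4 * (deriv a q.1 ^ 2 + 2 * deriv (deriv a) q.1)) V ∧
      LinearTermEquation c V Q1 Q2 (fun q => deriv a q.1)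
        (fun q => 1 / 4 * (deriv a q.1 ^ 2 + 2 * deriv (deriv a) q.1)) := by
  have E1 : EqOn Q1 (fun q => κ * Real.exp (a q.1)) V := fun p hp => (hQ p hp).1
  have E2 : EqOn Q2 (fun _ => 0) V := fun p hp => (hQ p hp).2.1
  have E0 : EqOn Q0 (fun q => κ * (Real.exp (a q.1) * (deriv a q.1 / 2))) V :=
    fun p hp => (hQ p hp).2.2
  have haV : ContDiffOn ℝ ∞ (fun q : ℝ × ℝ => a q.1) V :=
    ha.comp contDiffOn_fst (fun p hp => hVI p hp)
  have haV' : ContDiffOn ℝ ∞ (fun q : ℝ × ℝ => deriv a q.1) V := haV.dt hV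
  have haV'' : ContDiffOn ℝ ∞ (fun q : ℝ × ℝ => deriv (deriv a) q.1) V := haV'.dt hV
  have dA := fun {q} (hq : q ∈ V) => haV.smoothAt hV hq
  have dA' := fun {q} (hq : q ∈ V) => haV'.smoothAt hV hq
  have dA'' := fun {q} (hq : q ∈ V) => haV''.smoothAt hV hq
  have E2t := fun {q} (hq : q ∈ V) => (E2.dt hV hq).trans (dt_const 0)
  have E2x := fun {q} (hq : q ∈ V) => (E2.dx hV hq).trans (dx_const 0)
  have E1t : ∀ q ∈ V, dt Q1 q = κ * (Real.exp (a q.1) * deriv a q.1) := fun q hq => by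
    rw [E1.dt hV hq]
    exact ((hasDerivAt_dt (dA hq)).exp.const_mul κ).deriv
  have E1x : ∀ q ∈ V, dx Q1 q = 0 := fun q hq => by
    rw [E1.dx hV hq]
    exact dx_comp_fst (fun t => κ * Real.exp (a t))
  refine ⟨⟨(contDiffOn_const.mul haV.exp).congr E1, contDiffOn_const.congr E2,
    (contDiffOn_const.mul (haV.exp.mul (haV'.div_const 2))).congr E0, haV', fun p hp => ?_,
    fun p hp => ?_, fun p hp => ?_⟩,
    ⟨contDiffOn_snd, haV, (haV.div_const 2).neg, fun p hp => ?_, fun p hp => ?_,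
      fun p hp => ?_⟩, contDiffOn_const.mul ((haV'.pow 2).add (contDiffOn_const.mul haV'')),
      fun p hp => ?_⟩
  · simp only [E0 hp, E1t p hp, E2x hp]; ring
  · simp only [E0 hp, E1 hp]; ring
  · simp [E2 hp, E2t hp, E1x p hp]
  · simp [E2 hp, dt_comp_snd (fun t => t)]
  · simp only [E2 hp, E0 hp, E1 hp, dt_comp_fst]; ring
  · have : dt (fun q : ℝ × ℝ => -(a q.1 / 2)) p = -(deriv a p.1 / 2) :=
      ((hasDerivAt_dt (dA hp)).div_const 2).neg.deriv
    simp only [E2 hp, E0 hp, E1 hp, E1t p hp, E2x hp, this]; ring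
  · have h1 : dt (fun q : ℝ × ℝ => 1 / 4 * (deriv a q.1 ^ 2 + 2 * deriv (deriv a) q.1)) p =
        1 / 4 * (2 * deriv a p.1 * deriv (deriv a) p.1 + 2 * deriv (deriv (deriv a)) p.1) := by
      refine ((((hasDerivAt_dt (dA' hp)).pow 2).add
        ((hasDerivAt_dt (dA'' hp)).const_mul 2)).const_mul (1 / 4)).deriv.trans ?_
      simp only [dt_comp_fst]
      ring
    have h2 : dx (dx (fun q : ℝ × ℝ => deriv a q.1)) p = 0 := by
      have : dx (fun q : ℝ × ℝ => deriv a q.1) = fun _ => 0 := funext fun _ => dx_comp_fst _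
      rw [this, dx_const]
    have h3 : dt (fun q : ℝ × ℝ => deriv a q.1) = fun q => deriv (deriv a) q.1 := rfl
    simp only [E2 hp, E1 hp, E2x hp, E1x p hp, h1, box, h2, h3, dt_comp_fst]
    ring

/-- Only `σ² = 1` enters, so both signs are treated at once: it matches `c² a_xx` from `□a` with the
term `(σc)² a_xx` coming from the coefficients. The two forms of the equation for `k` differ by the
non-zero factor `κ e^{a_t - σc a_x}`. -/
theorem caseIII_equations (hV : IsOpen V) {σ κ : ℝ} (hσ : σ ^ 2 = 1) (hκ : κ ≠ 0)
    {a : ℝ × ℝ → ℝ} (ha : ContDiffOn ℝ ∞ a V)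
    (hQ : ∀ p ∈ V,
      Q1 p = κ * Real.exp (dt a p - σ * c * dx a p) ∧
      Q2 p = κ * (Real.exp (dt a p - σ * c * dx a p) * (-(σ * c))) ∧
      Q0 p = κ * (Real.exp (dt a p - σ * c * dx a p) * (1 / 2 * box c a p))) :
    DampingEquations c V Q1 Q2 Q0 (box c a) ∧
      FlowEquations V Q1 Q2 Q0 (fun q => q.2 + σ * c * q.1) (fun q => σ * c * dx a q + dt a q)
        (fun q => (3 * σ * c * dx a q - dt a q) / 2) ∧
      ∀ k : ℝ × ℝ → ℝ, LinearTermEquation c V Q1 Q2 (box c a) k ↔ KEquationIII c σ V a k := by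
  have E1 : EqOn Q1 (fun p => κ * Real.exp (dt a p - σ * c * dx a p)) V := fun p hp => (hQ p hp).1
  have E2 : EqOn Q2 (fun p => κ * (Real.exp (dt a p - σ * c * dx a p) * (-(σ * c)))) V :=
    fun p hp => (hQ p hp).2.1
  have E0 : EqOn Q0 (fun p => κ * (Real.exp (dt a p - σ * c * dx a p) * (1 / 2 * box c a p))) V :=
    fun p hp => (hQ p hp).2.2
  have sat := ha.dt hV
  have sax := ha.dx hV
  have sexp : ContDiffOn ℝ ∞ (fun p => Real.exp (dt a p - σ * c * dx a p)) V :=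
    (sat.sub (contDiffOn_const.mul sax)).exp
  have ht := fun {q} (hq : q ∈ V) => hasDerivAt_dt (sat.smoothAt hV hq)
  have ht' := fun {q} (hq : q ∈ V) => hasDerivAt_dx (sat.smoothAt hV hq)
  have hx := fun {q} (hq : q ∈ V) => hasDerivAt_dt (sax.smoothAt hV hq)
  have hx' := fun {q} (hq : q ∈ V) => hasDerivAt_dx (sax.smoothAt hV hq)
  have comm := fun {q} (hq : q ∈ V) => dt_dx_comm hV ha hq
  have het := fun {q} (hq : q ∈ V) => ((ht hq).sub ((hx hq).const_mul (σ * c))).exp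
  have hex := fun {q} (hq : q ∈ V) => ((ht' hq).sub ((hx' hq).const_mul (σ * c))).exp
  have E1t : ∀ q ∈ V, dt Q1 q = κ * (Real.exp (dt a q - σ * c * dx a q) *
      (dt (dt a) q - σ * c * dx (dt a) q)) := fun q hq => by
    rw [E1.dt hV hq, ← comm hq]; exact ((het hq).const_mul κ).deriv
  have E1x : ∀ q ∈ V, dx Q1 q = κ * (Real.exp (dt a q - σ * c * dx a q) *
      (dx (dt a) q - σ * c * dx (dx a) q)) := fun q hq => by
    rw [E1.dx hV hq]; exact ((hex hq).const_mul κ).deriv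
  have E2t : ∀ q ∈ V, dt Q2 q = κ * (Real.exp (dt a q - σ * c * dx a q) *
      (dt (dt a) q - σ * c * dx (dt a) q) * (-(σ * c))) := fun q hq => by
    rw [E2.dt hV hq, ← comm hq]; exact (((het hq).mul_const _).const_mul κ).deriv
  have E2x : ∀ q ∈ V, dx Q2 q = κ * (Real.exp (dt a q - σ * c * dx a q) *
      (dx (dt a) q - σ * c * dx (dx a) q) * (-(σ * c))) := fun q hq => by
    rw [E2.dx hV hq]; exact (((hex hq).mul_const _).const_mul κ).deriv
  refine ⟨⟨(contDiffOn_const.mul sexp).congr E1,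
    (contDiffOn_const.mul (sexp.mul contDiffOn_const)).congr E2,
    (contDiffOn_const.mul (sexp.mul (contDiffOn_const.mul (ha.box hV)))).congr E0,
    ha.box hV, fun p hp => ?_, fun p hp => ?_, fun p hp => ?_⟩,
    ⟨by fun_prop, (contDiffOn_const.mul sax).add sat,
      ((contDiffOn_const.mul sax).sub sat).div_const 2, fun p hp => ?_, fun p hp => ?_,
      fun p hp => ?_⟩, fun k => ?_⟩
  · simp only [E0 hp, E1t p hp, E2x p hp, box]
    linear_combination (κ * Real.exp (dt a p - σ * c * dx a p) * c ^ 2 * dx (dx a) p) * hσ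
  · simp only [E0 hp, E1 hp]; ring
  · simp only [E2 hp, E2t p hp, E1x p hp, box]
    linear_combination (-(κ * Real.exp (dt a p - σ * c * dx a p) * c ^ 2 * dx (dt a) p)) * hσ
  · have h1 : dt (fun q : ℝ × ℝ => q.2 + σ * c * q.1) p = σ * c :=
      (((hasDerivAt_id p.1).const_mul (σ * c)).const_add p.2).deriv.trans (mul_one _)
    have h2 : dx (fun q : ℝ × ℝ => q.2 + σ * c * q.1) p = 1 :=
      ((hasDerivAt_id p.2).add_const (σ * c * p.1)).deriv
    simp only [h1, h2, E1 hp, E2 hp]; ring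
  · have h1 : dt (fun q => σ * c * dx a q + dt a q) p = σ * c * dt (dx a) p + dt (dt a) p :=
      (((hx hp).const_mul (σ * c)).add (ht hp)).deriv
    have h2 : dx (fun q => σ * c * dx a q + dt a q) p = σ * c * dx (dx a) p + dx (dt a) p :=
      (((hx' hp).const_mul (σ * c)).add (ht' hp)).deriv
    simp only [h1, h2, E1 hp, E2 hp, E0 hp, comm hp, box]
    linear_combination (-(κ * Real.exp (dt a p - σ * c * dx a p) * c ^ 2 * dx (dx a) p)) * hσ
  · have h1 : dt (fun q => (3 * σ * c * dx a q - dt a q) / 2) p =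
        (3 * σ * c * dt (dx a) p - dt (dt a) p) / 2 :=
      ((((hx hp).const_mul (3 * σ * c)).sub (ht hp)).div_const 2).deriv
    have h2 : dx (fun q => (3 * σ * c * dx a q - dt a q) / 2) p =
        (3 * σ * c * dx (dx a) p - dx (dt a) p) / 2 :=
      ((((hx' hp).const_mul (3 * σ * c)).sub (ht' hp)).div_const 2).deriv
    simp only [h1, h2, E1 hp, E2 hp, E0 hp, comm hp, E1t p hp, E2x p hp, box]
    linear_combination (-(1 / 2 * κ * Real.exp (dt a p - σ * c * dx a p) * c ^ 2 *
      dx (dx a) p)) * hσ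
  · refine forall₂_congr fun p hp => ?_
    simp only [E1 hp, E2 hp, E1x p hp, E2x p hp, comm hp]
    set e := Real.exp (dt a p - σ * c * dx a p)
    have he : κ * e ≠ 0 := mul_ne_zero hκ (Real.exp_ne_zero _)
    constructor
    · intro h
      apply mul_left_cancel₀ he
      linear_combination h - (2 * κ * e * c ^ 2 * (dx (dt a) p - σ * c * dx (dx a) p) *
        dx (box c a) p) * hσ
    · intro h
      linear_combination κ * e * h + (2 * κ * e * c ^ 2 * (dx (dt a) p - σ * c * dx (dx a) p) *
        dx (box c a) p) * hσ

/-- Apart from smoothness, the only property of the hyperbolic pair used is `C' = S`, `S' = C`,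
which both choices share. The equation for `M = (3b - 4a_t)/2` is no extra condition: `Q₁_t + Q₂_x =
2 (Q₁ a_tt + Q₂ a_tx) - 2 Q₀`, so it follows from that for `b`. -/
theorem caseIV_equations (hV : IsOpen V) {κ : ℝ} (hκ : κ ≠ 0) {C S : ℝ → ℝ}
    (hCS : (C = Real.cosh ∧ S = Real.sinh) ∨ (C = Real.sinh ∧ S = Real.cosh))
    {a b b0 : ℝ × ℝ → ℝ} (ha : ContDiffOn ℝ ∞ a V) (hb : ContDiffOn ℝ ∞ b V)
    (hb0 : ContDiffOn ℝ ∞ b0 V)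
    (hQ : ∀ p ∈ V,
      Q1 p = κ * (Real.exp (dt a p) * C (c * dx a p)) ∧
      Q2 p = κ * (Real.exp (dt a p) * (c * S (c * dx a p))) ∧
      Q0 p = κ * (Real.exp (dt a p) * (C (c * dx a p) * (1 / 2 * box c a p)))) :
    DampingEquations c V Q1 Q2 Q0 (box c a) ∧
      (((∀ p ∈ V, C (c * dx a p) * dt b0 p + c * S (c * dx a p) * dx b0 p = 0) ∧
        (∀ p ∈ V, C (c * dx a p) * dt b p + c * S (c * dx a p) * dx b p =
          C (c * dx a p) * box c a p)) ↔
        FlowEquations V Q1 Q2 Q0 b0 b (fun q => (3 * b q - 4 * dt a q) / 2)) ∧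
      ∀ k : ℝ × ℝ → ℝ, LinearTermEquation c V Q1 Q2 (box c a) k ↔ KEquationIV c C S V a k := by
  have hC : ContDiff ℝ ∞ C := by
    rcases hCS with ⟨rfl, rfl⟩ | ⟨rfl, rfl⟩
    exacts [Real.contDiff_cosh, Real.contDiff_sinh]
  have hS : ContDiff ℝ ∞ S := by
    rcases hCS with ⟨rfl, rfl⟩ | ⟨rfl, rfl⟩
    exacts [Real.contDiff_sinh, Real.contDiff_cosh]
  have dC : ∀ y, HasDerivAt C (S y) y := by
    rcases hCS with ⟨rfl, rfl⟩ | ⟨rfl, rfl⟩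
    exacts [Real.hasDerivAt_cosh, Real.hasDerivAt_sinh]
  have dS : ∀ y, HasDerivAt S (C y) y := by
    rcases hCS with ⟨rfl, rfl⟩ | ⟨rfl, rfl⟩
    exacts [Real.hasDerivAt_sinh, Real.hasDerivAt_cosh]
  have E1 : EqOn Q1 (fun p => κ * (Real.exp (dt a p) * C (c * dx a p))) V :=
    fun p hp => (hQ p hp).1
  have E2 : EqOn Q2 (fun p => κ * (Real.exp (dt a p) * (c * S (c * dx a p)))) V :=
    fun p hp => (hQ p hp).2.1
  have E0 : EqOn Q0 (fun p => κ * (Real.exp (dt a p) * (C (c * dx a p) * (1 / 2 * box c a p)))) V :=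
    fun p hp => (hQ p hp).2.2
  have sat := ha.dt hV
  have sax := ha.dx hV
  have ht := fun {q} (hq : q ∈ V) => hasDerivAt_dt (sat.smoothAt hV hq)
  have ht' := fun {q} (hq : q ∈ V) => hasDerivAt_dx (sat.smoothAt hV hq)
  have hx := fun {q} (hq : q ∈ V) => hasDerivAt_dt (sax.smoothAt hV hq)
  have hx' := fun {q} (hq : q ∈ V) => hasDerivAt_dx (sax.smoothAt hV hq)
  have comm := fun {q} (hq : q ∈ V) => dt_dx_comm hV ha hq
  have sC : ContDiffOn ℝ ∞ (fun q => C (c * dx a q)) V :=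
    hC.comp_contDiffOn (contDiffOn_const.mul sax)
  have sS : ContDiffOn ℝ ∞ (fun q => S (c * dx a q)) V :=
    hS.comp_contDiffOn (contDiffOn_const.mul sax)
  have hCt := fun {q} (hq : q ∈ V) => HasDerivAt.comp q.1
    (h := fun s => c * dx a (s, q.2)) (dC _) ((hx hq).const_mul c)
  have hCx := fun {q} (hq : q ∈ V) => HasDerivAt.comp q.2
    (h := fun s => c * dx a (q.1, s)) (dC _) ((hx' hq).const_mul c)
  have hSt := fun {q} (hq : q ∈ V) => HasDerivAt.comp q.1
    (h := fun s => c * dx a (s, q.2)) (dS _) ((hx hq).const_mul c)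
  have hSx := fun {q} (hq : q ∈ V) => HasDerivAt.comp q.2
    (h := fun s => c * dx a (q.1, s)) (dS _) ((hx' hq).const_mul c)
  have E1t : ∀ q ∈ V, dt Q1 q = κ * (Real.exp (dt a q) * (dt (dt a) q * C (c * dx a q)
      + c * dt (dx a) q * S (c * dx a q))) := fun q hq => by
    rw [E1.dt hV hq]
    refine (((ht hq).exp.mul (hCt hq)).const_mul κ).deriv.trans ?_
    simp only [Prod.mk.eta, Function.comp_apply]
    ring
  have E1x : ∀ q ∈ V, dx Q1 q = κ * (Real.exp (dt a q) * (dt (dx a) q * C (c * dx a q)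
      + c * dx (dx a) q * S (c * dx a q))) := fun q hq => by
    rw [E1.dx hV hq, comm hq]
    refine (((ht' hq).exp.mul (hCx hq)).const_mul κ).deriv.trans ?_
    simp only [Prod.mk.eta, Function.comp_apply]
    ring
  have E2t : ∀ q ∈ V, dt Q2 q = κ * (Real.exp (dt a q) * (c * (dt (dt a) q * S (c * dx a q)
      + c * dt (dx a) q * C (c * dx a q)))) := fun q hq => by
    rw [E2.dt hV hq]
    refine (((ht hq).exp.mul ((hSt hq).const_mul c)).const_mul κ).deriv.trans ?_
    simp only [Prod.mk.eta, Function.comp_apply]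
    ring
  have E2x : ∀ q ∈ V, dx Q2 q = κ * (Real.exp (dt a q) * (c * (dt (dx a) q * S (c * dx a q)
      + c * dx (dx a) q * C (c * dx a q)))) := fun q hq => by
    rw [E2.dx hV hq, comm hq]
    refine (((ht' hq).exp.mul ((hSx hq).const_mul c)).const_mul κ).deriv.trans ?_
    simp only [Prod.mk.eta, Function.comp_apply]
    ring
  refine ⟨⟨(contDiffOn_const.mul (sat.exp.mul sC)).congr E1,
    (contDiffOn_const.mul (sat.exp.mul (contDiffOn_const.mul sS))).congr E2,
    (contDiffOn_const.mul (sat.exp.mul (sC.mul (contDiffOn_const.mul (ha.box hV))))).congr E0,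
    ha.box hV, fun p hp => ?_, fun p hp => ?_, fun p hp => ?_⟩, ⟨fun h => ?_, fun h => ?_⟩,
    fun k => ?_⟩
  · simp only [E0 hp, E1t p hp, E2x p hp, box]; ring
  · simp only [E0 hp, E1 hp]; ring
  · simp only [E2 hp, E2t p hp, E1x p hp, box]; ring
  · obtain ⟨h1, h2⟩ := h
    refine ⟨hb0, hb, ((contDiffOn_const.mul hb).sub (contDiffOn_const.mul sat)).div_const 2,
      fun p hp => ?_, fun p hp => ?_, fun p hp => ?_⟩
    · rw [E1 hp, E2 hp]
      linear_combination κ * Real.exp (dt a p) * h1 p hp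
    · rw [E1 hp, E2 hp, E0 hp]
      linear_combination κ * Real.exp (dt a p) * h2 p hp
    · have hbd := hb.smoothAt hV hp
      have e1 : dt (fun q => (3 * b q - 4 * dt a q) / 2) p =
          (3 * dt b p - 4 * dt (dt a) p) / 2 :=
        ((((hasDerivAt_dt hbd).const_mul 3).sub ((ht hp).const_mul 4)).div_const 2).deriv
      have e2 : dx (fun q => (3 * b q - 4 * dt a q) / 2) p =
          (3 * dx b p - 4 * dx (dt a) p) / 2 :=
        ((((hasDerivAt_dx hbd).const_mul 3).sub ((ht' hp).const_mul 4)).div_const 2).deriv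
      have hbox : box c a p = dt (dt a) p - c ^ 2 * dx (dx a) p := rfl
      have h2p := h2 p hp
      simp only [e1, e2, E1 hp, E2 hp, E0 hp, E1t p hp, E2x p hp, ← comm hp, hbox] at h2p ⊢
      linear_combination 3 / 2 * κ * Real.exp (dt a p) * h2p
  · refine ⟨fun p hp => ?_, fun p hp => ?_⟩
    all_goals
      have he : κ * Real.exp (dt a p) ≠ 0 := mul_ne_zero hκ (Real.exp_ne_zero _)
      apply mul_left_cancel₀ he
    · have := h.flow_b0 p hp
      rw [E1 hp, E2 hp] at this
      linear_combination this
    · have := h.flow_b p hp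
      rw [E1 hp, E2 hp, E0 hp] at this
      linear_combination this
  · refine forall₂_congr fun p hp => ?_
    simp only [E1 hp, E2 hp, E1x p hp, E2x p hp]
    have he : κ * Real.exp (dt a p) ≠ 0 := mul_ne_zero hκ (Real.exp_ne_zero _)
    constructor
    · intro h
      apply mul_left_cancel₀ he
      linear_combination h
    · intro h
      linear_combination κ * Real.exp (dt a p) * h

theorem isMultiplier_of_cases {n : ℕ∞} (hn : 1 ≤ n) (hV : IsOpen V) {g : (ℝ × ℝ) × ℝ × ℝ → ℝ}
    (h : CaseI n V g Q1 Q2 Q0 ∨ CaseII n V g Q1 Q2 Q0 ∨ CaseIII n c 1 V g Q1 Q2 Q0 ∨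
      CaseIII n c (-1) V g Q1 Q2 Q0 ∨ CaseIV n c V g Q1 Q2 Q0) :
    IsMultiplier c V g Q1 Q2 Q0 := by
  have III : ∀ σ : ℝ, σ ^ 2 = 1 → CaseIII n c σ V g Q1 Q2 Q0 → IsMultiplier c V g Q1 Q2 Q0 := by
    rintro σ hσ ⟨κ, J, a, k, f, hκ, hJ, hVJ, ha, hk, hf, hkeq, hg, hQ⟩
    obtain ⟨h1, h2, h3⟩ := caseIII_equations hV hσ hκ ha hQ
    refine isMultiplier_of_canonical hV hn hJ h1 h2 hk ((h3 k).2 hkeq) hVJ hf fun p hp u v => ?_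
    rw [hg p hp]
  rcases h with h | h | h | h | h
  · obtain ⟨κ, I, a, f, hκ, hI, hVI, ha, hf, hg, hQ⟩ := h
    obtain ⟨h1, h2, h3⟩ := caseI_equations (c := c) hV hVI ha hQ
    refine isMultiplier_of_canonical hV hn hI h1 h2 contDiffOn_const h3 hVI hf fun p hp u v => ?_
    rw [hg p hp]
    simp
  · obtain ⟨κ, I, J, a, f, hκ, hI, hJ, hVI, ha, hf, hg, hQ⟩ := h
    obtain ⟨h1, h2, h3, h4⟩ := caseII_equations (c := c) hV (fun p hp => (hVI p hp).1) ha hQ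
    refine isMultiplier_of_canonical hV hn hJ h1 h2 h3 h4 (fun p hp => (hVI p hp).2) hf
      fun p hp u v => ?_
    rw [hg p hp, mul_comm u]
    ring
  · exact III 1 (by norm_num) h
  · exact III (-1) (by norm_num) h
  · obtain ⟨C, S, κ, J, a, b, b0, k, f, hCS, hκ, hJ, hVJ, ha, hb, hb0, hk, hf, e1, e2, hkeq, hg,
      hQ⟩ := h
    obtain ⟨h1, h2, h3⟩ := caseIV_equations hV hκ hCS ha hb hb0 hQ
    exact isMultiplier_of_canonical hV hn hJ h1 (h2.1 ⟨e1, e2⟩) hk ((h3 k).2 hkeq) hVJ hf hg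

end Cases

/-! ### First-order null Lagrangians -/

section NullLagrangian

/-- `Ω` and the complement of `K` are open and cover the space. This lets data that are smooth on
`Ω` only be integrated over the whole plane once multiplied by, or varied along, a compactly
supported function. -/
theorem contDiff_of_contDiffOn_of_eq_zero {E : Type*} [NormedAddCommGroup E] [NormedSpace ℝ E]
    {n : WithTop ℕ∞} {W : E → ℝ} {Ω K : Set E} (hΩ : IsOpen Ω) (hK : IsClosed K) (hKΩ : K ⊆ Ω)
    (hW : ContDiffOn ℝ n W Ω) (h0 : ∀ p ∉ K, W p = 0) : ContDiff ℝ n W := by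
  refine contDiff_of_contDiffOn_union_of_isOpen hW (t := Kᶜ)
    ((contDiffOn_const (c := (0 : ℝ))).congr fun p hp => h0 p hp) ?_ hΩ hK.isOpen_compl
  rw [eq_univ_iff_forall]
  intro p
  by_cases hp : p ∈ K
  exacts [Or.inl (hKΩ hp), Or.inr hp]

/-- Integration by parts against the constant `1`. -/
theorem integral_fderiv_eq_zero {D : ℝ × ℝ → ℝ} (hD : ContDiff ℝ 1 D) (hc : HasCompactSupport D)
    (e : ℝ × ℝ) : ∫ p, fderiv ℝ D p e = 0 := by
  have h := integral_mul_fderiv_eq_neg_fderiv_mul_of_integrable (μ := MeasureTheory.volume)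
    (f := fun _ : ℝ × ℝ => (1 : ℝ)) (g := D) (v := e) (by simp)
    (by
      simp only [one_mul]
      exact ((hD.continuous_fderiv one_ne_zero).clm_apply
        continuous_const).integrable_of_hasCompactSupport
        (hc.fderiv_apply (𝕜 := ℝ) e))
    (by simp only [one_mul]; exact hD.continuous.integrable_of_hasCompactSupport hc)
    (fun x _ => differentiableAt_const _) (fun x _ => hD.differentiable one_ne_zero x)
  simpa using h

theorem integral_divergence_eq_zero {D₁ D₂ : ℝ × ℝ → ℝ} (h₁ : ContDiff ℝ 1 D₁)
    (h₂ : ContDiff ℝ 1 D₂) (hc₁ : HasCompactSupport D₁) (hc₂ : HasCompactSupport D₂) :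
    ∫ p, (dt D₁ p + dx D₂ p) = 0 := by
  have e₁ : dt D₁ = fun p => fderiv ℝ D₁ p (1, 0) :=
    funext fun p => dt_eq_fderiv (h₁.differentiable one_ne_zero p)
  have e₂ : dx D₂ = fun p => fderiv ℝ D₂ p (0, 1) :=
    funext fun p => dx_eq_fderiv (h₂.differentiable one_ne_zero p)
  rw [e₁, e₂, MeasureTheory.integral_add, integral_fderiv_eq_zero h₁ hc₁,
    integral_fderiv_eq_zero h₂ hc₂, add_zero]
  · exact ((h₁.continuous_fderiv one_ne_zero).clm_apply
      continuous_const).integrable_of_hasCompactSupport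
      (hc₁.fderiv_apply (𝕜 := ℝ) _)
  · exact ((h₂.continuous_fderiv one_ne_zero).clm_apply
      continuous_const).integrable_of_hasCompactSupport
      (hc₂.fderiv_apply (𝕜 := ℝ) _)

/-- Points `(p, u, u_t, u_x)` of the first-order jet space. -/
abbrev FirstJet : Type := (ℝ × ℝ) × ℝ × ℝ × ℝ

/-- The first-order jet of `u`. -/
noncomputable def firstJet (u : ℝ × ℝ → ℝ) (p : ℝ × ℝ) : FirstJet := (p, u p, dt u p, dx u p)

/-- The integral of `P` over the first-order jet of `u` does not change under compactly supported
variations of `u` in `Ω`. -/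
def IsNullLagrangian (Ω : Set (ℝ × ℝ)) (P : FirstJet → ℝ) : Prop :=
  ∀ u φ : ℝ × ℝ → ℝ, ContDiff ℝ ∞ u → ContDiff ℝ ∞ φ → HasCompactSupport φ → tsupport φ ⊆ Ω →
    ∫ p, (P (firstJet (fun q => u q + φ q) p) - P (firstJet u p)) = 0

variable {Ω : Set (ℝ × ℝ)} {P : FirstJet → ℝ} {u φ : ℝ × ℝ → ℝ}

theorem contDiff_firstJet (hu : ContDiff ℝ ∞ u) : ContDiff ℝ ∞ (firstJet u) :=
  contDiff_id.prodMk (hu.prodMk (hu.dt.prodMk hu.dx))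

theorem eventuallyEq_zero_of_notMem_tsupport {p : ℝ × ℝ} (hp : p ∉ tsupport φ) :
    φ =ᶠ[𝓝 p] fun _ => 0 :=
  notMem_tsupport_iff_eventuallyEq.1 hp

theorem dt_eq_zero_of_notMem_tsupport {p : ℝ × ℝ} (hp : p ∉ tsupport φ) : dt φ p = 0 :=
  (eventuallyEq_zero_of_notMem_tsupport hp).dt_eq.trans (dt_const 0)

theorem dx_eq_zero_of_notMem_tsupport {p : ℝ × ℝ} (hp : p ∉ tsupport φ) : dx φ p = 0 :=
  (eventuallyEq_zero_of_notMem_tsupport hp).dx_eq.trans (dx_const 0)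

/-- Since `ε φ` is an admissible variation for each `ε`, the integral vanishes identically in `ε`;
differentiate it under the integral sign at `ε = 0`. Subtracting `P` at the jet of `u` keeps the
integrand compactly supported. -/
theorem IsNullLagrangian.first_variation (h : IsNullLagrangian Ω P) (hΩ : IsOpen Ω)
    (hP : ContDiffOn ℝ 2 P (Ω ×ˢ univ)) (hu : ContDiff ℝ ∞ u) (hφ : ContDiff ℝ ∞ φ)
    (hc : HasCompactSupport φ) (hs : tsupport φ ⊆ Ω) :
    ∫ p, fderiv ℝ P (firstJet u p) (0, φ p, dt φ p, dx φ p) = 0 := by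
  set η : ℝ × ℝ → FirstJet := fun p => (0, φ p, dt φ p, dx φ p) with hη
  have cη : ContDiff ℝ ∞ η := contDiff_const.prodMk (hφ.prodMk (hφ.dt.prodMk hφ.dx))
  have η0 : ∀ p ∉ tsupport φ, η p = 0 := fun p hp => by
    simp only [hη, image_eq_zero_of_notMem_tsupport hp, dt_eq_zero_of_notMem_tsupport hp,
      dx_eq_zero_of_notMem_tsupport hp]
    rfl
  have hopen : IsOpen (Ω ×ˢ (univ : Set (ℝ × ℝ × ℝ))) := hΩ.prod isOpen_univ
  have cline : ContDiff ℝ ∞ (fun q : ℝ × (ℝ × ℝ) => firstJet u q.2 + q.1 • η q.2) :=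
    ((contDiff_firstJet hu).comp contDiff_snd).add
      (contDiff_fst.smul (cη.comp contDiff_snd))
  have mem : ∀ (ε : ℝ) {p : ℝ × ℝ}, p ∈ Ω → firstJet u p + ε • η p ∈ Ω ×ˢ univ := fun ε p hp =>
    ⟨by simpa [firstJet, hη] using hp, mem_univ _⟩
  have cF : ∀ ε : ℝ, ContDiff ℝ 1 (fun p => P (firstJet u p + ε • η p) - P (firstJet u p)) :=
    fun ε => by
    refine contDiff_of_contDiffOn_of_eq_zero hΩ (isClosed_tsupport φ) hs ?_ fun p hp => by
      simp [η0 p hp]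
    have h1 : ContDiff ℝ 1 (fun p => firstJet u p + ε • η p) :=
      ContDiff.of_le (n := ∞) ((contDiff_firstJet hu).add (cη.const_smul ε)) (by simp)
    refine ContDiffOn.sub ((hP.of_le one_le_two).comp h1.contDiffOn fun p hp => mem ε hp) ?_
    exact (hP.of_le one_le_two).comp ((contDiff_firstJet hu).of_le (by simp)).contDiffOn
      fun p hp => ⟨hp, mem_univ _⟩
  have suppF : ∀ ε : ℝ,
      HasCompactSupport (fun p => P (firstJet u p + ε • η p) - P (firstJet u p)) := fun ε =>
    HasCompactSupport.intro hc fun p hp => by simp [η0 p hp]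
  have cP' : ContinuousOn (fderiv ℝ P) (Ω ×ˢ univ) :=
    (hP.fderiv_of_isOpen hopen (m := 1) (by norm_num [one_add_one_eq_two])).continuousOn
  have cF' : ContinuousOn (fun q : ℝ × (ℝ × ℝ) =>
      fderiv ℝ P (firstJet u q.2 + q.1 • η q.2) (η q.2)) (univ ×ˢ Ω) :=
    (cP'.comp cline.continuous.continuousOn fun q hq => mem q.1 hq.2).clm_apply
      (cη.continuous.comp continuous_snd).continuousOn
  have cF0 : Continuous (fun p => fderiv ℝ P (firstJet u p + (0 : ℝ) • η p) (η p)) := by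
    rw [← contDiff_zero (𝕜 := ℝ)]
    refine contDiff_of_contDiffOn_of_eq_zero hΩ (isClosed_tsupport φ) hs ?_ fun p hp => by
      simp [η0 p hp]
    rw [contDiffOn_zero]
    exact cF'.comp (f := fun p : ℝ × ℝ => ((0 : ℝ), p)) (by fun_prop) fun p hp => ⟨mem_univ _, hp⟩
  -- Dominating constant: the derivative is continuous on the compact set `[-1, 1] × tsupport φ` and
  -- zero off the support.
  obtain ⟨B, hB⟩ := ((isCompact_Icc (a := (-1 : ℝ)) (b := 1)).prod hc).exists_bound_of_continuousOn
    (cF'.mono (prod_mono (subset_univ _) hs))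
  have key := hasDerivAt_integral_of_dominated_loc_of_deriv_le (μ := MeasureTheory.volume)
    (F := fun ε p => P (firstJet u p + ε • η p) - P (firstJet u p))
    (F' := fun ε p => fderiv ℝ P (firstJet u p + ε • η p) (η p))
    (bound := (tsupport φ).indicator fun _ => B) (x₀ := (0 : ℝ)) (s := Icc (-1 : ℝ) 1)
    (Icc_mem_nhds (by norm_num) (by norm_num))
    (Eventually.of_forall fun ε => (cF ε).continuous.aestronglyMeasurable)
    ((cF 0).continuous.integrable_of_hasCompactSupport (suppF 0))
    cF0.aestronglyMeasurable
    (Eventually.of_forall fun p ε hε => by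
      by_cases hp : p ∈ tsupport φ
      · rw [indicator_of_mem hp]; exact hB (ε, p) ⟨hε, hp⟩
      · rw [indicator_of_notMem hp, η0 p hp]; simp)
    ((MeasureTheory.integrableOn_const hc.measure_lt_top.ne).integrable_indicator
      hc.measurableSet)
    (Eventually.of_forall fun p ε _ => by
      by_cases hp : p ∈ tsupport φ
      · have hd : DifferentiableAt ℝ P (firstJet u p + ε • η p) :=
          (hP.contDiffAt (hopen.mem_nhds (mem ε (hs hp)))).differentiableAt two_ne_zero
        have hl : HasDerivAt (fun ε : ℝ => firstJet u p + ε • η p) (η p) ε := by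
          simpa using ((hasDerivAt_id ε).smul_const (η p)).const_add (firstJet u p)
        exact (hd.hasFDerivAt.comp_hasDerivAt ε hl).sub_const _
      · simp [η0 p hp, hasDerivAt_const])
  have hzero : (fun ε : ℝ => ∫ p, (P (firstJet u p + ε • η p) - P (firstJet u p))) =
      fun _ => 0 := by
    funext ε
    have hεφ : ContDiff ℝ ∞ (fun q => ε * φ q) := contDiff_const.mul hφ
    have := h u (fun q => ε * φ q) hu hεφ (hc.mul_left (f := fun _ => ε))
      ((tsupport_mul_subset_right (f := fun _ => ε)).trans hs)
    rw [← this]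
    congr 1
    funext p
    congr 2
    have du := hu.differentiable (by simp) p
    have dφ := hφ.differentiable (by simp) p
    simp only [firstJet, hη]
    rw [dt_add du (dφ.const_mul ε), dx_add du (dφ.const_mul ε),
      dt_mul (differentiableAt_const _) dφ, dx_mul (differentiableAt_const _) dφ,
      dt_const, dx_const]
    simp
  have h2 := key.2
  rw [hzero] at h2
  have h3 := h2.unique (hasDerivAt_const (0 : ℝ) (0 : ℝ))
  simpa using h3

/-- Integrate the first variation by parts and apply the fundamental lemma of the calculus of
variations. As `P` is `C²`, the Euler–Lagrange expression is continuous, so it vanishes everywhere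
on `Ω` and not only almost everywhere. -/
theorem IsNullLagrangian.euler_lagrange_along (h : IsNullLagrangian Ω P) (hΩ : IsOpen Ω)
    (hP : ContDiffOn ℝ 2 P (Ω ×ˢ univ)) (hu : ContDiff ℝ ∞ u) {p : ℝ × ℝ} (hp : p ∈ Ω) :
    fderiv ℝ P (firstJet u p) (0, 1, 0, 0)
      - dt (fun q => fderiv ℝ P (firstJet u q) (0, 0, 1, 0)) p
      - dx (fun q => fderiv ℝ P (firstJet u q) (0, 0, 0, 1)) p = 0 := by
  have hopen : IsOpen (Ω ×ˢ (univ : Set (ℝ × ℝ × ℝ))) := hΩ.prod isOpen_univ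
  have cP' : ContDiffOn ℝ 1 (fderiv ℝ P) (Ω ×ˢ univ) :=
    hP.fderiv_of_isOpen hopen (by norm_num [one_add_one_eq_two])
  have c1 : ∀ e : FirstJet, ContDiffOn ℝ 1 (fun q => fderiv ℝ P (firstJet u q) e) Ω := fun e =>
    (cP'.comp ((contDiff_firstJet hu).of_le (by simp)).contDiffOn
      fun p hp => ⟨hp, mem_univ _⟩).clm_apply contDiffOn_const
  have cont : ContinuousOn (fun p => fderiv ℝ P (firstJet u p) (0, 1, 0, 0)
      - dt (fun q => fderiv ℝ P (firstJet u q) (0, 0, 1, 0)) p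
      - dx (fun q => fderiv ℝ P (firstJet u q) (0, 0, 0, 1)) p) Ω := by
    have h2 : ContDiffOn ℝ 0 (dt fun q => fderiv ℝ P (firstJet u q) (0, 0, 1, 0)) Ω :=
      (c1 _).dt_of_le hΩ (by simp)
    have h3 : ContDiffOn ℝ 0 (dx fun q => fderiv ℝ P (firstJet u q) (0, 0, 0, 1)) Ω :=
      (c1 _).dx_of_le hΩ (by simp)
    exact ((c1 _).continuousOn.sub h2.continuousOn).sub h3.continuousOn
  have hae := hΩ.ae_eq_zero_of_integral_contDiff_smul_eq_zero (μ := MeasureTheory.volume)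
    (cont.locallyIntegrableOn hΩ.measurableSet) (by
      intro φ hφ hc hs
      have hint := h.first_variation hΩ hP hu hφ hc hs
      have cD : ∀ e : FirstJet, ContDiff ℝ 1 (fun q => fderiv ℝ P (firstJet u q) e * φ q) :=
        fun e => contDiff_of_contDiffOn_of_eq_zero hΩ (isClosed_tsupport φ) hs
          ((c1 e).mul (hφ.of_le (by simp)).contDiffOn)
          fun p hp => by simp [image_eq_zero_of_notMem_tsupport hp]
      have sD : ∀ e : FirstJet, HasCompactSupport (fun q => fderiv ℝ P (firstJet u q) e * φ q) :=
        fun e => hc.mul_left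
      have hdiv := integral_divergence_eq_zero (cD (0, 0, 1, 0)) (cD (0, 0, 0, 1)) (sD _) (sD _)
      -- The two integrands differ by the divergence of a compactly supported field, whose integral
      -- is zero.
      have hsplit : ∀ p, φ p • (fderiv ℝ P (firstJet u p) (0, 1, 0, 0)
          - dt (fun q => fderiv ℝ P (firstJet u q) (0, 0, 1, 0)) p
          - dx (fun q => fderiv ℝ P (firstJet u q) (0, 0, 0, 1)) p) =
          fderiv ℝ P (firstJet u p) (0, φ p, dt φ p, dx φ p) -
          (dt (fun q => fderiv ℝ P (firstJet u q) (0, 0, 1, 0) * φ q) p +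
            dx (fun q => fderiv ℝ P (firstJet u q) (0, 0, 0, 1) * φ q) p) := by
        intro p
        by_cases hp : p ∈ tsupport φ
        · have d := fun e => (c1 e).dAt hΩ one_ne_zero (hs hp)
          have dφ := hφ.differentiable (by simp) p
          have e0 : ((0, φ p, dt φ p, dx φ p) : FirstJet) =
              φ p • (0, 1, 0, 0) + dt φ p • (0, 0, 1, 0) + dx φ p • (0, 0, 0, 1) := by
            simp
          rw [dt_mul (d _) dφ, dx_mul (d _) dφ, e0]
          simp only [map_add, map_smul, smul_eq_mul]
          ring
        · have z : ∀ e : FirstJet, (fun q => fderiv ℝ P (firstJet u q) e * φ q) =ᶠ[𝓝 p]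
              fun _ => 0 := fun e => by
            filter_upwards [eventuallyEq_zero_of_notMem_tsupport hp] with q hq
            rw [hq, mul_zero]
          rw [(z _).dt_eq, (z _).dx_eq, dt_const, dx_const, image_eq_zero_of_notMem_tsupport hp,
            dt_eq_zero_of_notMem_tsupport hp, dx_eq_zero_of_notMem_tsupport hp]
          have : ((0, 0, 0, 0) : FirstJet) = 0 := rfl
          simp [this]
      have i1 : MeasureTheory.Integrable (fun p => fderiv ℝ P (firstJet u p)
          (0, φ p, dt φ p, dx φ p)) := by
        have e0 : (fun p => fderiv ℝ P (firstJet u p) (0, φ p, dt φ p, dx φ p)) = fun p =>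
            φ p * fderiv ℝ P (firstJet u p) (0, 1, 0, 0)
            + dt φ p * fderiv ℝ P (firstJet u p) (0, 0, 1, 0)
            + dx φ p * fderiv ℝ P (firstJet u p) (0, 0, 0, 1) := by
          funext p
          have e0 : ((0, φ p, dt φ p, dx φ p) : FirstJet) =
              φ p • (0, 1, 0, 0) + dt φ p • (0, 0, 1, 0) + dx φ p • (0, 0, 0, 1) := by
            simp
          rw [e0]
          simp only [map_add, map_smul, smul_eq_mul]
        have i0 : ∀ (e : FirstJet) (ψ : ℝ × ℝ → ℝ), Continuous ψ → (∀ p ∉ tsupport φ, ψ p = 0) →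
            MeasureTheory.Integrable (fun p => ψ p * fderiv ℝ P (firstJet u p) e) := by
          intro e ψ hψ h0
          have cc : ContDiff ℝ 0 (fun p => ψ p * fderiv ℝ P (firstJet u p) e) :=
            contDiff_of_contDiffOn_of_eq_zero hΩ (isClosed_tsupport φ) hs
              (contDiffOn_zero.2 (hψ.continuousOn.mul (c1 e).continuousOn))
              fun p hp => by simp [h0 p hp]
          exact cc.continuous.integrable_of_hasCompactSupport
            (HasCompactSupport.intro hc fun p hp => by simp [h0 p hp])
        rw [e0]
        exact ((i0 _ φ hφ.continuous fun p hp => image_eq_zero_of_notMem_tsupport hp).add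
          (i0 _ _ hφ.dt.continuous fun p hp => dt_eq_zero_of_notMem_tsupport hp)).add
          (i0 _ _ hφ.dx.continuous fun p hp => dx_eq_zero_of_notMem_tsupport hp)
      have i2 : MeasureTheory.Integrable (fun p =>
          dt (fun q => fderiv ℝ P (firstJet u q) (0, 0, 1, 0) * φ q) p +
            dx (fun q => fderiv ℝ P (firstJet u q) (0, 0, 0, 1) * φ q) p) := by
        have z : ∀ p ∉ tsupport φ, ∀ e : FirstJet,
            (fun q => fderiv ℝ P (firstJet u q) e * φ q) =ᶠ[𝓝 p] fun _ => 0 := fun p hp e => by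
          filter_upwards [eventuallyEq_zero_of_notMem_tsupport hp] with q hq
          rw [hq, mul_zero]
        have a1 := ((cD (0, 0, 1, 0)).contDiffOn (s := univ)).dt_of_le isOpen_univ
          (m := 0) (by simp)
        have a2 := ((cD (0, 0, 0, 1)).contDiffOn (s := univ)).dx_of_le isOpen_univ
          (m := 0) (by simp)
        refine ((contDiffOn_univ.1 a1).continuous.add
          (contDiffOn_univ.1 a2).continuous).integrable_of_hasCompactSupport
          (HasCompactSupport.intro hc fun p hp => ?_)
        simp only [Pi.add_apply]
        rw [(z p hp _).dt_eq, (z p hp _).dx_eq, dt_const, dx_const, add_zero]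
      simp_rw [hsplit]
      rw [MeasureTheory.integral_sub i1 i2, hint, hdiv, sub_zero])
  have heq := MeasureTheory.Measure.eqOn_open_of_ae_eq (μ := MeasureTheory.volume)
    ((MeasureTheory.ae_restrict_iff' hΩ.measurableSet).2 hae) hΩ cont continuousOn_const
  exact heq hp

/-- A quadratic polynomial can have any second-order jet at `p`, so `r`, `s`, `y` (the values of
`u_tt`, `u_tx`, `u_xx`) become independent variables. -/
theorem IsNullLagrangian.euler_lagrange (h : IsNullLagrangian Ω P) (hΩ : IsOpen Ω)
    (hP : ContDiffOn ℝ 2 P (Ω ×ˢ univ)) {p : ℝ × ℝ} (hp : p ∈ Ω) (u v w r s y : ℝ) :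
    fderiv ℝ P (p, u, v, w) (0, 1, 0, 0)
      - fderiv ℝ (fun z => fderiv ℝ P z (0, 0, 1, 0)) (p, u, v, w) ((1, 0), v, r, s)
      - fderiv ℝ (fun z => fderiv ℝ P z (0, 0, 0, 1)) (p, u, v, w) ((0, 1), w, s, y) = 0 := by
  obtain ⟨U, hUdef⟩ : ∃ U : ℝ × ℝ → ℝ, U = fun q => u + v * (q.1 - p.1) + w * (q.2 - p.2)
    + 1 / 2 * r * (q.1 - p.1) ^ 2 + s * (q.1 - p.1) * (q.2 - p.2)
    + 1 / 2 * y * (q.2 - p.2) ^ 2 := ⟨_, rfl⟩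
  have hU : ContDiff ℝ ∞ U := by rw [hUdef]; fun_prop
  have Ut : dt U = fun q => v + r * (q.1 - p.1) + s * (q.2 - p.2) := by
    funext q
    have hd := (hasDerivAt_id q.1).sub_const p.1
    rw [hUdef]
    refine HasDerivAt.deriv ?_
    have := (((((hasDerivAt_const q.1 u).add (hd.const_mul v)).add_const (w * (q.2 - p.2))).add
      ((hd.pow 2).const_mul (1 / 2 * r))).add ((hd.const_mul s).mul_const (q.2 - p.2))).add_const
      (1 / 2 * y * (q.2 - p.2) ^ 2)
    refine this.congr_deriv ?_
    simp
    ring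
  have Ux : dx U = fun q => w + s * (q.1 - p.1) + y * (q.2 - p.2) := by
    funext q
    have hd := (hasDerivAt_id q.2).sub_const p.2
    rw [hUdef]
    refine HasDerivAt.deriv ?_
    have := ((((hd.const_mul w).const_add (u + v * (q.1 - p.1))).add_const
      (1 / 2 * r * (q.1 - p.1) ^ 2)).add (hd.const_mul (s * (q.1 - p.1)))).add
      ((hd.pow 2).const_mul (1 / 2 * y))
    refine this.congr_deriv ?_
    simp
    ring
  have key := h.euler_lagrange_along hΩ hP hU hp
  have hjet : firstJet U p = (p, u, v, w) := by
    simp only [firstJet, Ut, Ux]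
    simp [hUdef]
  have hopen : IsOpen (Ω ×ˢ (univ : Set (ℝ × ℝ × ℝ))) := hΩ.prod isOpen_univ
  have cP' : ContDiffOn ℝ 1 (fderiv ℝ P) (Ω ×ˢ univ) :=
    hP.fderiv_of_isOpen hopen (by norm_num [one_add_one_eq_two])
  have dP : ∀ e : FirstJet, DifferentiableAt ℝ (fun z => fderiv ℝ P z e) (p, u, v, w) := fun e =>
    ((cP'.clm_apply contDiffOn_const).contDiffAt
      (hopen.mem_nhds ⟨hp, mem_univ _⟩)).differentiableAt one_ne_zero
  have hUd := fun q => hU.differentiable (by simp) q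
  have jt : HasDerivAt (fun t => firstJet U (t, p.2)) ((1, 0), v, r, s) p.1 := by
    simp only [firstJet, Ut, Ux]
    refine ((hasDerivAt_id p.1).prodMk (hasDerivAt_const _ _)).prodMk
      (HasDerivAt.prodMk ?_ (HasDerivAt.prodMk ?_ ?_))
    · have := hasDerivAt_dt (hUd p)
      simp only [Ut] at this
      simpa using this
    · simpa using ((((hasDerivAt_id p.1).sub_const p.1).const_mul r).const_add v).add_const
        (s * (p.2 - p.2))
    · simpa using ((((hasDerivAt_id p.1).sub_const p.1).const_mul s).const_add w).add_const
        (y * (p.2 - p.2))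
  have jx : HasDerivAt (fun t => firstJet U (p.1, t)) ((0, 1), w, s, y) p.2 := by
    simp only [firstJet, Ut, Ux]
    refine ((hasDerivAt_const _ _).prodMk (hasDerivAt_id p.2)).prodMk
      (HasDerivAt.prodMk ?_ (HasDerivAt.prodMk ?_ ?_))
    · have := hasDerivAt_dx (hUd p)
      simp only [Ux] at this
      simpa using this
    · simpa using (((hasDerivAt_id p.2).sub_const p.2).const_mul s).const_add
        (v + r * (p.1 - p.1))
    · simpa using (((hasDerivAt_id p.2).sub_const p.2).const_mul y).const_add
        (w + s * (p.1 - p.1))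
  have et : dt (fun q => fderiv ℝ P (firstJet U q) (0, 0, 1, 0)) p =
      fderiv ℝ (fun z => fderiv ℝ P z (0, 0, 1, 0)) (p, u, v, w) ((1, 0), v, r, s) := by
    have d := (dP (0, 0, 1, 0)).hasFDerivAt
    rw [← hjet] at d
    have := HasFDerivAt.comp_hasDerivAt (f := fun t => firstJet U (t, p.2)) p.1 d jt
    rw [← hjet]
    exact this.deriv
  have ex : dx (fun q => fderiv ℝ P (firstJet U q) (0, 0, 0, 1)) p =
      fderiv ℝ (fun z => fderiv ℝ P z (0, 0, 0, 1)) (p, u, v, w) ((0, 1), w, s, y) := by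
    have d := (dP (0, 0, 0, 1)).hasFDerivAt
    rw [← hjet] at d
    have := HasFDerivAt.comp_hasDerivAt (f := fun t => firstJet U (p.1, t)) p.2 d jx
    rw [← hjet]
    exact this.deriv
  rwa [et, ex, hjet] at key

end NullLagrangian

/-! ### The determining equations of a multiplier -/

section DeterminingEquations

/-- What remains of `(u_tt - c² u_xx + g) Q` after a divergence is subtracted. -/
noncomputable def reducedLagrangian (c : ℝ) (g : (ℝ × ℝ) × ℝ × ℝ → ℝ) (Q1 Q2 Q0 : ℝ × ℝ → ℝ)
    (z : FirstJet) : ℝ :=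
  1 / 2 * (dx Q2 z.1 - dt Q1 z.1 - 2 * Q0 z.1) * z.2.2.1 ^ 2
    + c ^ 2 / 2 * (dx Q2 z.1 - dt Q1 z.1 + 2 * Q0 z.1) * z.2.2.2 ^ 2
    + (c ^ 2 * dx Q1 z.1 - dt Q2 z.1) * z.2.2.1 * z.2.2.2 + 1 / 2 * box c Q0 z.1 * z.2.1 ^ 2
    + g (z.1, z.2.1, z.2.2.1) * (Q1 z.1 * z.2.2.1 + Q2 z.1 * z.2.2.2 + Q0 z.1 * z.2.1)

theorem Filter.EventuallyEq.iterate_dx {w₁ w₂ : ℝ × ℝ → ℝ} {p : ℝ × ℝ} (h : w₁ =ᶠ[𝓝 p] w₂) (i : ℕ) :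
    dx^[i] w₁ =ᶠ[𝓝 p] dx^[i] w₂ := by
  induction i with
  | zero => exact h
  | succ i ih =>
    rw [Function.iterate_succ_apply', Function.iterate_succ_apply']
    exact ih.eventuallyEq_dx

/-- Locality of jets: off the support of a variation the density and flux do not change, whatever
their order. -/
theorem Filter.EventuallyEq.jet_eq {w₁ w₂ : ℝ × ℝ → ℝ} {p : ℝ × ℝ} (h : w₁ =ᶠ[𝓝 p] w₂) (N : ℕ) :
    jet N w₁ p = jet N w₂ p := by
  simp only [jet, Prod.mk.injEq, true_and]
  exact ⟨funext fun i => (h.iterate_dx i).eq_of_nhds,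
    funext fun i => (h.eventuallyEq_dt.iterate_dx i).eq_of_nhds⟩

theorem ContDiff.iterate_dx {w : ℝ × ℝ → ℝ} (h : ContDiff ℝ ∞ w) (i : ℕ) :
    ContDiff ℝ ∞ (_root_.dx^[i] w) := by
  induction i with
  | zero => exact h
  | succ i ih => rw [Function.iterate_succ_apply']; exact ih.dx

theorem contDiff_jet {u : ℝ × ℝ → ℝ} (hu : ContDiff ℝ ∞ u) (N : ℕ) : ContDiff ℝ ∞ (jet N u) :=
  contDiff_id.prodMk ((contDiff_pi.2 fun i : Fin (N + 1) => hu.iterate_dx i).prodMk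
    (contDiff_pi.2 fun i : Fin (N + 1) => hu.dt.iterate_dx i))

variable {c : ℝ} {Ω : Set (ℝ × ℝ)} {g : (ℝ × ℝ) × ℝ × ℝ → ℝ} {Q1 Q2 Q0 : ℝ × ℝ → ℝ}

theorem contDiffOn_waveDensity (hΩ : IsOpen Ω) (h1 : ContDiffOn ℝ ∞ Q1 Ω) (h2 : ContDiffOn ℝ ∞ Q2 Ω)
    (h0 : ContDiffOn ℝ ∞ Q0 Ω) {u : ℝ × ℝ → ℝ} (hu : ContDiff ℝ ∞ u) :
    ContDiffOn ℝ ∞ (waveDensity c Q1 Q2 Q0 u) Ω := by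
  have := h0.dt hΩ
  have := hu.dt
  have := hu.dx
  unfold waveDensity
  fun_prop

theorem contDiffOn_waveFlux (hΩ : IsOpen Ω) (h1 : ContDiffOn ℝ ∞ Q1 Ω) (h2 : ContDiffOn ℝ ∞ Q2 Ω)
    (h0 : ContDiffOn ℝ ∞ Q0 Ω) {u : ℝ × ℝ → ℝ} (hu : ContDiff ℝ ∞ u) :
    ContDiffOn ℝ ∞ (waveFlux c Q1 Q2 Q0 u) Ω := by
  have := h0.dx hΩ
  have := hu.dt
  have := hu.dx
  unfold waveFlux
  fun_prop

theorem Filter.EventuallyEq.waveDensity_eq {w₁ w₂ : ℝ × ℝ → ℝ} {p : ℝ × ℝ} (h : w₁ =ᶠ[𝓝 p] w₂) :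
    waveDensity c Q1 Q2 Q0 w₁ p = waveDensity c Q1 Q2 Q0 w₂ p := by
  simp only [waveDensity, h.eq_of_nhds, h.dt_eq, h.dx_eq]

theorem Filter.EventuallyEq.waveFlux_eq {w₁ w₂ : ℝ × ℝ → ℝ} {p : ℝ × ℝ} (h : w₁ =ᶠ[𝓝 p] w₂) :
    waveFlux c Q1 Q2 Q0 w₁ p = waveFlux c Q1 Q2 Q0 w₂ p := by
  simp only [waveFlux, h.eq_of_nhds, h.dt_eq, h.dx_eq]

/-- Along any smooth function the remainder is the divergence of `T` minus `waveDensity` and `Ψ`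
minus `waveFlux`. The difference of these fields for `u + φ` and `u` is `C¹` and vanishes off the
support of `φ`, so its divergence integrates to zero. -/
theorem IsMultiplier.isNullLagrangian (h : IsMultiplier c Ω g Q1 Q2 Q0) (hΩ : IsOpen Ω)
    (h1 : ContDiffOn ℝ ∞ Q1 Ω) (h2 : ContDiffOn ℝ ∞ Q2 Ω) (h0 : ContDiffOn ℝ ∞ Q0 Ω) :
    IsNullLagrangian Ω (reducedLagrangian c g Q1 Q2 Q0) := by
  obtain ⟨N, T, Ψ, hT, hΨ, hid⟩ := h
  intro u φ hu hφ hc hs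
  have hv : ContDiff ℝ ∞ (fun q => u q + φ q) := hu.add hφ
  have cT : ∀ {U : ℝ × ℝ → ℝ}, ContDiff ℝ ∞ U →
      ContDiffOn ℝ 1 (fun q => T (jet N U q) - waveDensity c Q1 Q2 Q0 U q) Ω := fun {U} hU =>
    (hT.comp ((contDiff_jet hU N).of_le (by simp)).contDiffOn fun p hp => ⟨hp, mem_univ _⟩).sub
      ((contDiffOn_waveDensity hΩ h1 h2 h0 hU).of_le (by simp))
  have cΨ : ∀ {U : ℝ × ℝ → ℝ}, ContDiff ℝ ∞ U →
      ContDiffOn ℝ 1 (fun q => Ψ (jet N U q) - waveFlux c Q1 Q2 Q0 U q) Ω := fun {U} hU =>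
    (hΨ.comp ((contDiff_jet hU N).of_le (by simp)).contDiffOn fun p hp => ⟨hp, mem_univ _⟩).sub
      ((contDiffOn_waveFlux hΩ h1 h2 h0 hU).of_le (by simp))
  have hred : ∀ {U : ℝ × ℝ → ℝ}, ContDiff ℝ ∞ U → ∀ p ∈ Ω,
      reducedLagrangian c g Q1 Q2 Q0 (firstJet U p) =
        dt (fun q => T (jet N U q) - waveDensity c Q1 Q2 Q0 U q) p +
        dx (fun q => Ψ (jet N U q) - waveFlux c Q1 Q2 Q0 U q) p := by
    intro U hU p hp
    have dT : DifferentiableAt ℝ (fun q => T (jet N U q)) p :=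
      ContDiffOn.dAt hΩ one_ne_zero (hT.comp ((contDiff_jet hU N).of_le (by simp)).contDiffOn
        fun p hp => ⟨hp, mem_univ _⟩) hp
    have dΨ : DifferentiableAt ℝ (fun q => Ψ (jet N U q)) p :=
      ContDiffOn.dAt hΩ one_ne_zero (hΨ.comp ((contDiff_jet hU N).of_le (by simp)).contDiffOn
        fun p hp => ⟨hp, mem_univ _⟩) hp
    rw [dt_sub dT ((contDiffOn_waveDensity hΩ h1 h2 h0 hU).smoothAt hΩ hp),
      dx_sub dΨ ((contDiffOn_waveFlux hΩ h1 h2 h0 hU).smoothAt hΩ hp)]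
    have e1 := hid U hU p hp
    have e2 := wave_mul_multExpr (c := c) hΩ h1 h2 h0 hU.contDiffOn hp
    rw [add_mul, e2] at e1
    simp only [reducedLagrangian, firstJet]
    simp only [multExpr] at e1
    linear_combination e1
  have hev : ∀ p ∉ tsupport φ, (fun q => u q + φ q) =ᶠ[𝓝 p] u := fun p hp => by
    filter_upwards [eventuallyEq_zero_of_notMem_tsupport hp] with q hq
    rw [hq, add_zero]
  set D₁ : ℝ × ℝ → ℝ := fun q =>
    (T (jet N (fun q => u q + φ q) q) - waveDensity c Q1 Q2 Q0 (fun q => u q + φ q) q)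
      - (T (jet N u q) - waveDensity c Q1 Q2 Q0 u q)
  set D₂ : ℝ × ℝ → ℝ := fun q =>
    (Ψ (jet N (fun q => u q + φ q) q) - waveFlux c Q1 Q2 Q0 (fun q => u q + φ q) q)
      - (Ψ (jet N u q) - waveFlux c Q1 Q2 Q0 u q)
  have z₁ : ∀ p ∉ tsupport φ, D₁ p = 0 := fun p hp => by
    simp only [D₁, (hev p hp).jet_eq, (hev p hp).waveDensity_eq, sub_self]
  have z₂ : ∀ p ∉ tsupport φ, D₂ p = 0 := fun p hp => by
    simp only [D₂, (hev p hp).jet_eq, (hev p hp).waveFlux_eq, sub_self]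
  have hdiv := integral_divergence_eq_zero
    (contDiff_of_contDiffOn_of_eq_zero hΩ (isClosed_tsupport φ) hs ((cT hv).sub (cT hu)) z₁)
    (contDiff_of_contDiffOn_of_eq_zero hΩ (isClosed_tsupport φ) hs ((cΨ hv).sub (cΨ hu)) z₂)
    (HasCompactSupport.intro hc z₁) (HasCompactSupport.intro hc z₂)
  rw [← hdiv]
  congr 1
  funext p
  by_cases hp : p ∈ tsupport φ
  · have hpΩ := hs hp
    rw [hred hv p hpΩ, hred hu p hpΩ,
      dt_sub ((cT hv).dAt hΩ one_ne_zero hpΩ) ((cT hu).dAt hΩ one_ne_zero hpΩ),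
      dx_sub ((cΨ hv).dAt hΩ one_ne_zero hpΩ) ((cΨ hu).dAt hΩ one_ne_zero hpΩ)]
    ring
  · have hopen : ∀ᶠ q in 𝓝 p, q ∉ tsupport φ := (isClosed_tsupport φ).isOpen_compl.mem_nhds hp
    have y₁ : D₁ =ᶠ[𝓝 p] fun _ => 0 := hopen.mono z₁
    have y₂ : D₂ =ᶠ[𝓝 p] fun _ => 0 := hopen.mono z₂
    rw [y₁.dt_eq, y₂.dx_eq, dt_const, dx_const]
    simp only [firstJet, (hev p hp).eq_of_nhds, (hev p hp).dt_eq, (hev p hp).dx_eq, sub_self,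
      add_zero]

theorem contDiffOn_reducedLagrangian (hΩ : IsOpen Ω) (hg : ContDiffOn ℝ 2 g (Ω ×ˢ univ))
    (h1 : ContDiffOn ℝ ∞ Q1 Ω) (h2 : ContDiffOn ℝ ∞ Q2 Ω) (h0 : ContDiffOn ℝ ∞ Q0 Ω) :
    ContDiffOn ℝ 2 (reducedLagrangian c g Q1 Q2 Q0) (Ω ×ˢ univ) := by
  have lift : ∀ {w : ℝ × ℝ → ℝ}, ContDiffOn ℝ ∞ w Ω →
      ContDiffOn ℝ 2 (fun z : FirstJet => w z.1) (Ω ×ˢ univ) := fun h =>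
    (ContDiffOn.of_le (m := 2) (n := ∞) h (by norm_cast)).comp contDiffOn_fst (fun z hz => hz.1)
  have cg : ContDiffOn ℝ 2 (fun z : FirstJet => g (z.1, z.2.1, z.2.2.1)) (Ω ×ˢ univ) :=
    hg.comp (f := fun z : FirstJet => (z.1, z.2.1, z.2.2.1)) (by fun_prop)
      fun z hz => ⟨hz.1, mem_univ _⟩
  have general : ∀ {S : Set FirstJet} {q1 q2 q0 q1t q1x q2t q2x b G : FirstJet → ℝ},
      ContDiffOn ℝ 2 q1 S → ContDiffOn ℝ 2 q2 S → ContDiffOn ℝ 2 q0 S → ContDiffOn ℝ 2 q1t S →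
      ContDiffOn ℝ 2 q1x S → ContDiffOn ℝ 2 q2t S → ContDiffOn ℝ 2 q2x S → ContDiffOn ℝ 2 b S →
      ContDiffOn ℝ 2 G S → ContDiffOn ℝ 2 (fun z =>
        1 / 2 * (q2x z - q1t z - 2 * q0 z) * z.2.2.1 ^ 2
        + c ^ 2 / 2 * (q2x z - q1t z + 2 * q0 z) * z.2.2.2 ^ 2
        + (c ^ 2 * q1x z - q2t z) * z.2.2.1 * z.2.2.2 + 1 / 2 * b z * z.2.1 ^ 2
        + G z * (q1 z * z.2.2.1 + q2 z * z.2.2.2 + q0 z * z.2.1)) S := by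
    intros
    fun_prop
  exact general (lift h1) (lift h2) (lift h0) (lift (h1.dt hΩ)) (lift (h1.dx hΩ)) (lift (h2.dt hΩ))
    (lift (h2.dx hΩ)) (lift (h0.box hΩ)) cg

theorem hasDerivAt_firstJet_w {F : FirstJet → ℝ} {p : ℝ × ℝ} {u v w : ℝ}
    (hF : DifferentiableAt ℝ F (p, u, v, w)) :
    HasDerivAt (fun s => F (p, u, v, s)) (fderiv ℝ F (p, u, v, w) (0, 0, 0, 1)) w :=
  HasFDerivAt.comp_hasDerivAt (f := fun s : ℝ => ((p, u, v, s) : FirstJet)) w hF.hasFDerivAt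
    ((hasDerivAt_const _ _).prodMk ((hasDerivAt_const _ _).prodMk
      ((hasDerivAt_const _ _).prodMk (hasDerivAt_id w))))

theorem hasDerivAt_firstJet_v {F : FirstJet → ℝ} {p : ℝ × ℝ} {u v w : ℝ}
    (hF : DifferentiableAt ℝ F (p, u, v, w)) :
    HasDerivAt (fun s => F (p, u, s, w)) (fderiv ℝ F (p, u, v, w) (0, 0, 1, 0)) v :=
  HasFDerivAt.comp_hasDerivAt (f := fun s : ℝ => ((p, u, s, w) : FirstJet)) v hF.hasFDerivAt
    ((hasDerivAt_const _ _).prodMk ((hasDerivAt_const _ _).prodMk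
      ((hasDerivAt_id v).prodMk (hasDerivAt_const _ _))))

theorem hasDerivAt_firstJet_u {F : FirstJet → ℝ} {p : ℝ × ℝ} {u v w : ℝ}
    (hF : DifferentiableAt ℝ F (p, u, v, w)) :
    HasDerivAt (fun s => F (p, s, v, w)) (fderiv ℝ F (p, u, v, w) (0, 1, 0, 0)) u :=
  HasFDerivAt.comp_hasDerivAt (f := fun s : ℝ => ((p, s, v, w) : FirstJet)) u hF.hasFDerivAt
    ((hasDerivAt_const _ _).prodMk ((hasDerivAt_id u).prodMk (hasDerivAt_const _ _)))

theorem hasDerivAt_firstJet_t {F : FirstJet → ℝ} {p : ℝ × ℝ} {u v w : ℝ}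
    (hF : DifferentiableAt ℝ F (p, u, v, w)) :
    HasDerivAt (fun s => F ((s, p.2), u, v, w)) (fderiv ℝ F (p, u, v, w) ((1, 0), 0, 0, 0)) p.1 :=
  HasFDerivAt.comp_hasDerivAt (f := fun s : ℝ => (((s, p.2), u, v, w) : FirstJet)) p.1
    hF.hasFDerivAt (((hasDerivAt_id _).prodMk (hasDerivAt_const _ _)).prodMk
      (hasDerivAt_const _ _))

theorem hasDerivAt_firstJet_x {F : FirstJet → ℝ} {p : ℝ × ℝ} {u v w : ℝ}
    (hF : DifferentiableAt ℝ F (p, u, v, w)) :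
    HasDerivAt (fun s => F ((p.1, s), u, v, w)) (fderiv ℝ F (p, u, v, w) ((0, 1), 0, 0, 0)) p.2 :=
  HasFDerivAt.comp_hasDerivAt (f := fun s : ℝ => (((p.1, s), u, v, w) : FirstJet)) p.2
    hF.hasFDerivAt (((hasDerivAt_const _ _).prodMk (hasDerivAt_id _)).prodMk
      (hasDerivAt_const _ _))

/-- The determining equations, before the dependence of `g` on `u_t` is resolved. -/
theorem IsMultiplier.determining_equations (h : IsMultiplier c Ω g Q1 Q2 Q0) (hc : 0 < c)
    (hΩ : IsOpen Ω) (hg : ContDiffOn ℝ 2 g (Ω ×ˢ univ)) (h1 : ContDiffOn ℝ ∞ Q1 Ω)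
    (h2 : ContDiffOn ℝ ∞ Q2 Ω) (h0 : ContDiffOn ℝ ∞ Q0 Ω) {p : ℝ × ℝ} (hp : p ∈ Ω) :
    2 * Q0 p = dt Q1 p - dx Q2 p ∧
    (∀ u v g' : ℝ, HasDerivAt (fun s => g (p, u, s)) g' v →
      Q2 p * g' = dt Q2 p - c ^ 2 * dx Q1 p) ∧
    (∀ u : ℝ, ∃ m l : ℝ, ∀ v : ℝ,
      g (p, u, v) * (Q1 p * v + Q0 p * u) = 2 * Q0 p * v ^ 2 + m * v + l) ∧
    ∀ G : ℝ × ℝ → ℝ, DifferentiableAt ℝ G p →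
      (∀ᶠ q in 𝓝 p, ∀ u v : ℝ, g (q, u, v) = G q * v + g (q, u, 0)) → ∀ u : ℝ,
      Q1 p * dt (fun q => g (q, u, 0)) p + Q2 p * dx (fun q => g (q, u, 0)) p
        - Q0 p * u * deriv (fun s => g (p, s, 0)) u
        + (dt Q1 p + dx Q2 p - Q0 p) * g (p, u, 0) =
        (box c Q0 p - dt (fun q => G q * Q0 q) p) * u := by
  have hnull := h.isNullLagrangian hΩ h1 h2 h0
  have hP := contDiffOn_reducedLagrangian (c := c) hΩ hg h1 h2 h0
  set P := reducedLagrangian c g Q1 Q2 Q0 with hPdef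
  have hopen : IsOpen (Ω ×ˢ (univ : Set (ℝ × ℝ × ℝ))) := hΩ.prod isOpen_univ
  have cP' : ContDiffOn ℝ 1 (fderiv ℝ P) (Ω ×ˢ univ) :=
    hP.fderiv_of_isOpen hopen (by norm_num [one_add_one_eq_two])
  have dP : ∀ {q : ℝ × ℝ}, q ∈ Ω → ∀ u v w : ℝ, DifferentiableAt ℝ P (q, u, v, w) :=
    fun hq u v w => (hP.contDiffAt (hopen.mem_nhds ⟨hq, mem_univ _⟩)).differentiableAt two_ne_zero
  have dP' : ∀ (e : FirstJet) (u v w : ℝ),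
      DifferentiableAt ℝ (fun z => fderiv ℝ P z e) (p, u, v, w) := fun e u v w =>
    ((cP'.clm_apply contDiffOn_const).contDiffAt
      (hopen.mem_nhds ⟨hp, mem_univ _⟩)).differentiableAt one_ne_zero
  have dg : ∀ {q : ℝ × ℝ}, q ∈ Ω → ∀ u v : ℝ, DifferentiableAt ℝ g (q, u, v) := fun hq u v =>
    (hg.contDiffAt ((hΩ.prod isOpen_univ).mem_nhds ⟨hq, mem_univ _⟩)).differentiableAt two_ne_zero
  have dgv : ∀ {q : ℝ × ℝ}, q ∈ Ω → ∀ u v : ℝ,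
      HasDerivAt (fun s => g (q, u, s)) (deriv (fun s => g (q, u, s)) v) v := fun {q} hq u v => by
    refine DifferentiableAt.hasDerivAt ?_
    exact (dg hq u v).comp (f := fun s : ℝ => (q, u, s)) v (by fun_prop)
  have el := fun u v w r s y => hnull.euler_lagrange hΩ hP hp u v w r s y
  set Pv : FirstJet → ℝ := fun z => fderiv ℝ P z (0, 0, 1, 0) with hPv
  set Pw : FirstJet → ℝ := fun z => fderiv ℝ P z (0, 0, 0, 1) with hPw
  have ePw : ∀ {q : ℝ × ℝ}, q ∈ Ω → ∀ u v w : ℝ, Pw (q, u, v, w) =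
      c ^ 2 * (dx Q2 q - dt Q1 q + 2 * Q0 q) * w + (c ^ 2 * dx Q1 q - dt Q2 q) * v
        + g (q, u, v) * Q2 q := by
    intro q hq u v w
    refine (hasDerivAt_firstJet_w (dP hq u v w)).unique ?_
    have hid := hasDerivAt_id w
    have := (((((hid.pow 2).const_mul (c ^ 2 / 2 * (dx Q2 q - dt Q1 q + 2 * Q0 q))).const_add
      (1 / 2 * (dx Q2 q - dt Q1 q - 2 * Q0 q) * v ^ 2)).add
      (hid.const_mul ((c ^ 2 * dx Q1 q - dt Q2 q) * v))).add_const (1 / 2 * box c Q0 q * u ^ 2)).add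
      ((((hid.const_mul (Q2 q)).const_add (Q1 q * v)).add_const (Q0 q * u)).const_mul (g (q, u, v)))
    refine this.congr_deriv ?_
    simp
    ring
  have ePv : ∀ {q : ℝ × ℝ}, q ∈ Ω → ∀ u v w : ℝ, Pv (q, u, v, w) =
      (dx Q2 q - dt Q1 q - 2 * Q0 q) * v + (c ^ 2 * dx Q1 q - dt Q2 q) * w
        + deriv (fun s => g (q, u, s)) v * (Q1 q * v + Q2 q * w + Q0 q * u)
        + g (q, u, v) * Q1 q := by
    intro q hq u v w
    refine (hasDerivAt_firstJet_v (dP hq u v w)).unique ?_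
    have hid := hasDerivAt_id v
    have := (((((hid.pow 2).const_mul (1 / 2 * (dx Q2 q - dt Q1 q - 2 * Q0 q))).add_const
      (c ^ 2 / 2 * (dx Q2 q - dt Q1 q + 2 * Q0 q) * w ^ 2)).add
      ((hid.const_mul (c ^ 2 * dx Q1 q - dt Q2 q)).mul_const w)).add_const
      (1 / 2 * box c Q0 q * u ^ 2)).add
      ((dgv hq u v).mul (((hid.const_mul (Q1 q)).add_const (Q2 q * w)).add_const (Q0 q * u)))
    refine this.congr_deriv ?_
    simp
    ring
  have decomp : ∀ (e : ℝ × ℝ) (a b d : ℝ), ((e, a, b, d) : FirstJet) =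
      (e, 0, 0, 0) + a • (0, 1, 0, 0) + b • (0, 0, 1, 0) + d • (0, 0, 0, 1) := by
    intro e a b d; simp
  have el' : ∀ u v w r s y : ℝ, fderiv ℝ P (p, u, v, w) (0, 1, 0, 0)
      - (fderiv ℝ Pv (p, u, v, w) ((1, 0), 0, 0, 0) + v * fderiv ℝ Pv (p, u, v, w) (0, 1, 0, 0)
        + r * fderiv ℝ Pv (p, u, v, w) (0, 0, 1, 0) + s * fderiv ℝ Pv (p, u, v, w) (0, 0, 0, 1))
      - (fderiv ℝ Pw (p, u, v, w) ((0, 1), 0, 0, 0) + w * fderiv ℝ Pw (p, u, v, w) (0, 1, 0, 0)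
        + s * fderiv ℝ Pw (p, u, v, w) (0, 0, 1, 0) + y * fderiv ℝ Pw (p, u, v, w) (0, 0, 0, 1))
      = 0 := by
    intro u v w r s y
    have := el u v w r s y
    rw [decomp (1, 0) v r s, decomp (0, 1) w s y] at this
    simpa only [map_add, map_smul, smul_eq_mul] using this
  -- The Euler–Lagrange equation is affine in `r`, `s`, `y`; comparing the values `0` and `1`
  -- isolates each coefficient.
  have hvv : ∀ u v w, fderiv ℝ Pv (p, u, v, w) (0, 0, 1, 0) = 0 := fun u v w => by
    linear_combination el' u v w 0 0 0 - el' u v w 1 0 0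
  have hww : ∀ u v w, fderiv ℝ Pw (p, u, v, w) (0, 0, 0, 1) = 0 := fun u v w => by
    linear_combination el' u v w 0 0 0 - el' u v w 0 0 1
  have hvw : ∀ u v w, fderiv ℝ Pv (p, u, v, w) (0, 0, 0, 1)
      + fderiv ℝ Pw (p, u, v, w) (0, 0, 1, 0) = 0 := fun u v w => by
    linear_combination el' u v w 0 0 0 - el' u v w 0 1 0
  -- The remaining part is needed at `u_t = u_x = 0` only.
  have hbase : ∀ u, fderiv ℝ P (p, u, 0, 0) (0, 1, 0, 0)
      - fderiv ℝ Pv (p, u, 0, 0) ((1, 0), 0, 0, 0)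
      - fderiv ℝ Pw (p, u, 0, 0) ((0, 1), 0, 0, 0) = 0 := fun u => by
    linear_combination el' u 0 0 0 0 0
  -- From `P_ww = 0`, where `P_ww = c² (Q₂_x - Q₁_t + 2 Q₀)`; this is where `c ≠ 0` matters.
  have E1 : 2 * Q0 p = dt Q1 p - dx Q2 p := by
    have hd := hasDerivAt_firstJet_w (dP' (0, 0, 0, 1) 0 0 0)
    have hd2 : HasDerivAt (fun s => Pw (p, 0, 0, s))
        (c ^ 2 * (dx Q2 p - dt Q1 p + 2 * Q0 p)) 0 := by
      simp only [ePw hp]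
      have := (((hasDerivAt_id (0 : ℝ)).const_mul
        (c ^ 2 * (dx Q2 p - dt Q1 p + 2 * Q0 p))).add_const
        ((c ^ 2 * dx Q1 p - dt Q2 p) * 0)).add_const (g (p, 0, 0) * Q2 p)
      exact this.congr_deriv (mul_one _)
    have h3 := (hww 0 0 0).symm.trans (hd.unique hd2)
    have hc2 : c ^ 2 ≠ 0 := by positivity
    have := (mul_eq_zero.1 h3.symm).resolve_left hc2
    linarith
  refine ⟨E1, ?_, ?_, ?_⟩
  -- Both mixed derivatives of `P` come out as `c² Q₁_x - Q₂_t + Q₂ g'`, and their sum is zero.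
  · intro u v g' hg'
    have hw := hasDerivAt_firstJet_w (dP' (0, 0, 1, 0) u v 0)
    have hw2 : HasDerivAt (fun s => Pv (p, u, v, s))
        ((c ^ 2 * dx Q1 p - dt Q2 p) + g' * Q2 p) 0 := by
      simp only [ePv hp, hg'.deriv]
      have hid := hasDerivAt_id (0 : ℝ)
      have := (((hid.const_mul (c ^ 2 * dx Q1 p - dt Q2 p)).const_add
        ((dx Q2 p - dt Q1 p - 2 * Q0 p) * v)).add
        ((((hid.const_mul (Q2 p)).const_add (Q1 p * v)).add_const (Q0 p * u)).const_mul
          g')).add_const (g (p, u, v) * Q1 p)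
      refine this.congr_deriv ?_
      ring
    have hv := hasDerivAt_firstJet_v (dP' (0, 0, 0, 1) u v 0)
    have hv2 : HasDerivAt (fun s => Pw (p, u, s, 0))
        ((c ^ 2 * dx Q1 p - dt Q2 p) + g' * Q2 p) v := by
      simp only [ePw hp]
      have hid := hasDerivAt_id v
      have := ((hid.const_mul (c ^ 2 * dx Q1 p - dt Q2 p)).const_add
        (c ^ 2 * (dx Q2 p - dt Q1 p + 2 * Q0 p) * 0)).add (hg'.mul_const (Q2 p))
      refine this.congr_deriv ?_
      ring
    have := hvw u v 0
    rw [hw.unique hw2, hv.unique hv2] at this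
    linarith
  -- From `P_vv = 0`, `P` is affine in `v`. At `w = 0`, by the first equation, `P` is `-2 Q₀ v² + ½
  -- □Q₀ u² + g (Q₁ v + Q₀ u)`.
  · intro u
    have hconst : ∀ v, Pv (p, u, v, 0) = Pv (p, u, 0, 0) := by
      intro v
      refine is_const_of_deriv_eq_zero (f := fun v => Pv (p, u, v, 0))
        (fun v => (hasDerivAt_firstJet_v (dP' (0, 0, 1, 0) u v 0)).differentiableAt)
        (fun v => ?_) v 0
      rw [(hasDerivAt_firstJet_v (dP' (0, 0, 1, 0) u v 0)).deriv]
      exact hvv u v 0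
    have haff : ∀ v, P (p, u, v, 0) - Pv (p, u, 0, 0) * v =
        P (p, u, 0, 0) - Pv (p, u, 0, 0) * 0 := by
      have hd : ∀ v, HasDerivAt (fun v => P (p, u, v, 0) - Pv (p, u, 0, 0) * v) 0 v := fun v => by
        have := (hasDerivAt_firstJet_v (dP hp u v 0)).sub
          ((hasDerivAt_id v).const_mul (Pv (p, u, 0, 0)))
        refine this.congr_deriv ?_
        have h3 := hconst v
        simp only [hPv] at h3 ⊢
        rw [h3]; ring
      intro v
      exact is_const_of_deriv_eq_zero (fun v => (hd v).differentiableAt) (fun v => (hd v).deriv) v 0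
    refine ⟨Pv (p, u, 0, 0), P (p, u, 0, 0) - 1 / 2 * box c Q0 p * u ^ 2, fun v => ?_⟩
    have := haff v
    simp only [hPdef, reducedLagrangian] at this ⊢
    linear_combination this - 1 / 2 * v ^ 2 * E1
  -- With `g` affine in `u_t` near `p`, `P_v` at `v = w = 0` equals `G Q₀ u + g Q₁` and `P_w` equals
  -- `g Q₂`; insert these into the remaining part.
  · intro G hG hev u
    have dh : DifferentiableAt ℝ (fun q => g (q, u, 0)) p :=
      (dg hp u 0).comp (f := fun q : ℝ × ℝ => (q, u, 0)) p (by fun_prop)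
    have dhu : DifferentiableAt ℝ (fun s : ℝ => g (p, s, 0)) u :=
      (dg hp u 0).comp (f := fun s : ℝ => (p, s, 0)) u (by fun_prop)
    have d0 := h0.smoothAt hΩ hp
    have d1 := h1.smoothAt hΩ hp
    have d2 := h2.smoothAt hΩ hp
    have evv : (fun q => Pv (q, u, 0, 0)) =ᶠ[𝓝 p] fun q =>
        G q * Q0 q * u + g (q, u, 0) * Q1 q := by
      filter_upwards [hev, hΩ.mem_nhds hp] with q hq hqΩ
      have hd : deriv (fun s => g (q, u, s)) 0 = G q := by
        refine HasDerivAt.deriv ?_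
        have := ((hasDerivAt_id (0 : ℝ)).const_mul (G q)).add_const (g (q, u, 0))
        rw [mul_one] at this
        refine this.congr_of_eventuallyEq (Eventually.of_forall fun s => ?_)
        simp only [id]
        exact hq u s
      rw [ePv hqΩ, hd]
      ring
    have ewv : (fun q => Pw (q, u, 0, 0)) =ᶠ[𝓝 p] fun q => g (q, u, 0) * Q2 q := by
      filter_upwards [hΩ.mem_nhds hp] with q hqΩ
      rw [ePw hqΩ]
      ring
    have e1 : fderiv ℝ Pv (p, u, 0, 0) ((1, 0), 0, 0, 0) =
        dt (fun q => G q * Q0 q) p * u + (dt (fun q => g (q, u, 0)) p * Q1 p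
          + g (p, u, 0) * dt Q1 p) := by
      have ha : dt (fun q => Pv (q, u, 0, 0)) p = _ :=
        (hasDerivAt_firstJet_t (dP' (0, 0, 1, 0) u 0 0)).deriv
      rw [← ha, evv.dt_eq]
      exact (((hasDerivAt_dt (hG.mul d0)).mul_const u).add
        ((hasDerivAt_dt dh).mul (hasDerivAt_dt d1))).deriv
    have e2 : fderiv ℝ Pw (p, u, 0, 0) ((0, 1), 0, 0, 0) =
        dx (fun q => g (q, u, 0)) p * Q2 p + g (p, u, 0) * dx Q2 p := by
      have ha : dx (fun q => Pw (q, u, 0, 0)) p = _ :=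
        (hasDerivAt_firstJet_x (dP' (0, 0, 0, 1) u 0 0)).deriv
      rw [← ha, ewv.dx_eq]
      exact ((hasDerivAt_dx dh).mul (hasDerivAt_dx d2)).deriv
    have e3 : fderiv ℝ P (p, u, 0, 0) (0, 1, 0, 0) = box c Q0 p * u
        + deriv (fun s => g (p, s, 0)) u * (Q0 p * u) + g (p, u, 0) * Q0 p := by
      refine (hasDerivAt_firstJet_u (dP hp u 0 0)).unique ?_
      have hfun : (fun s => P (p, s, 0, 0)) = fun s => 1 / 2 * box c Q0 p * s ^ 2
          + g (p, s, 0) * (Q0 p * s) := by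
        funext s
        simp only [hPdef, reducedLagrangian]
        ring
      rw [hfun]
      have hid := hasDerivAt_id u
      have := ((hid.pow 2).const_mul (1 / 2 * box c Q0 p)).add
        (dhu.hasDerivAt.mul (hid.const_mul (Q0 p)))
      refine this.congr_deriv ?_
      simp
      ring
    have := hbase u
    rw [e1, e2, e3] at this
    linear_combination -this

end DeterminingEquations

/-! ### The damping coefficient and the transport equation for the source. -/

section SourceEquation

/-- The equation for the part `h = h(t, x, u)` of `g` that does not involve `u_t`. -/
def SourceEquation (c : ℝ) (V : Set (ℝ × ℝ)) (Q1 Q2 Q0 G : ℝ × ℝ → ℝ) (h : (ℝ × ℝ) × ℝ → ℝ) :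
    Prop :=
  ∀ p ∈ V, ∀ u : ℝ,
    Q1 p * dt (fun q => h (q, u)) p + Q2 p * dx (fun q => h (q, u)) p
      - Q0 p * u * deriv (fun s => h (p, s)) u + (dt Q1 p + dx Q2 p - Q0 p) * h (p, u) =
      (box c Q0 p - dt (fun q => G q * Q0 q) p) * u

/-- If `g` times a nonconstant affine function is a quadratic polynomial and `g` is continuous, then
`g` is affine. -/
theorem eq_affine_of_mul_affine {g : ℝ → ℝ} (hg : Continuous g) {a b d m l : ℝ} (ha : a ≠ 0)
    (h : ∀ v, g v * (a * v + b) = d * v ^ 2 + m * v + l) (v : ℝ) : g v = d / a * v + g 0 := by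
  -- The zero of the affine factor is also a zero of the quadratic polynomial, so the quotient is
  -- affine off `v₀`, and by continuity at `v₀` too.
  set v₀ := -b / a
  have hv₀ : a * v₀ + b = 0 := by simp only [v₀]; field_simp; ring
  have key : g = fun v => (d * (v + v₀) + m) / a := by
    refine Continuous.ext_on (dense_compl_singleton v₀) hg (by fun_prop) fun v hv => ?_
    have hv' : v - v₀ ≠ 0 := sub_ne_zero.2 hv
    have h0 := h v₀
    rw [hv₀, mul_zero] at h0
    rw [eq_div_iff ha]
    apply mul_left_cancel₀ hv'
    linear_combination h v - h0 - g v * hv₀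
  rw [key]
  field_simp
  ring

variable {c : ℝ} {Ω : Set (ℝ × ℝ)} {g : (ℝ × ℝ) × ℝ × ℝ → ℝ} {Q1 Q2 Q0 : ℝ × ℝ → ℝ}

/-- Where `Q₁ ≠ 0`, dividing by the affine function `Q₁ v + Q₀ u` makes `g` affine in `v` with slope
`2 Q₀ / Q₁`. Where `Q₁ = 0` and `Q₂ ≠ 0`, the mixed equation gives `g_v` directly as `(Q₂_t - c²
Q₁_x) / Q₂`. In both regimes the slope is independent of `u` and smooth in `(t, x)`, which the
source equation requires. -/
theorem IsMultiplier.exists_damping (h : IsMultiplier c Ω g Q1 Q2 Q0) (hc : 0 < c)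
    (hΩ : IsOpen Ω) (hg : ContDiffOn ℝ 2 g (Ω ×ˢ univ)) (h1 : ContDiffOn ℝ ∞ Q1 Ω)
    (h2 : ContDiffOn ℝ ∞ Q2 Ω) (h0 : ContDiffOn ℝ ∞ Q0 Ω) {U : Set (ℝ × ℝ)} (hU : IsOpen U)
    (hUΩ : U ⊆ Ω) (hQ : (∀ p ∈ U, Q1 p ≠ 0) ∨ ∀ p ∈ U, Q1 p = 0 ∧ Q2 p ≠ 0) :
    ∃ G : ℝ × ℝ → ℝ, DampingEquations c U Q1 Q2 Q0 G ∧
      (∀ p ∈ U, ∀ u v : ℝ, g (p, u, v) = G p * v + g (p, u, 0)) ∧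
      SourceEquation c U Q1 Q2 Q0 G (fun z => g (z.1, z.2, 0)) := by
  have hdet := fun {p} (hp : p ∈ Ω) => h.determining_equations hc hΩ hg h1 h2 h0 hp
  have dgv : ∀ p ∈ Ω, ∀ u v : ℝ, DifferentiableAt ℝ (fun s => g (p, u, s)) v := fun p hp u v =>
    ((hg.contDiffAt ((hΩ.prod isOpen_univ).mem_nhds ⟨hp, mem_univ _⟩)).differentiableAt
      two_ne_zero).comp (f := fun s : ℝ => (p, u, s)) v (by fun_prop)
  obtain ⟨G, sG, hG1, hG2, hgG⟩ : ∃ G : ℝ × ℝ → ℝ, ContDiffOn ℝ ∞ G U ∧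
      (∀ p ∈ U, Q1 p * G p = 2 * Q0 p) ∧
      (∀ p ∈ U, Q2 p * G p = dt Q2 p - c ^ 2 * dx Q1 p) ∧
      ∀ p ∈ U, ∀ u v : ℝ, g (p, u, v) = G p * v + g (p, u, 0) := by
    rcases hQ with hQ | hQ
    · have haff : ∀ p ∈ U, ∀ u v : ℝ, g (p, u, v) = 2 * Q0 p / Q1 p * v + g (p, u, 0) := by
        intro p hp u v
        obtain ⟨m, l, hml⟩ := (hdet (hUΩ hp)).2.2.1 u
        exact eq_affine_of_mul_affine (g := fun s => g (p, u, s))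
          (continuous_iff_continuousAt.2 fun s => (dgv p (hUΩ hp) u s).continuousAt) (hQ p hp) hml v
      refine ⟨fun p => 2 * Q0 p / Q1 p,
        ((contDiffOn_const.mul h0).mono hUΩ).div (h1.mono hUΩ) hQ, fun p hp => ?_, fun p hp => ?_,
        haff⟩
      · have := hQ p hp
        field_simp
      · refine (hdet (hUΩ hp)).2.1 0 0 _ ?_
        rw [funext (haff p hp 0)]
        exact (((hasDerivAt_id (0 : ℝ)).const_mul (2 * Q0 p / Q1 p)).add_const
          (g (p, 0, 0))).congr_deriv (mul_one _)
    · have hder : ∀ p ∈ U, ∀ u v : ℝ,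
          deriv (fun s => g (p, u, s)) v = (dt Q2 p - c ^ 2 * dx Q1 p) / Q2 p := fun p hp u v => by
        rw [eq_div_iff (hQ p hp).2, mul_comm]
        exact (hdet (hUΩ hp)).2.1 u v _ (dgv p (hUΩ hp) u v).hasDerivAt
      refine ⟨fun p => (dt Q2 p - c ^ 2 * dx Q1 p) / Q2 p,
        ((((h2.dt hΩ).sub (contDiffOn_const.mul (h1.dx hΩ)))).mono hUΩ).div (h2.mono hUΩ)
          fun p hp => (hQ p hp).2, fun p hp => ?_, fun p hp => ?_, fun p hp u v => ?_⟩
      -- For `Q₁ = 0` and `u = 0` the polynomial `2 Q₀ v² + m v + l` vanishes identically; its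
      -- values at `0`, `1`, `-1` give `Q₀ = 0`.
      · obtain ⟨m, l, hml⟩ := (hdet (hUΩ hp)).2.2.1 0
        have e0 := hml 0
        have e1 := hml 1
        have e2 := hml (-1)
        simp only [(hQ p hp).1] at e0 e1 e2 ⊢
        linarith
      · have := (hQ p hp).2
        field_simp
      · have hd : ∀ v, HasDerivAt (fun v => g (p, u, v)
            - (dt Q2 p - c ^ 2 * dx Q1 p) / Q2 p * v) 0 v := fun v => by
          refine ((dgv p (hUΩ hp) u v).hasDerivAt.sub
            ((hasDerivAt_id v).const_mul _)).congr_deriv ?_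
          rw [hder p hp u v, mul_one, sub_self]
        have := is_const_of_deriv_eq_zero (fun v => (hd v).differentiableAt)
          (fun v => (hd v).deriv) v 0
        linear_combination this
  refine ⟨G, ⟨h1.mono hUΩ, h2.mono hUΩ, h0.mono hUΩ, sG, fun p hp => (hdet (hUΩ hp)).1, hG1, hG2⟩,
    hgG, fun p hp u => ?_⟩
  exact (hdet (hUΩ hp)).2.2.2 G (sG.smoothAt hU hp)
    (eventually_of_mem (hU.mem_nhds hp) hgG) u

end SourceEquation

/-! ### Smoothness of the flow of a scalar time-dependent vector field -/

section Flow

/-- A function whose partial derivatives are `C^n` on an open set is `C^{n+1}` there. -/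
theorem contDiffOn_succ_of_partial {n : ℕ} {S : Set (ℝ × ℝ)} (hS : IsOpen S) {φ a b : ℝ × ℝ → ℝ}
    (ha : ContDiffOn ℝ n a S) (hb : ContDiffOn ℝ n b S)
    (h1 : ∀ p ∈ S, HasDerivAt (fun s => φ (s, p.2)) (a p) p.1)
    (h2 : ∀ p ∈ S, HasDerivAt (fun s => φ (p.1, s)) (b p) p.2) :
    ContDiffOn ℝ (n + 1) φ S := by
  have key : ∀ p ∈ S, HasFDerivAt φ (a p • ContinuousLinearMap.fst ℝ ℝ ℝ
      + b p • ContinuousLinearMap.snd ℝ ℝ ℝ) p := by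
    intro p hp
    have hn := hS.mem_nhds hp
    have h := hasStrictFDerivAt_uncurry_coprod (𝕜 := ℝ) (u := p) (f := fun s y => φ (s, y))
      (f₁ := fun s y => ContinuousLinearMap.toSpanSingleton ℝ (a (s, y)))
      (f₂ := fun s y => ContinuousLinearMap.toSpanSingleton ℝ (b (s, y)))
      (eventually_of_mem hn fun q hq => (h1 q hq).hasFDerivAt)
      (eventually_of_mem hn fun q hq => (h2 q hq).hasFDerivAt)
      ((ContinuousLinearMap.toSpanSingletonCLE (𝕜 := ℝ) (E := ℝ)).continuous.continuousAt.comp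
        (f := a) (ha.continuousOn.continuousAt hn))
      ((ContinuousLinearMap.toSpanSingletonCLE (𝕜 := ℝ) (E := ℝ)).continuous.continuousAt.comp
        (f := b) (hb.continuousOn.continuousAt hn))
    refine h.hasFDerivAt.congr_fderiv ?_
    ext <;> simp [Function.HasUncurry.uncurry]
  rw [contDiffOn_succ_iff_fderiv_of_isOpen hS]
  refine ⟨fun p hp => (key p hp).differentiableAt.differentiableWithinAt, by simp, ?_⟩
  refine ContDiffOn.congr ?_ fun p hp => (key p hp).fderiv
  exact (ha.smul contDiffOn_const).add (hb.smul contDiffOn_const)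

/-- The mean of `∂_x q` over the segment from `q.2.1` to `q.2.2` at time `q.1`. -/
noncomputable def meanSlope (q : ℝ × ℝ → ℝ) (z : ℝ × ℝ × ℝ) : ℝ :=
  ∫ θ in (0 : ℝ)..1, dx q (z.1, z.2.1 + θ * (z.2.2 - z.2.1))

theorem contDiff_meanSlope {q : ℝ × ℝ → ℝ} (hq : ContDiff ℝ ∞ q) : ContDiff ℝ ∞ (meanSlope q) := by
  rw [contDiff_iff_contDiffAt]
  intro z
  refine contDiffAt_integral_unitInterval (n := ⊤) isOpen_univ
    (F := fun r : (ℝ × ℝ × ℝ) × ℝ => dx q (r.1.1, r.1.2.1 + r.2 * (r.1.2.2 - r.1.2.1)))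
    (ContDiff.contDiffOn ?_) (fun _ _ => mem_univ _)
  exact hq.dx.comp (by fun_prop)

/-- Hadamard's factorization. It makes the difference of two trajectories solve a linear equation
exactly, not merely to first order. -/
theorem sub_eq_mul_meanSlope {q : ℝ × ℝ → ℝ} (hq : ContDiff ℝ ∞ q) (t a b : ℝ) :
    q (t, b) - q (t, a) = (b - a) * meanSlope q (t, a, b) := by
  have hd : ∀ s, HasDerivAt (fun y => q (t, y)) (dx q (t, s)) s := fun s =>
    hasDerivAt_dx (p := (t, s)) (hq.differentiable (by simp) _)
  have hc : Continuous fun s => dx q (t, s) := hq.dx.continuous.comp (by fun_prop)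
  rw [← intervalIntegral.integral_eq_sub_of_hasDerivAt (fun s _ => hd s)
    (hc.intervalIntegrable a b), integral_eq_mul_integral_unitInterval]
  rfl

theorem meanSlope_self (q : ℝ × ℝ → ℝ) (t a : ℝ) : meanSlope q (t, a, a) = dx q (t, a) := by
  simp [meanSlope]

/-- A solution of `δ' = ρ δ` is an exponential. -/
theorem eq_mul_exp_integral {δ ρ : ℝ → ℝ} {a b : ℝ} (h0 : (0 : ℝ) ∈ Ioo a b)
    (hρ : ContinuousOn ρ (Ioo a b)) (hδ : ∀ t ∈ Ioo a b, HasDerivAt δ (ρ t * δ t) t) {t : ℝ}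
    (ht : t ∈ Ioo a b) : δ t = δ 0 * Real.exp (∫ s in (0 : ℝ)..t, ρ s) := by
  have hI : ∀ t ∈ Ioo a b, HasDerivAt (fun t => ∫ s in (0 : ℝ)..t, ρ s) (ρ t) t := fun t ht => by
    have hsub : uIcc 0 t ⊆ Ioo a b := ordConnected_Ioo.uIcc_subset h0 ht
    exact intervalIntegral.integral_hasDerivAt_right (hρ.mono hsub).intervalIntegrable
      (hρ.stronglyMeasurableAtFilter isOpen_Ioo t ht) (hρ.continuousAt (isOpen_Ioo.mem_nhds ht))
  have hd : ∀ t ∈ Ioo a b,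
      HasDerivAt (fun t => δ t * Real.exp (-∫ s in (0 : ℝ)..t, ρ s)) 0 t := fun t ht => by
    refine ((hδ t ht).mul (hI t ht).neg.exp).congr_deriv ?_
    ring
  have hconst := (convex_Ioo a b).is_const_of_fderivWithin_eq_zero (𝕜 := ℝ)
    (fun t ht => (hd t ht).differentiableAt.differentiableWithinAt) (fun t ht => by
      rw [fderivWithin_of_isOpen isOpen_Ioo ht]
      ext
      simp [(hd t ht).deriv]) h0 ht
  simp only [intervalIntegral.integral_same, neg_zero, Real.exp_zero, mul_one] at hconst
  rw [hconst, mul_assoc, ← Real.exp_add, neg_add_cancel, Real.exp_zero, mul_one]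

/-- The flow of a compactly supported smooth scalar vector field `∂_t + q ∂_x`, started at `t = 0`,
is smooth, and its derivative in the initial value is positive. -/
theorem exists_smooth_flow {q : ℝ × ℝ → ℝ} (hq : ContDiff ℝ ∞ q) (hc : HasCompactSupport q) :
    ∃ φ E : ℝ × ℝ → ℝ, ContDiffOn ℝ ∞ φ (Ioo (-1) 1 ×ˢ Ioo (-1) 1) ∧
      (∀ y ∈ Ioo (-1 : ℝ) 1, φ (0, y) = y) ∧
      (∀ p ∈ Ioo (-1 : ℝ) 1 ×ˢ Ioo (-1 : ℝ) 1,
        HasDerivAt (fun s => φ (s, p.2)) (q (p.1, φ p)) p.1) ∧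
      ∀ p ∈ Ioo (-1 : ℝ) 1 ×ˢ Ioo (-1 : ℝ) 1, 0 < E p ∧
        HasDerivAt (fun s => φ (p.1, s)) (E p) p.2 := by
  obtain ⟨K, hK⟩ := hq.lipschitzWith_of_hasCompactSupport hc (by simp)
  obtain ⟨L, hL⟩ := hc.exists_bound_of_continuous hq.continuous
  -- The global bound `L` and Lipschitz constant `K` allow the whole interval `[-1, 1]`. The radius
  -- `L + 1` is the initial radius `1` plus the distance covered in unit time.
  have hPL : IsPicardLindelof (fun t x => q (t, x)) (tmin := -1) (tmax := 1)
      (⟨0, by norm_num⟩ : Icc (-1 : ℝ) 1) (0 : ℝ) (L.toNNReal + 1) 1 L.toNNReal K := by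
    refine ⟨fun t _ => ?_, fun x _ => ?_, fun t _ x _ => ?_, ?_⟩
    · refine (LipschitzWith.of_dist_le_mul fun x y => ?_).lipschitzOnWith
      refine (hK.dist_le_mul _ _).trans_eq ?_
      rw [Prod.dist_eq, dist_self, max_eq_right dist_nonneg]
    · exact (hq.continuous.comp (by fun_prop)).continuousOn
    · exact (hL _).trans (Real.le_coe_toNNReal L)
    · simp
  obtain ⟨α, hα, hαc⟩ := hPL.exists_forall_mem_closedBall_eq_hasDerivWithinAt_continuousOn
  set S : Set (ℝ × ℝ) := Ioo (-1 : ℝ) 1 ×ˢ Ioo (-1 : ℝ) 1 with hSdef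
  have hS : IsOpen S := isOpen_Ioo.prod isOpen_Ioo
  have h01 : (0 : ℝ) ∈ Ioo (-1 : ℝ) 1 := by norm_num
  have hball : ∀ {y : ℝ}, y ∈ Ioo (-1 : ℝ) 1 → y ∈ Metric.closedBall (0 : ℝ) ((1 : NNReal) : ℝ) :=
    fun {y} hy => by
    rw [Real.closedBall_eq_Icc]
    simp only [NNReal.coe_one, zero_sub, zero_add]
    exact Ioo_subset_Icc_self hy
  set φ : ℝ × ℝ → ℝ := fun p => α (p.2, p.1) with hφdef
  have hφ0 : ∀ y ∈ Ioo (-1 : ℝ) 1, φ (0, y) = y := fun y hy => (hα y (hball hy)).1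
  have hφt : ∀ p ∈ S, HasDerivAt (fun s => φ (s, p.2)) (q (p.1, φ p)) p.1 := fun p hp =>
    ((hα p.2 (hball hp.2)).2 p.1 (Ioo_subset_Icc_self hp.1)).hasDerivAt
      (Icc_mem_nhds hp.1.1 hp.1.2)
  have hφc : ContinuousOn φ S := by
    refine hαc.comp (f := fun p : ℝ × ℝ => (p.2, p.1)) (by fun_prop) fun p hp => ?_
    exact ⟨hball hp.2, Ioo_subset_Icc_self hp.1⟩
  -- The solution of the variational equation, in closed form because the state is scalar.
  set E : ℝ × ℝ → ℝ := fun p => Real.exp (∫ s in (0 : ℝ)..p.1, dx q (s, φ (s, p.2))) with hEdef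
  have hφy : ∀ p ∈ S, HasDerivAt (fun s => φ (p.1, s)) (E p) p.2 := by
    rintro ⟨t, y₀⟩ ⟨ht, hy₀⟩
    have hρ : ContinuousOn (fun z : ℝ × ℝ => meanSlope q (z.2, φ (z.2, y₀), φ (z.2, z.1))) S := by
      refine (contDiff_meanSlope hq).continuous.comp_continuousOn
        (continuous_snd.continuousOn.prodMk (ContinuousOn.prodMk ?_ ?_))
      · exact hφc.comp (f := fun z : ℝ × ℝ => (z.2, y₀)) (by fun_prop) fun z hz => ⟨hz.2, hy₀⟩
      · exact hφc.comp (f := fun z : ℝ × ℝ => (z.2, z.1)) (by fun_prop) fun z hz => ⟨hz.2, hz.1⟩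
    -- The difference quotient of the flow is an exponential of an integral that is continuous in
    -- `y`; its limit at `y₀` is `E`.
    have hquot : ∀ y ∈ Ioo (-1 : ℝ) 1, φ (t, y) - φ (t, y₀) = (y - y₀) *
        Real.exp (∫ s in (0 : ℝ)..t, meanSlope q (s, φ (s, y₀), φ (s, y))) := by
      intro y hy
      have := eq_mul_exp_integral (δ := fun s => φ (s, y) - φ (s, y₀))
        (ρ := fun s => meanSlope q (s, φ (s, y₀), φ (s, y))) h01
        (hρ.comp (f := fun s : ℝ => (y, s)) (by fun_prop) fun s hs => ⟨hy, hs⟩)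
        (fun s hs => by
          refine ((hφt (s, y) ⟨hs, hy⟩).sub (hφt (s, y₀) ⟨hs, hy₀⟩)).congr_deriv ?_
          rw [sub_eq_mul_meanSlope hq, mul_comm]) ht
      rw [hφ0 y hy, hφ0 y₀ hy₀] at this
      exact this
    have hcont : ContinuousAt (fun y => Real.exp (∫ s in (0 : ℝ)..t,
        meanSlope q (s, φ (s, y₀), φ (s, y)))) y₀ := by
      have h0 := contDiffAt_primitive (n := 0) hS (contDiffOn_zero.2 hρ)
        (p₀ := y₀) (a := 0) (t := t) (fun θ hθ => ⟨hy₀, ordConnected_Ioo.uIcc_subset h01 ht hθ⟩)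
      have h1 : ContinuousAt (fun y : ℝ => ∫ s in (0 : ℝ)..t,
          meanSlope q (s, φ (s, y₀), φ (s, y))) y₀ :=
        ContinuousAt.comp (f := fun y : ℝ => (y, t)) h0.continuousAt (by fun_prop)
      exact Real.continuous_exp.continuousAt.comp h1
    have hE : E (t, y₀) = Real.exp (∫ s in (0 : ℝ)..t,
        meanSlope q (s, φ (s, y₀), φ (s, y₀))) := by
      simp only [hEdef, meanSlope_self]
    rw [hE, hasDerivAt_iff_tendsto_slope]
    refine (hcont.tendsto.mono_left nhdsWithin_le_nhds).congr' ?_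
    filter_upwards [self_mem_nhdsWithin, nhdsWithin_le_nhds (isOpen_Ioo.mem_nhds hy₀)] with y hne hy
    rw [slope_def_field, hquot y hy]
    have : y - y₀ ≠ 0 := sub_ne_zero.2 hne
    field_simp
  -- Bootstrap: the two partial derivatives of `φ` are built from `φ` itself, so they are `C^n` when
  -- `φ` is.
  have hsmooth : ∀ n : ℕ, ContDiffOn ℝ n φ S := by
    intro n
    induction n with
    | zero => exact contDiffOn_zero.2 hφc
    | succ n ih =>
      have hqn : ContDiff ℝ n q := hq.of_le (by exact_mod_cast le_top)
      have hqxn : ContDiff ℝ n (dx q) := hq.dx.of_le (by exact_mod_cast le_top)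
      have ha : ContDiffOn ℝ n (fun p => q (p.1, φ p)) S :=
        hqn.comp_contDiffOn (contDiffOn_fst.prodMk ih)
      have hF : ContDiffOn ℝ n (fun z : ℝ × ℝ => dx q (z.2, φ (z.2, z.1))) S :=
        hqxn.comp_contDiffOn (contDiffOn_snd.prodMk
          (ih.comp (f := fun z : ℝ × ℝ => (z.2, z.1)) (by fun_prop) fun z hz => ⟨hz.2, hz.1⟩))
      have hE : ContDiffOn ℝ n E S := by
        rintro ⟨t, y⟩ ⟨ht, hy⟩
        have h0 := contDiffAt_primitive (n := n) hS hF (p₀ := y) (a := 0) (t := t)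
          (fun θ hθ => ⟨hy, ordConnected_Ioo.uIcc_subset h01 ht hθ⟩)
        have h1 : ContDiffAt ℝ n
            (fun z : ℝ × ℝ => ∫ s in (0 : ℝ)..z.1, dx q (s, φ (s, z.2))) (t, y) :=
          ContDiffAt.comp (f := fun z : ℝ × ℝ => (z.2, z.1)) (t, y) h0 (by fun_prop)
        exact h1.exp.contDiffWithinAt
      exact_mod_cast contDiffOn_succ_of_partial hS ha hE hφt hφy
  exact ⟨φ, E, contDiffOn_infty.2 hsmooth, hφ0, hφt,
    fun p hp => ⟨Real.exp_pos _, hφy p hp⟩⟩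

end Flow

/-! ### Straightening a vector field `∂_t + q ∂_x` -/

/-- The linear automorphism `(a, b) ↦ (a, a d + b e)` of the plane. -/
noncomputable def shearEquiv (d e : ℝ) (he : e ≠ 0) : (ℝ × ℝ) ≃L[ℝ] ℝ × ℝ :=
  LinearEquiv.toContinuousLinearEquiv
    { toFun := fun z => (z.1, z.1 * d + z.2 * e)
      map_add' := fun z w => by ext <;> simp; ring
      map_smul' := fun k z => by ext <;> simp; ring
      invFun := fun z => (z.1, (z.2 - z.1 * d) / e)
      left_inv := fun z => by ext <;> simp [he]
      right_inv := fun z => by ext <;> simp [he] }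

theorem shearEquiv_apply (d e : ℝ) (he : e ≠ 0) (z : ℝ × ℝ) :
    shearEquiv d e he z = (z.1, z.1 * d + z.2 * e) := rfl

/-- `V` is straightened by the flow `ψ` of `∂_t + q ∂_x` started at time `t₀`, and `b₀` is the
label of the trajectory through a point. -/
structure FlowBox (q : ℝ × ℝ → ℝ) (V : Set (ℝ × ℝ)) (I J : Set ℝ) (t₀ : ℝ) (ψ b₀ : ℝ × ℝ → ℝ) :
    Prop where
  isOpen : IsOpen V
  isOpen_time : IsOpen I
  isOpen_label : IsOpen J
  ordConnected : I.OrdConnected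
  start_mem : t₀ ∈ I
  smooth_flow : ContDiffOn ℝ ∞ ψ (I ×ˢ J)
  smooth_label : ContDiffOn ℝ ∞ b₀ V
  time_mem : ∀ p ∈ V, p.1 ∈ I
  label_mem : ∀ p ∈ V, b₀ p ∈ J
  flow_label : ∀ p ∈ V, ψ (p.1, b₀ p) = p.2
  flow_mem : ∀ s ∈ I, ∀ y ∈ J, (s, ψ (s, y)) ∈ V
  label_flow : ∀ s ∈ I, ∀ y ∈ J, b₀ (s, ψ (s, y)) = y
  flow_start : ∀ y ∈ J, ψ (t₀, y) = y
  hasDerivAt_flow : ∀ s ∈ I, ∀ y ∈ J, HasDerivAt (fun r => ψ (r, y)) (q (s, ψ (s, y))) s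

/-- Cut `q` off near `p₀`, translate `p₀` to the origin and use the flow of the cut-off field. On
the points whose image stays where the cutoff is `1`, this is the flow of `q`. -/
theorem exists_local_flow {q : ℝ × ℝ → ℝ} {U : Set (ℝ × ℝ)} (hU : IsOpen U)
    (hq : ContDiffOn ℝ ∞ q U) {p₀ : ℝ × ℝ} (hp : p₀ ∈ U) :
    ∃ (S : Set (ℝ × ℝ)) (ψ E : ℝ × ℝ → ℝ), IsOpen S ∧ p₀ ∈ S ∧ ContDiffOn ℝ ∞ ψ S ∧
      (∀ y, (p₀.1, y) ∈ S → ψ (p₀.1, y) = y) ∧ (∀ z ∈ S, (z.1, ψ z) ∈ U) ∧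
      (∀ z ∈ S, HasDerivAt (fun s => ψ (s, z.2)) (q (z.1, ψ z)) z.1) ∧
      ∀ z ∈ S, 0 < E z ∧ HasDerivAt (fun y => ψ (z.1, y)) (E z) z.2 := by
  obtain ⟨ε, hε, hεU⟩ := Metric.isOpen_iff.1 hU p₀ hp
  -- Equal to `1` on the ball of radius `ε/4`, with support in the closed ball of radius `ε/2`,
  -- which lies in `U`.
  set χ : ContDiffBump p₀ := ⟨ε / 4, ε / 2, by positivity, by linarith⟩ with hχ
  have hχt : tsupport χ ⊆ U := by
    rw [χ.tsupport_eq]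
    exact (Metric.closedBall_subset_ball (half_lt_self hε)).trans hεU
  have hglob : ContDiff ℝ ∞ (fun z => χ z * q z) := by
    rw [contDiff_iff_contDiffAt]
    intro z
    by_cases hz : z ∈ tsupport χ
    · exact χ.contDiff.contDiffAt.mul (hq.contDiffAt (hU.mem_nhds (hχt hz)))
    · refine (contDiffAt_const (c := 0)).congr_of_eventuallyEq ?_
      filter_upwards [(isClosed_tsupport χ).isOpen_compl.mem_nhds hz] with w hw
      simp [image_eq_zero_of_notMem_tsupport hw]
  obtain ⟨φ, E, hφ, hφ0, hφt, hφE⟩ := exists_smooth_flow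
    (q := fun z => χ (p₀ + z) * q (p₀ + z)) (hglob.comp (contDiff_const.add contDiff_id))
    (χ.hasCompactSupport.mul_right.comp_homeomorph (Homeomorph.addLeft p₀))
  set R : Set (ℝ × ℝ) := (fun z => z - p₀) ⁻¹' (Ioo (-1 : ℝ) 1 ×ˢ Ioo (-1 : ℝ) 1) with hR
  have hRo : IsOpen R := (isOpen_Ioo.prod isOpen_Ioo).preimage (by fun_prop)
  set ψ : ℝ × ℝ → ℝ := fun z => p₀.2 + φ (z - p₀) with hψ
  have hψs : ContDiffOn ℝ ∞ ψ R :=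
    contDiffOn_const.add (hφ.comp (by fun_prop) fun z hz => hz)
  have hψ0 : ∀ y, (p₀.1, y) ∈ R → ψ (p₀.1, y) = y := fun y hy => by
    have h := hφ0 (y - p₀.2) hy.2
    simp only [hψ]
    rw [show ((p₀.1, y) - p₀ : ℝ × ℝ) = (0, y - p₀.2) by ext <;> simp, h]
    ring
  have hpR : p₀ ∈ R := by simp [hR]
  have hΦ : ContinuousOn (fun z => (z.1, ψ z)) R := by
    have := hψs.continuousOn
    fun_prop
  have hball : IsOpen (Metric.ball p₀ (ε / 4)) := Metric.isOpen_ball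
  refine ⟨R ∩ (fun z => (z.1, ψ z)) ⁻¹' Metric.ball p₀ (ε / 4), ψ, fun z => E (z - p₀),
    hΦ.isOpen_inter_preimage hRo hball, ⟨hpR, ?_⟩, hψs.mono inter_subset_left,
    fun y hy => hψ0 y hy.1, fun z hz => hεU (Metric.ball_subset_ball (by linarith) hz.2),
    fun z hz => ?_, fun z hz => ⟨(hφE _ hz.1).1, ?_⟩⟩
  · rw [mem_preimage, show (p₀.1, ψ p₀) = p₀ by ext1 <;> simp [hψ0 p₀.2 hpR]]
    exact Metric.mem_ball_self (by positivity)
  · have h := (hφt _ hz.1).comp_sub_const z.1 p₀.1 |>.const_add p₀.2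
    have h1 : χ (z.1, ψ z) = 1 := χ.one_of_mem_closedBall (Metric.ball_subset_closedBall hz.2)
    have h2 : p₀ + ((z - p₀).1, φ (z - p₀)) = (z.1, ψ z) := by ext <;> simp [hψ]
    rw [h2, h1, one_mul] at h
    exact h
  · exact (hφE _ hz.1).2.comp_sub_const z.2 p₀.2 |>.const_add p₀.2

/-- The derivative of `(s, y) ↦ (s, ψ (s, y))` is a shear with diagonal entries `1` and `E > 0`, so
the inverse function theorem applies; `b₀` is the second component of the inverse. -/
theorem exists_flowBox {q : ℝ × ℝ → ℝ} {U : Set (ℝ × ℝ)} (hU : IsOpen U)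
    (hq : ContDiffOn ℝ ∞ q U) {p₀ : ℝ × ℝ} (hp : p₀ ∈ U) :
    ∃ V I J ψ b₀, p₀ ∈ V ∧ V ⊆ U ∧ FlowBox q V I J p₀.1 ψ b₀ := by
  obtain ⟨S, ψ, E, hS, hpS, hψ, hψ0, hψU, hψt, hE⟩ := exists_local_flow hU hq hp
  set Φ : ℝ × ℝ → ℝ × ℝ := fun z => (z.1, ψ z) with hΦ
  have hΦs : ∀ z ∈ S, ContDiffAt ℝ ∞ Φ z := fun z hz =>
    contDiffAt_fst.prodMk (hψ.contDiffAt (hS.mem_nhds hz))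
  have hΦd : ∀ z (hz : z ∈ S), HasFDerivAt Φ
      (shearEquiv (dt ψ z) (E z) (hE z hz).1.ne' : (ℝ × ℝ) →L[ℝ] ℝ × ℝ) z := fun z hz => by
    have h := hψ.smoothAt hS hz
    refine (hasFDerivAt_fst.prodMk h.hasFDerivAt).congr_fderiv ?_
    ext
    · simp [shearEquiv_apply]
    · simp [shearEquiv_apply, dt_eq_fderiv h]
    · simp [shearEquiv_apply]
    · have : dx ψ z = E z := (hE z hz).2.deriv
      simp [shearEquiv_apply, ← this, dx_eq_fderiv h]
  have hΦp : Φ p₀ = p₀ := by ext1 <;> simp [hΦ, hψ0 p₀.2 hpS]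
  set e := (hΦs p₀ hpS).toOpenPartialHomeomorph Φ (hΦd p₀ hpS) (by simp) with he
  have hec : ⇑e = Φ := (hΦs p₀ hpS).toOpenPartialHomeomorph_coe (hΦd p₀ hpS) (by simp)
  have hpe : p₀ ∈ e.source :=
    (hΦs p₀ hpS).mem_toOpenPartialHomeomorph_source (hΦd p₀ hpS) (by simp)
  -- Balls of the sup norm are rectangles, so times and labels range over intervals independently.
  obtain ⟨r, hr, hrS⟩ := Metric.isOpen_iff.1 (hS.inter e.open_source) p₀ ⟨hpS, hpe⟩
  have hrect : ∀ {s y}, s ∈ Metric.ball p₀.1 r → y ∈ Metric.ball p₀.2 r → (s, y) ∈ S ∩ e.source :=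
    fun hs hy => hrS (by rw [← ball_prod_same]; exact ⟨hs, hy⟩)
  have himg : ∀ p ∈ e '' Metric.ball p₀ r,
      p ∈ e.target ∧ e.symm p ∈ Metric.ball p₀ r ∧ p.1 = (e.symm p).1 ∧ ψ (e.symm p) = p.2 := by
    rintro _ ⟨z, hz, rfl⟩
    rw [e.left_inv (hrS hz).2, hec]
    exact ⟨hec ▸ e.map_source (hrS hz).2, hz, rfl, rfl⟩
  refine ⟨e '' Metric.ball p₀ r, Metric.ball p₀.1 r, Metric.ball p₀.2 r, ψ, fun p => (e.symm p).2,
    ⟨p₀, Metric.mem_ball_self hr, hec ▸ hΦp⟩, ?_, ?_⟩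
  · rintro _ ⟨z, hz, rfl⟩
    exact hec ▸ hψU z (hrS hz).1
  · refine ⟨e.isOpen_image_of_subset_source Metric.isOpen_ball fun z hz => (hrS hz).2,
      Metric.isOpen_ball, Metric.isOpen_ball, ?_, Metric.mem_ball_self hr, ?_, ?_, ?_, ?_, ?_, ?_,
      ?_, ?_, ?_⟩
    · rw [Real.ball_eq_Ioo]
      exact ordConnected_Ioo
    · exact hψ.mono fun z hz => (hrect hz.1 hz.2).1
    · intro p hp
      obtain ⟨h1, h2, -, -⟩ := himg p hp
      have h3 := hΦd _ (hrS h2).1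
      have h4 := hΦs _ (hrS h2).1
      rw [← hec] at h3 h4
      exact (contDiffAt_snd.comp p (e.contDiffAt_symm h1 h3 h4)).contDiffWithinAt
    · intro p hp
      obtain ⟨-, h2, h3, -⟩ := himg p hp
      rw [← ball_prod_same] at h2
      exact h3 ▸ h2.1
    · intro p hp
      have h2 := (himg p hp).2.1
      rw [← ball_prod_same] at h2
      exact h2.2
    · intro p hp
      obtain ⟨-, -, h3, h4⟩ := himg p hp
      rw [h3]
      exact h4
    · intro s hs y hy
      exact ⟨(s, y), by rw [← ball_prod_same]; exact ⟨hs, hy⟩, by rw [hec]⟩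
    · intro s hs y hy
      have := e.left_inv (hrect hs hy).2
      rw [hec] at this
      exact congrArg Prod.snd this
    · exact fun y hy => hψ0 y (hrect (Metric.mem_ball_self hr) hy).1
    · exact fun s hs y hy => hψt (s, y) (hrect hs hy).1

/-- The flow box of a constant speed. -/
theorem flowBox_const (m t₀ : ℝ) {I J : Set ℝ} (hI : IsOpen I) (hJ : IsOpen J)
    (hc : I.OrdConnected) (ht : t₀ ∈ I) :
    FlowBox (fun _ => m) {p | p.1 ∈ I ∧ p.2 - m * (p.1 - t₀) ∈ J} I J t₀
      (fun z => z.2 + m * (z.1 - t₀)) (fun p => p.2 - m * (p.1 - t₀)) where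
  isOpen := (hI.preimage continuous_fst).inter
    (hJ.preimage (f := fun p : ℝ × ℝ => p.2 - m * (p.1 - t₀)) (by fun_prop))
  isOpen_time := hI
  isOpen_label := hJ
  ordConnected := hc
  start_mem := ht
  smooth_flow := by fun_prop
  smooth_label := by fun_prop
  time_mem := fun p hp => hp.1
  label_mem := fun p hp => hp.2
  flow_label := fun p _ => by simp
  flow_mem := fun s hs y hy => ⟨hs, by simpa using hy⟩
  label_flow := fun s _ y _ => by simp
  flow_start := fun y _ => by simp
  hasDerivAt_flow := fun s _ y _ => by
    simpa using (((hasDerivAt_id s).sub_const t₀).const_mul m).const_add y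

namespace FlowBox

variable {q : ℝ × ℝ → ℝ} {V : Set (ℝ × ℝ)} {I J : Set ℝ} {t₀ : ℝ} {ψ b₀ w : ℝ × ℝ → ℝ}

theorem eq_flow (h : FlowBox q V I J t₀ ψ b₀) {p : ℝ × ℝ} (hp : p ∈ V) :
    (p.1, ψ (p.1, b₀ p)) = p := by ext1 <;> simp [h.flow_label p hp]

theorem hasDerivAt_comp (h : FlowBox q V I J t₀ ψ b₀) {s y : ℝ} (hs : s ∈ I) (hy : y ∈ J)
    (hw : DifferentiableAt ℝ w (s, ψ (s, y))) :
    HasDerivAt (fun r => w (r, ψ (r, y)))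
      (dt w (s, ψ (s, y)) + q (s, ψ (s, y)) * dx w (s, ψ (s, y))) s := by
  have := hw.hasFDerivAt.comp_hasDerivAt s ((hasDerivAt_id s).prodMk (h.hasDerivAt_flow s hs y hy))
  rwa [fderiv_apply_eq hw, one_mul] at this

/-- The chain rule along the trajectory through `p` reduces equations for `∂_t + q ∂_x` to ordinary
differential equations in time. -/
theorem dt_add_mul_dx_eq (h : FlowBox q V I J t₀ ψ b₀) {p : ℝ × ℝ} (hp : p ∈ V)
    (hw : DifferentiableAt ℝ w p) {d : ℝ}
    (hd : HasDerivAt (fun r => w (r, ψ (r, b₀ p))) d p.1) : dt w p + q p * dx w p = d := by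
  have := h.hasDerivAt_comp (w := w) (h.time_mem p hp) (h.label_mem p hp) (by rwa [h.eq_flow hp])
  rw [h.eq_flow hp] at this
  exact this.unique hd

theorem eventually_label_flow (h : FlowBox q V I J t₀ ψ b₀) {s y : ℝ} (hs : s ∈ I) (hy : y ∈ J) :
    ∀ᶠ r in 𝓝 s, b₀ (r, ψ (r, y)) = y :=
  mem_of_superset (h.isOpen_time.mem_nhds hs) fun r hr => h.label_flow r hr y hy

theorem dt_label_add (h : FlowBox q V I J t₀ ψ b₀) {p : ℝ × ℝ} (hp : p ∈ V) :
    dt b₀ p + q p * dx b₀ p = 0 :=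
  h.dt_add_mul_dx_eq hp (h.smooth_label.smoothAt h.isOpen hp)
    ((hasDerivAt_const p.1 (b₀ p)).congr_of_eventuallyEq
      (h.eventually_label_flow (h.time_mem p hp) (h.label_mem p hp)))

/-- A function that is constant along the flow is determined by its values at the start. -/
theorem eq_start_of_hasDerivAt_zero (h : FlowBox q V I J t₀ ψ b₀) {v : ℝ → ℝ}
    (hv : ∀ s ∈ I, HasDerivAt v 0 s) {s : ℝ} (hs : s ∈ I) : v s = v t₀ :=
  h.ordConnected.convex.is_const_of_fderivWithin_eq_zero (𝕜 := ℝ)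
    (fun r hr => (hv r hr).differentiableAt.differentiableWithinAt)
    (fun r hr => by
      rw [fderivWithin_of_isOpen h.isOpen_time hr]
      ext
      simpa using (hv r hr).deriv) hs h.start_mem

/-- The transport equation along the flow is solvable. -/
theorem exists_transport (h : FlowBox q V I J t₀ ψ b₀) {r : ℝ × ℝ → ℝ} (hr : ContDiffOn ℝ ∞ r V) :
    ∃ w, ContDiffOn ℝ ∞ w V ∧ ∀ p ∈ V, dt w p + q p * dx w p = r p := by
  -- The right-hand side in the coordinates (label, time); integrating it in time from `t₀` gives
  -- the solution.
  set F : ℝ × ℝ → ℝ := fun z => r (z.2, ψ (z.2, z.1)) with hF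
  have hFs : ContDiffOn ℝ ∞ F (J ×ˢ I) :=
    hr.comp (contDiffOn_snd.prodMk (h.smooth_flow.comp (by fun_prop) fun z hz => ⟨hz.2, hz.1⟩))
      fun z hz => h.flow_mem _ hz.2 _ hz.1
  have hJI : IsOpen (J ×ˢ I) := h.isOpen_label.prod h.isOpen_time
  have hsub : ∀ {s}, s ∈ I → uIcc t₀ s ⊆ I := fun hs => h.ordConnected.uIcc_subset h.start_mem hs
  set w : ℝ × ℝ → ℝ := fun p => ∫ s in t₀..p.1, F (b₀ p, s) with hw
  have hws : ContDiffOn ℝ ∞ w V := fun p hp => by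
    have h1 := contDiffAt_primitive hJI hFs (p₀ := b₀ p) (a := t₀) (t := p.1)
      fun θ hθ => ⟨h.label_mem p hp, hsub (h.time_mem p hp) hθ⟩
    exact (h1.comp (f := fun p => (b₀ p, p.1)) p
      ((h.smooth_label.contDiffAt (h.isOpen.mem_nhds hp)).prodMk contDiffAt_fst)).contDiffWithinAt
  refine ⟨w, hws, fun p hp => h.dt_add_mul_dx_eq hp (hws.smoothAt h.isOpen hp) ?_⟩
  have hpI := h.time_mem p hp
  have hpJ := h.label_mem p hp
  have hcont : ContinuousOn (fun s => F (b₀ p, s)) I :=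
    hFs.continuousOn.comp (by fun_prop) fun s hs => ⟨hpJ, hs⟩
  have hd : HasDerivAt (fun s => ∫ θ in t₀..s, F (b₀ p, θ)) (F (b₀ p, p.1)) p.1 :=
    intervalIntegral.integral_hasDerivAt_right
      ((hcont.mono (hsub hpI)).intervalIntegrable)
      (hcont.stronglyMeasurableAtFilter h.isOpen_time p.1 hpI)
      (hcont.continuousAt (h.isOpen_time.mem_nhds hpI))
  simp only [hF, h.eq_flow hp] at hd
  refine hd.congr_of_eventuallyEq ?_
  filter_upwards [h.eventually_label_flow hpI hpJ] with s hs
  simp only [hw, hs, hF]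

end FlowBox

/-! ### The form of `g` along the flow of a multiplier -/

theorem fderiv_prod_apply {h : (ℝ × ℝ) × ℝ → ℝ} {p : ℝ × ℝ} {u : ℝ}
    (hd : DifferentiableAt ℝ h (p, u)) (a b d : ℝ) :
    fderiv ℝ h (p, u) ((a, b), d) = a * dt (fun q => h (q, u)) p + b * dx (fun q => h (q, u)) p
      + d * deriv (fun s => h (p, s)) u := by
  have h1 : HasFDerivAt (fun q => h (q, u)) _ p :=
    hd.hasFDerivAt.comp p (hasFDerivAt_prodMk_left p u)
  have h2 : HasDerivAt (fun s => h (p, s)) _ u :=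
    hd.hasFDerivAt.comp_hasDerivAt u ((hasDerivAt_const u p).prodMk (hasDerivAt_id u))
  rw [h2.deriv, ← fderiv_apply_eq h1.differentiableAt, h1.fderiv, ← smul_eq_mul, ← map_smul,
    ContinuousLinearMap.comp_apply, ← map_add]
  simp

namespace FlowBox

variable {c : ℝ} {q : ℝ × ℝ → ℝ} {V : Set (ℝ × ℝ)} {I J : Set ℝ} {t₀ : ℝ}
  {ψ b₀ Q1 Q2 Q0 G : ℝ × ℝ → ℝ}

/-- Divided by `2 Q₁`, the equation is a transport equation with zeroth-order coefficient `2 Q₂_x /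
Q₁`. Two applications of `exists_transport` solve it: one for the exponent `m` of the integrating
factor, one for `w = e^m k`. -/
theorem exists_linearTerm (hB : FlowBox q V I J t₀ ψ b₀) (hD : DampingEquations c V Q1 Q2 Q0 G)
    (hQ1 : ∀ p ∈ V, Q1 p ≠ 0) (hq : ∀ p ∈ V, Q2 p = q p * Q1 p) :
    ∃ k, ContDiffOn ℝ ∞ k V ∧ LinearTermEquation c V Q1 Q2 G k := by
  have hV := hB.isOpen
  have sx := hD.smooth2.dx hV
  have sG := hD.smoothG
  obtain ⟨m, hm, hmq⟩ := hB.exists_transport (r := fun p => 2 * dx Q2 p / Q1 p)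
    ((contDiffOn_const.mul sx).div hD.smooth1 hQ1)
  set R : ℝ × ℝ → ℝ := fun p => dx Q2 p * (G p ^ 2 + 2 * dt G p) + G p * dx G p * Q2 p
      + G p * dt G p * Q1 p - 2 * c ^ 2 * dx Q1 p * dx G p + Q1 p * box c G p with hR
  have hRs : ContDiffOn ℝ ∞ R V := by
    have s1 := hD.smooth1
    have s2 := hD.smooth2
    have s1x := s1.dx hV
    have sGt := sG.dt hV
    have sGx := sG.dx hV
    have sGb : ContDiffOn ℝ ∞ (box c G) V := sG.box hV
    fun_prop
  obtain ⟨w, hw, hwq⟩ := hB.exists_transport (r := fun p => Real.exp (m p) * (R p / (2 * Q1 p)))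
    (hm.exp.mul (hRs.div (contDiffOn_const.mul hD.smooth1) fun p hp => by simpa using hQ1 p hp))
  refine ⟨fun p => Real.exp (-m p) * w p, hm.neg.exp.mul hw, fun p hp => ?_⟩
  have dm := hm.smoothAt hV hp
  have dw := hw.smoothAt hV hp
  have e1 : dt (fun p => Real.exp (-m p) * w p) p =
      Real.exp (-m p) * (dt w p - dt m p * w p) := by
    refine (((hasDerivAt_dt dm).neg.exp).mul (hasDerivAt_dt dw)).deriv.trans ?_
    simp only [Prod.mk.eta, Pi.neg_apply]
    ring
  have e2 : dx (fun p => Real.exp (-m p) * w p) p =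
      Real.exp (-m p) * (dx w p - dx m p * w p) := by
    refine (((hasDerivAt_dx dm).neg.exp).mul (hasDerivAt_dx dw)).deriv.trans ?_
    simp only [Prod.mk.eta, Pi.neg_apply]
    ring
  have h1 := hQ1 p hp
  have hE : Real.exp (-m p) * Real.exp (m p) = 1 := by rw [← Real.exp_add]; simp
  have hm' : Q1 p * (dt m p + q p * dx m p) = 2 * dx Q2 p := by rw [hmq p hp]; field_simp
  have hw' : 2 * Q1 p * (dt w p + q p * dx w p) = Real.exp (m p) * R p := by
    rw [hwq p hp]; field_simp
  rw [e1, e2]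
  change _ = R p
  rw [hq p hp]
  linear_combination Real.exp (-m p) * hw' - 2 * Real.exp (-m p) * w p * hm' + R p * hE

/-- Method of characteristics. For fixed `z`, the expression `e^{-M} (h - k u)` at `u = z e^{-b/2}`
is constant along trajectories, so it is a function of the label and `z`. Its value at the starting
time is `f`, which therefore has the regularity of `h`. -/
theorem exists_canonical (hB : FlowBox q V I J t₀ ψ b₀) (hD : DampingEquations c V Q1 Q2 Q0 G)
    (hQ1 : ∀ p ∈ V, Q1 p ≠ 0) (hq : ∀ p ∈ V, Q2 p = q p * Q1 p) {b₀' b M k : ℝ × ℝ → ℝ}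
    (hF : FlowEquations V Q1 Q2 Q0 b₀' b M) (hk : ContDiffOn ℝ ∞ k V)
    (hlin : LinearTermEquation c V Q1 Q2 G k) {n : ℕ∞} (hn : 1 ≤ n) {h : (ℝ × ℝ) × ℝ → ℝ}
    (hh : ContDiffOn ℝ n h (V ×ˢ univ)) (hS : SourceEquation c V Q1 Q2 Q0 G h) :
    ∃ f, ContDiffOn ℝ n f (J ×ˢ univ) ∧ ∀ p ∈ V, ∀ u,
      h (p, u) = k p * u + Real.exp (M p) * f (b₀ p, u * Real.exp (b p / 2)) := by
  have hV := hB.isOpen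
  have sM := hF.smooth_M
  have sb := hF.smooth_b
  set D : ℝ → ℝ × ℝ → ℝ := fun z p => Real.exp (-M p) *
    (h (p, z * Real.exp (-b p / 2)) - k p * (z * Real.exp (-b p / 2))) with hDdef
  have hconst : ∀ z, ∀ y ∈ J, ∀ s ∈ I, HasDerivAt (fun r => D z (r, ψ (r, y))) 0 s := by
    intro z y hy s hs
    have hp := hB.flow_mem s hs y hy
    have dM := hB.hasDerivAt_comp hs hy (sM.smoothAt hV hp)
    have db := hB.hasDerivAt_comp hs hy (sb.smoothAt hV hp)
    have dk := hB.hasDerivAt_comp hs hy (hk.smoothAt hV hp)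
    have dU := ((db.neg.div_const 2).exp).const_mul z
    have hdiff : DifferentiableAt ℝ h
        ((s, ψ (s, y)), z * Real.exp (-b (s, ψ (s, y)) / 2)) :=
      (hh.contDiffAt ((hV.prod isOpen_univ).mem_nhds ⟨hp, mem_univ _⟩)).differentiableAt
        (by exact_mod_cast (zero_lt_one.trans_le hn).ne')
    have dh := hdiff.hasFDerivAt.comp_hasDerivAt s
      (((hasDerivAt_id s).prodMk (hB.hasDerivAt_flow s hs y hy)).prodMk dU)
    rw [fderiv_prod_apply hdiff] at dh
    have := (dM.neg.exp).mul (dh.sub (dk.mul dU))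
    refine this.congr_deriv ?_
    simp only [Function.comp_def, Pi.neg_apply, Pi.mul_apply, Pi.sub_apply, id]
    generalize (s, ψ (s, y)) = p at *
    have h1 := hQ1 p hp
    have h2 := hq p hp
    have h3 := hlin p hp
    have h4 := hS p hp (z * Real.exp (-b p / 2))
    have h5 := hD.two_mul_box_sub hV hp
    have h6 := hF.flow_b p hp
    have h7 := hF.flow_M p hp
    have h8 := hD.two_mul_Q0 p hp
    apply mul_left_cancel₀ h1
    obtain ⟨U, hU⟩ : ∃ U, z * Real.exp (-b p / 2) = U := ⟨_, rfl⟩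
    have hU' : ∀ X, z * (Real.exp (-b p / 2) * X) = U * X := fun X => by rw [← mul_assoc, hU]
    rw [hU] at h4
    simp only [hU, hU']
    rw [h2] at h3 h4 h5 h6 h7
    -- `h4` is the source equation; `h3` and `h5` remove its inhomogeneity through `k`, while `h6`
    -- and `h7` account for the rescaling of `u` and of the source.
    linear_combination Real.exp (-M p) * (-(h (p, U) - k p * U) * h7 + h4
      + (k p * U - U * deriv (fun s => h (p, s)) U) / 2 * h6 - U / 2 * h3 + U / 2 * h5
      + k p * U * h8)
  have ht : MapsTo (fun y => (t₀, y)) J V := fun y hy => by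
    have := hB.flow_mem t₀ hB.start_mem y hy
    rwa [hB.flow_start y hy] at this
  refine ⟨fun w => D w.2 (t₀, w.1), ?_, fun p hp u => ?_⟩
  · have ht' : ContDiffOn ℝ n (fun w : ℝ × ℝ => (t₀, w.1)) (J ×ˢ univ) := by fun_prop
    have hm : MapsTo (fun w : ℝ × ℝ => (t₀, w.1)) (J ×ˢ univ) V := fun w hw => ht hw.1
    have hle : (n : WithTop ℕ∞) ≤ ∞ := by exact_mod_cast le_top
    have cM := (sM.of_le hle).comp ht' hm
    have ck := (hk.of_le hle).comp ht' hm
    have cU : ContDiffOn ℝ n (fun w : ℝ × ℝ => w.2 * Real.exp (-b (t₀, w.1) / 2)) (J ×ˢ univ) :=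
      contDiffOn_snd.mul ((((sb.of_le hle).comp ht' hm).neg.div_const 2).exp)
    exact cM.neg.exp.mul ((hh.comp (ht'.prodMk cU) fun w hw => ⟨hm hw, mem_univ _⟩).sub
      (ck.mul cU))
  · have hy := hB.label_mem p hp
    have := hB.eq_start_of_hasDerivAt_zero (hconst (u * Real.exp (b p / 2)) _ hy)
      (hB.time_mem p hp)
    rw [hB.eq_flow hp, hB.flow_start _ hy] at this
    have hU : u * Real.exp (b p / 2) * Real.exp (-b p / 2) = u := by
      rw [mul_assoc, ← Real.exp_add]
      ring_nf
      simp
    have hE : Real.exp (M p) * Real.exp (-M p) = 1 := by rw [← Real.exp_add]; simp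
    change _ = _ + _ * D (u * Real.exp (b p / 2)) (t₀, b₀ p)
    rw [← this, hDdef]
    simp only [hU]
    linear_combination (k p * u - h (p, u)) * hE

end FlowBox

/-! ### The normal forms near a generic point -/

section NormalForms

/-- A closed pair of smooth functions is locally a gradient. -/
theorem exists_potential {A B : ℝ × ℝ → ℝ} {U : Set (ℝ × ℝ)} (hU : IsOpen U) (hc : Convex ℝ U)
    (hA : ContDiffOn ℝ ∞ A U) (hB : ContDiffOn ℝ ∞ B U) (hAB : ∀ p ∈ U, dx A p = dt B p) :
    ∃ a, ContDiffOn ℝ ∞ a U ∧ ∀ p ∈ U, dt a p = A p ∧ dx a p = B p := by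
  set L1 := ContinuousLinearMap.fst ℝ ℝ ℝ
  set L2 := ContinuousLinearMap.snd ℝ ℝ ℝ
  set η : ℝ × ℝ → (ℝ × ℝ) →L[ℝ] ℝ := fun p => A p • L1 + B p • L2 with hη
  have hηs : ContDiffOn ℝ ∞ η U := (hA.smul contDiffOn_const).add (hB.smul contDiffOn_const)
  obtain ⟨a, ha⟩ := hc.exists_forall_hasFDerivAt_of_fderiv_symmetric hU
    (hηs.differentiableOn (by simp)) (fun p hp v w => by
      have dA := hA.smoothAt hU hp
      have dB := hB.smoothAt hU hp
      have h : HasFDerivAt η _ p :=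
        (dA.hasFDerivAt.smul_const L1).add (dB.hasFDerivAt.smul_const L2)
      rw [h.fderiv]
      obtain ⟨v1, v2⟩ := v
      obtain ⟨w1, w2⟩ := w
      simp only [add_apply, ContinuousLinearMap.smulRight_apply,
        smul_apply, fderiv_apply_eq dA, fderiv_apply_eq dB, hAB p hp, L1, L2,
        ContinuousLinearMap.coe_fst', ContinuousLinearMap.coe_snd', smul_eq_mul]
      ring)
  refine ⟨a, ?_, fun p hp => ?_⟩
  · rw [contDiffOn_infty_iff_fderiv_of_isOpen hU]
    exact ⟨fun p hp => (ha p hp).differentiableAt.differentiableWithinAt,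
      hηs.congr fun p hp => (ha p hp).fderiv⟩
  · have hd := (ha p hp).differentiableAt
    rw [dt_eq_fderiv hd, dx_eq_fderiv hd, (ha p hp).fderiv]
    simp [hη, L1, L2]

/-- The slanted rectangle is the region straightened by the flow of constant speed `m`, in the form
required by `flowBox_const`. -/
theorem exists_slanted_subset (m : ℝ) {U : Set (ℝ × ℝ)} (hU : IsOpen U) {p₀ : ℝ × ℝ}
    (hp : p₀ ∈ U) : ∃ r > 0, {p : ℝ × ℝ | p.1 ∈ Metric.ball p₀.1 r ∧
      p.2 - m * (p.1 - p₀.1) ∈ Metric.ball p₀.2 r} ⊆ U := by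
  have hS : IsOpen ((fun z : ℝ × ℝ => (z.1, z.2 + m * (z.1 - p₀.1))) ⁻¹' U) :=
    hU.preimage (by fun_prop)
  obtain ⟨r, hr, hrS⟩ := Metric.isOpen_iff.1 hS p₀ (by simpa using hp)
  refine ⟨r, hr, fun p hp => ?_⟩
  have := hrS (a := (p.1, p.2 - m * (p.1 - p₀.1)))
    (by rw [← ball_prod_same]; exact hp)
  simpa using this

theorem ordConnected_ball (x r : ℝ) : (Metric.ball x r).OrdConnected := by
  rw [Real.ball_eq_Ioo]
  exact ordConnected_Ioo

theorem eq_of_dx_eq_zero {I J : Set ℝ} (hJ : IsOpen J) (hc : J.OrdConnected)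
    {w : ℝ × ℝ → ℝ} (hw : ∀ p ∈ I ×ˢ J, DifferentiableAt ℝ w p) (h0 : ∀ p ∈ I ×ˢ J, dx w p = 0)
    {t x y : ℝ} (ht : t ∈ I) (hx : x ∈ J) (hy : y ∈ J) : w (t, y) = w (t, x) :=
  hc.convex.is_const_of_fderivWithin_eq_zero (𝕜 := ℝ) (f := fun y => w (t, y))
    (fun z hz => (hasDerivAt_dx (hw (t, z) ⟨ht, hz⟩)).differentiableAt.differentiableWithinAt)
    (fun z hz => by
      rw [fderivWithin_of_isOpen hJ hz]
      ext
      simpa [dx] using h0 (t, z) ⟨ht, hz⟩) hy hx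

/-- Identifies the coefficient of `u_t` found in `g` with the one that the normal form prescribes.
-/
theorem DampingEquations.eqOn {c : ℝ} {V : Set (ℝ × ℝ)} {Q1 Q2 Q0 G G' : ℝ × ℝ → ℝ}
    (h : DampingEquations c V Q1 Q2 Q0 G) (h' : DampingEquations c V Q1 Q2 Q0 G') {p : ℝ × ℝ}
    (hp : p ∈ V) (hQ : Q1 p ≠ 0 ∨ Q2 p ≠ 0) : G p = G' p := by
  rcases hQ with hQ | hQ
  · exact mul_left_cancel₀ hQ ((h.Q1_mul p hp).trans (h'.Q1_mul p hp).symm)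
  · exact mul_left_cancel₀ hQ ((h.Q2_mul p hp).trans (h'.Q2_mul p hp).symm)

variable {c : ℝ} {U : Set (ℝ × ℝ)} {n : ℕ∞} {g : (ℝ × ℝ) × ℝ × ℝ → ℝ} {Q1 Q2 Q0 G : ℝ × ℝ → ℝ}
  {p₀ : ℝ × ℝ}

theorem SourceEquation.mono {h : (ℝ × ℝ) × ℝ → ℝ} {W : Set (ℝ × ℝ)}
    (hS : SourceEquation c U Q1 Q2 Q0 G h) (hW : W ⊆ U) : SourceEquation c W Q1 Q2 Q0 G h :=
  fun p hp => hS p (hW hp)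

/-- The source equation depends on `G` only through its values. -/
theorem SourceEquation.congr {V : Set (ℝ × ℝ)} (hV : IsOpen V) {G' : ℝ × ℝ → ℝ}
    {h : (ℝ × ℝ) × ℝ → ℝ} (hS : SourceEquation c V Q1 Q2 Q0 G h) (hG : EqOn G G' V) :
    SourceEquation c V Q1 Q2 Q0 G' h := fun p hp u => by
  rw [hS p hp u, EqOn.dt hV (w₁ := fun q => G q * Q0 q)
    (w₂ := fun q => G' q * Q0 q) (fun q hq => by simp only [hG hq]) hp]

theorem contDiffOn_source {W : Set (ℝ × ℝ)} (hg : ContDiffOn ℝ n g (U ×ˢ univ)) (hW : W ⊆ U) :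
    ContDiffOn ℝ n (fun z : (ℝ × ℝ) × ℝ => g (z.1, z.2, 0)) (W ×ˢ univ) :=
  hg.comp (contDiffOn_fst.prodMk (contDiffOn_snd.prodMk contDiffOn_const))
    fun _ hz => ⟨hW hz.1, mem_univ _⟩

/-- `Q₁ = 0` forces `Q₀ = 0`, hence `Q₂_x = 0`, and the source equation collapses to `Q₂ h_x = 0`.
The field has no `∂_t` component, so flow boxes are replaced by constancy in `x`. -/
theorem exists_caseI (hn : 1 ≤ n) (hU : IsOpen U) (hg : ContDiffOn ℝ n g (U ×ˢ univ))
    (hD : DampingEquations c U Q1 Q2 Q0 G)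
    (haff : ∀ p ∈ U, ∀ u v, g (p, u, v) = G p * v + g (p, u, 0))
    (hS : SourceEquation c U Q1 Q2 Q0 G fun z => g (z.1, z.2, 0)) (hp : p₀ ∈ U)
    (h1 : ∀ p ∈ U, Q1 p = 0) (h2 : ∀ p ∈ U, 0 < Q2 p / Q2 p₀) :
    ∃ V, IsOpen V ∧ p₀ ∈ V ∧ V ⊆ U ∧ CaseI n V g Q1 Q2 Q0 := by
  obtain ⟨r, hr, hrU⟩ := Metric.isOpen_iff.1 hU p₀ hp
  set V := Metric.ball p₀ r
  have hV : IsOpen V := Metric.isOpen_ball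
  have hVIJ : Metric.ball p₀.1 r ×ˢ Metric.ball p₀.2 r = V := ball_prod_same _ _ _
  have hI : IsOpen (Metric.ball p₀.1 r) := Metric.isOpen_ball
  have hJ : IsOpen (Metric.ball p₀.2 r) := Metric.isOpen_ball
  have hVI : ∀ p ∈ V, p.1 ∈ Metric.ball p₀.1 r := fun p hp => by
    rw [← hVIJ] at hp
    exact hp.1
  have hVJ : ∀ p ∈ V, p.2 ∈ Metric.ball p₀.2 r := fun p hp => by
    rw [← hVIJ] at hp
    exact hp.2
  have hx : ∀ t ∈ Metric.ball p₀.1 r, (t, p₀.2) ∈ U := fun t ht =>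
    hrU (by rw [← hVIJ]; exact ⟨ht, Metric.mem_ball_self hr⟩)
  have hκ : Q2 p₀ ≠ 0 := fun h => by simpa [h] using h2 p₀ hp
  have h0 : EqOn Q0 (fun _ => 0) U := fun p hp => by
    have := hD.Q1_mul p hp
    rw [h1 p hp] at this
    linarith
  have h1t : ∀ p ∈ U, dt Q1 p = 0 := fun p hp =>
    (EqOn.dt hU (w₂ := fun _ => 0) h1 hp).trans (dt_const 0)
  have h2x : ∀ p ∈ U, dx Q2 p = 0 := fun p hp => by
    have := hD.two_mul_Q0 p hp
    rw [h1t p hp, h0 hp] at this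
    linarith
  have hconst : ∀ {w : ℝ × ℝ → ℝ}, (∀ p ∈ U, DifferentiableAt ℝ w p) → (∀ p ∈ U, dx w p = 0) →
      ∀ p ∈ V, w p = w (p.1, p₀.2) := fun {w} hw hw0 p hp =>
    eq_of_dx_eq_zero hJ (ordConnected_ball _ _) (fun q hq => hw q (hrU (hVIJ ▸ hq)))
      (fun q hq => hw0 q (hrU (hVIJ ▸ hq))) (hVI p hp) (Metric.mem_ball_self hr) (hVJ p hp)
  -- Dividing by the value at `p₀` makes the logarithm's argument positive; that value becomes `κ`
  -- and carries the sign.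
  set a : ℝ → ℝ := fun t => Real.log (Q2 (t, p₀.2) / Q2 p₀) with ha
  have has : ContDiffOn ℝ ∞ a (Metric.ball p₀.1 r) :=
    ((hD.smooth2.comp (f := fun t => (t, p₀.2)) (by fun_prop) hx).div_const _).log
      fun t ht => (h2 _ (hx t ht)).ne'
  have hQ : ∀ p ∈ V, Q1 p = 0 ∧ Q2 p = Q2 p₀ * Real.exp (a p.1) ∧ Q0 p = 0 := fun p hp => by
    refine ⟨h1 p (hrU hp), ?_, h0 (hrU hp)⟩
    rw [Real.exp_log (h2 _ (hx _ (hVI p hp))), mul_div_cancel₀ _ hκ]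
    exact hconst (fun q hq => hD.smooth2.smoothAt hU hq) h2x p hp
  have hD' := (caseI_equations (c := c) hV hVI has hQ).1
  refine ⟨V, hV, Metric.mem_ball_self hr, hrU, Q2 p₀, Metric.ball p₀.1 r, a,
    fun z => g ((z.1, p₀.2), z.2, 0), hκ, hI, hVI, has, ?_, fun p hp u v => ?_, hQ⟩
  · exact hg.comp (by fun_prop) fun z hz => ⟨hx _ hz.1, mem_univ _⟩
  · have hne : Q2 p ≠ 0 := fun h => by simpa [h] using h2 p (hrU hp)
    rw [haff p (hrU hp), (hD.mono hrU).eqOn hD' hp (Or.inr hne)]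
    congr 1
    refine hconst (w := fun q => g (q, u, 0)) (fun q hq => ?_) (fun q hq => ?_) p hp
    · have hgd := (hg.contDiffAt ((hU.prod isOpen_univ).mem_nhds
        (show (q, u, (0 : ℝ)) ∈ U ×ˢ univ from ⟨hq, mem_univ _⟩))).differentiableAt
          (by exact_mod_cast (zero_lt_one.trans_le hn).ne')
      exact hgd.comp (f := fun q : ℝ × ℝ => (q, u, (0 : ℝ))) q (by fun_prop)
    · have hne : Q2 q ≠ 0 := fun h => by simpa [h] using h2 q hq
      have hb : box c Q0 q = 0 := by
        rw [EqOn.box hU h0 hq]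
        simp only [box, dt, dx, deriv_const]
        ring
      have hG : dt (fun q => G q * Q0 q) q = 0 := by
        have : EqOn (fun q => G q * Q0 q) (fun _ => 0) U := fun q hq => by simp [h0 hq]
        exact (this.dt hU hq).trans (dt_const 0)
      have := hS q hq u
      rw [hb, hG, h1 q hq, h0 hq, h1t q hq, h2x q hq] at this
      simpa [hne] using this

/-- `Q₂ = 0` leaves `c² Q₁_x = 0`, so `Q₁` depends on `t` only and `2 Q₀ = Q₁_t`. The trajectories
are the lines of constant `x`, a flow box of speed `0`. -/
theorem exists_caseII (hc : c ≠ 0) (hn : 1 ≤ n) (hU : IsOpen U)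
    (hg : ContDiffOn ℝ n g (U ×ˢ univ)) (hD : DampingEquations c U Q1 Q2 Q0 G)
    (haff : ∀ p ∈ U, ∀ u v, g (p, u, v) = G p * v + g (p, u, 0))
    (hS : SourceEquation c U Q1 Q2 Q0 G fun z => g (z.1, z.2, 0)) (hp : p₀ ∈ U)
    (h2 : ∀ p ∈ U, Q2 p = 0) (h1 : ∀ p ∈ U, 0 < Q1 p / Q1 p₀) :
    ∃ V, IsOpen V ∧ p₀ ∈ V ∧ V ⊆ U ∧ CaseII n V g Q1 Q2 Q0 := by
  obtain ⟨r, hr, hrU⟩ := exists_slanted_subset 0 hU hp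
  have hI : IsOpen (Metric.ball p₀.1 r) := Metric.isOpen_ball
  have hJ : IsOpen (Metric.ball p₀.2 r) := Metric.isOpen_ball
  have hB := flowBox_const 0 p₀.1 hI hJ (ordConnected_ball _ _) (Metric.mem_ball_self hr)
  set V := {p : ℝ × ℝ | p.1 ∈ Metric.ball p₀.1 r ∧ p.2 - 0 * (p.1 - p₀.1) ∈ Metric.ball p₀.2 r}
  have hV := hB.isOpen
  have hVI := hB.time_mem
  have hVJ : ∀ p ∈ V, p.2 ∈ Metric.ball p₀.2 r := fun p hp => by simpa using hp.2
  have hmem : Metric.ball p₀.1 r ×ˢ Metric.ball p₀.2 r ⊆ V := fun z hz =>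
    ⟨hz.1, by simpa using hz.2⟩
  have hx : ∀ t ∈ Metric.ball p₀.1 r, (t, p₀.2) ∈ U := fun t ht =>
    hrU (hmem ⟨ht, Metric.mem_ball_self hr⟩)
  have hne : ∀ p ∈ V, Q1 p ≠ 0 := fun p hp h => by simpa [h] using h1 p (hrU hp)
  have hκ : Q1 p₀ ≠ 0 := fun h => by simpa [h] using h1 p₀ hp
  have h1x : ∀ p ∈ U, dx Q1 p = 0 := fun p hp => by
    have := hD.Q2_mul p hp
    rw [(EqOn.dt hU (w₂ := fun _ => 0) h2 hp).trans (dt_const 0), h2 p hp] at this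
    simpa [hc] using this
  set a : ℝ → ℝ := fun t => Real.log (Q1 (t, p₀.2) / Q1 p₀) with ha
  have has : ContDiffOn ℝ ∞ a (Metric.ball p₀.1 r) :=
    ((hD.smooth1.comp (f := fun t => (t, p₀.2)) (by fun_prop) hx).div_const _).log
      fun t ht => (h1 _ (hx t ht)).ne'
  have hQ1 : EqOn Q1 (fun p => Q1 p₀ * Real.exp (a p.1)) V := fun p hp => by
    simp only
    rw [Real.exp_log (h1 _ (hx _ (hVI p hp))), mul_div_cancel₀ _ hκ]
    exact eq_of_dx_eq_zero hJ (ordConnected_ball _ _)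
      (fun q hq => hD.smooth1.smoothAt hU (hrU (hmem hq))) (fun q hq => h1x q (hrU (hmem hq)))
      (hVI p hp) (Metric.mem_ball_self hr) (hVJ p hp)
  have hQ : ∀ p ∈ V, Q1 p = Q1 p₀ * Real.exp (a p.1) ∧ Q2 p = 0 ∧
      Q0 p = Q1 p₀ * (Real.exp (a p.1) * (deriv a p.1 / 2)) := fun p hp => by
    refine ⟨hQ1 hp, h2 p (hrU hp), ?_⟩
    have e1 : dt Q1 p = Q1 p₀ * (Real.exp (a p.1) * deriv a p.1) := by
      rw [hQ1.dt hV hp]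
      have hd := ((has.contDiffAt (hI.mem_nhds (hVI p hp))).differentiableAt (by simp)).hasDerivAt
      exact (hd.exp.const_mul (Q1 p₀)).deriv
    have e2 : dx Q2 p = 0 := (EqOn.dx hU (w₂ := fun _ => 0) h2 (hrU hp)).trans (dx_const 0)
    have := hD.two_mul_Q0 p (hrU hp)
    rw [e1, e2] at this
    linarith
  obtain ⟨hD', hF, hk, hlin⟩ := caseII_equations (c := c) hV hVI has hQ
  have hGeq : EqOn G (fun q => deriv a q.1) V := fun p hp =>
    (hD.mono hrU).eqOn hD' hp (Or.inl (hne p hp))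
  obtain ⟨f, hf, hfe⟩ := hB.exists_canonical hD' hne (fun p hp => by simp [h2 p (hrU hp)]) hF hk
    hlin hn (contDiffOn_source hg hrU) ((hS.mono hrU).congr hV hGeq)
  refine ⟨V, hV, hmem ⟨Metric.mem_ball_self hr, Metric.mem_ball_self hr⟩, hrU, Q1 p₀,
    Metric.ball p₀.1 r, Metric.ball p₀.2 r, a, f, hκ, hI, hJ, fun p hp => ⟨hVI p hp, hVJ p hp⟩, has,
    hf, fun p hp u v => ?_, hQ⟩
  rw [haff p (hrU hp), hGeq hp, hfe p hp u, zero_mul, sub_zero, mul_comm u]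
  ring

end NormalForms

/-! ### Cases (iii) and (iv): both `Q₁` and `Q₂` present. -/

section NormalForms

variable {c : ℝ} {U : Set (ℝ × ℝ)} {n : ℕ∞} {g : (ℝ × ℝ) × ℝ × ℝ → ℝ} {Q1 Q2 Q0 G : ℝ × ℝ → ℝ}
  {p₀ : ℝ × ℝ}

/-- The trajectories are characteristic lines of the wave equation. Any `a` with `a_t - σc a_x = log
(Q₁ / Q₁(p₀))` serves: as `□` factors into `∂_t + σc ∂_x` and `∂_t - σc ∂_x`, applying the first
factor to this equation gives `Q₁ □a = Q₁_t - Q₂_x = 2 Q₀`. -/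
theorem exists_caseIII {σ : ℝ} (hσ : σ ^ 2 = 1) (hn : 1 ≤ n) (hU : IsOpen U)
    (hg : ContDiffOn ℝ n g (U ×ˢ univ)) (hD : DampingEquations c U Q1 Q2 Q0 G)
    (haff : ∀ p ∈ U, ∀ u v, g (p, u, v) = G p * v + g (p, u, 0))
    (hS : SourceEquation c U Q1 Q2 Q0 G fun z => g (z.1, z.2, 0)) (hp : p₀ ∈ U)
    (h2 : ∀ p ∈ U, Q2 p = -(σ * c) * Q1 p) (h1 : ∀ p ∈ U, 0 < Q1 p / Q1 p₀) :
    ∃ V, IsOpen V ∧ p₀ ∈ V ∧ V ⊆ U ∧ CaseIII n c σ V g Q1 Q2 Q0 := by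
  obtain ⟨r, hr, hrU⟩ := exists_slanted_subset (-(σ * c)) hU hp
  have hI : IsOpen (Metric.ball p₀.1 r) := Metric.isOpen_ball
  have hJ : IsOpen (Metric.ball p₀.2 r) := Metric.isOpen_ball
  have hB := flowBox_const (-(σ * c)) p₀.1 hI hJ (ordConnected_ball _ _) (Metric.mem_ball_self hr)
  set V := {p : ℝ × ℝ | p.1 ∈ Metric.ball p₀.1 r ∧
    p.2 - -(σ * c) * (p.1 - p₀.1) ∈ Metric.ball p₀.2 r} with hVdef
  have hV := hB.isOpen
  have hpV : p₀ ∈ V := by simp [hVdef, hr]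
  have hD1 := hD.mono hrU
  have hne : ∀ p ∈ V, Q1 p ≠ 0 := fun p hp h => by simpa [h] using h1 p (hrU hp)
  have hκ : Q1 p₀ ≠ 0 := hne p₀ hpV
  obtain ⟨a, ha, haq⟩ := hB.exists_transport (r := fun p => Real.log (Q1 p / Q1 p₀))
    ((hD1.smooth1.div_const _).log fun p hp => (h1 p (hrU hp)).ne')
  have haq' : EqOn (fun p => dt a p - σ * c * dx a p) (fun p => Real.log (Q1 p / Q1 p₀)) V :=
    fun p hp => by simp only [← haq p hp]; ring
  have hQ1 : ∀ p ∈ V, Q1 p = Q1 p₀ * Real.exp (dt a p - σ * c * dx a p) := fun p hp => by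
    rw [show dt a p - σ * c * dx a p = _ from haq' hp, Real.exp_log (h1 p (hrU hp)),
      mul_div_cancel₀ _ hκ]
  have hbox : ∀ p ∈ V, Q1 p * box c a p = 2 * Q0 p := fun p hp => by
    have d1 := hD1.smooth1.smoothAt hV hp
    have dat := (ha.dt hV).smoothAt hV hp
    have dax := (ha.dx hV).smoothAt hV hp
    have hpos := (h1 p (hrU hp)).ne'
    have et : dt (dt a) p - σ * c * dt (dx a) p = dt Q1 p / Q1 p := by
      have := haq'.dt hV hp
      rw [show dt (fun p => dt a p - σ * c * dx a p) p = _ from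
        ((hasDerivAt_dt dat).sub ((hasDerivAt_dt dax).const_mul (σ * c))).deriv] at this
      rw [this, show dt (fun p => Real.log (Q1 p / Q1 p₀)) p = _ from
        (((hasDerivAt_dt d1).div_const (Q1 p₀)).log hpos).deriv]
      simp only [Prod.mk.eta]
      field_simp
    have ex : dx (dt a) p - σ * c * dx (dx a) p = dx Q1 p / Q1 p := by
      have := haq'.dx hV hp
      rw [show dx (fun p => dt a p - σ * c * dx a p) p = _ from
        ((hasDerivAt_dx dat).sub ((hasDerivAt_dx dax).const_mul (σ * c))).deriv] at this
      rw [this, show dx (fun p => Real.log (Q1 p / Q1 p₀)) p = _ from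
        (((hasDerivAt_dx d1).div_const (Q1 p₀)).log hpos).deriv]
      simp only [Prod.mk.eta]
      field_simp
    have e2x : dx Q2 p = -(σ * c) * dx Q1 p := by
      rw [EqOn.dx hV (fun q hq => h2 q (hrU hq)) hp]
      exact ((hasDerivAt_dx d1).const_mul _).deriv
    have hb : box c a p = dt Q1 p / Q1 p + σ * c * (dx Q1 p / Q1 p) := by
      rw [← et, ← ex, box, dt_dx_comm hV ha hp]
      linear_combination c ^ 2 * dx (dx a) p * hσ
    rw [hb, hD1.two_mul_Q0 p hp, e2x]
    have := hne p hp
    field_simp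
    ring
  have hQ : ∀ p ∈ V, Q1 p = Q1 p₀ * Real.exp (dt a p - σ * c * dx a p) ∧
      Q2 p = Q1 p₀ * (Real.exp (dt a p - σ * c * dx a p) * (-(σ * c))) ∧
      Q0 p = Q1 p₀ * (Real.exp (dt a p - σ * c * dx a p) * (1 / 2 * box c a p)) := fun p hp => by
    refine ⟨hQ1 p hp, ?_, ?_⟩
    · rw [h2 p (hrU hp), hQ1 p hp]
      ring
    · have := hbox p hp
      rw [hQ1 p hp] at this
      linarith
  obtain ⟨hD', hF, hk⟩ := caseIII_equations hV hσ hκ ha hQ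
  have hGeq : EqOn G (box c a) V := fun p hp => hD1.eqOn hD' hp (Or.inl (hne p hp))
  obtain ⟨k, hks, hkl⟩ := hB.exists_linearTerm hD' hne fun p hp => h2 p (hrU hp)
  obtain ⟨f, hf, hfe⟩ := hB.exists_canonical hD' hne (fun p hp => h2 p (hrU hp)) hF hks hkl hn
    (contDiffOn_source hg hrU) ((hS.mono hrU).congr hV hGeq)
  -- The flow box labels a line by its position at time `p₀.1`, the normal form by its position at
  -- time `0`; hence the shift by `σ c p₀.1`.
  refine ⟨V, hV, hpV, hrU, Q1 p₀, (fun y => y - σ * c * p₀.1) ⁻¹' Metric.ball p₀.2 r, a, k,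
    fun z => f (z.1 - σ * c * p₀.1, z.2), hκ, hJ.preimage (by fun_prop), fun p hp => ?_, ha, hks,
    ?_, (hk k).1 hkl, fun p hp u v => ?_, hQ⟩
  · have := hp.2
    rw [mem_preimage]
    convert this using 1
    ring
  · exact hf.comp (by fun_prop) fun z hz => ⟨hz.1, mem_univ _⟩
  · rw [haff p (hrU hp), hGeq hp, hfe p hp u]
    simp only
    rw [show p.2 - -(σ * c) * (p.1 - p₀.1) = p.2 + σ * c * p.1 - σ * c * p₀.1 by ring]
    ring

/-- The characteristic components `c Q₁ ± Q₂` of a multiplier determine the function `a`. -/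
theorem DampingEquations.exists_potential (hc : c ≠ 0) (hU : IsOpen U) (hconv : Convex ℝ U)
    (hD : DampingEquations c U Q1 Q2 Q0 G) (hP : ∀ p ∈ U, c * Q1 p + Q2 p ≠ 0)
    (hM : ∀ p ∈ U, c * Q1 p - Q2 p ≠ 0) :
    ∃ a, ContDiffOn ℝ ∞ a U ∧ ∀ p ∈ U,
      dt a p = (Real.log (c * Q1 p + Q2 p) + Real.log (c * Q1 p - Q2 p)) / 2 - Real.log c ∧
      dx a p = (Real.log (c * Q1 p + Q2 p) - Real.log (c * Q1 p - Q2 p)) / (2 * c) ∧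
      box c a p = G p := by
  have s1 := hD.smooth1
  have s2 := hD.smooth2
  have sP : ContDiffOn ℝ ∞ (fun p => Real.log (c * Q1 p + Q2 p)) U :=
    ((contDiffOn_const.mul s1).add s2).log hP
  have sM : ContDiffOn ℝ ∞ (fun p => Real.log (c * Q1 p - Q2 p)) U :=
    ((contDiffOn_const.mul s1).sub s2).log hM
  -- The damping equations decouple: `c Q₁ + Q₂` is transported with speed `-c` and `c Q₁ - Q₂` with
  -- speed `c`, both with growth rate `G`. `Real.log` ignores signs, so non-vanishing suffices.
  have ht : ∀ p ∈ U, dt (fun p => Real.log (c * Q1 p + Q2 p)) p =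
      c * dx (fun p => Real.log (c * Q1 p + Q2 p)) p + G p := fun p hp => by
    have d1 := s1.smoothAt hU hp
    have d2 := s2.smoothAt hU hp
    rw [show dt (fun p => Real.log (c * Q1 p + Q2 p)) p = _ from
        ((((hasDerivAt_dt d1).const_mul c).add (hasDerivAt_dt d2)).log (hP p hp)).deriv,
      show dx (fun p => Real.log (c * Q1 p + Q2 p)) p = _ from
        ((((hasDerivAt_dx d1).const_mul c).add (hasDerivAt_dx d2)).log (hP p hp)).deriv]
    have := hP p hp
    have e1 := hD.two_mul_Q0 p hp
    have e2 := hD.Q1_mul p hp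
    have e3 := hD.Q2_mul p hp
    simp only [Prod.mk.eta, Pi.add_apply]
    field_simp
    linear_combination -c * e1 - c * e2 - e3
  have hx : ∀ p ∈ U, dt (fun p => Real.log (c * Q1 p - Q2 p)) p =
      -c * dx (fun p => Real.log (c * Q1 p - Q2 p)) p + G p := fun p hp => by
    have d1 := s1.smoothAt hU hp
    have d2 := s2.smoothAt hU hp
    rw [show dt (fun p => Real.log (c * Q1 p - Q2 p)) p = _ from
        ((((hasDerivAt_dt d1).const_mul c).sub (hasDerivAt_dt d2)).log (hM p hp)).deriv,
      show dx (fun p => Real.log (c * Q1 p - Q2 p)) p = _ from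
        ((((hasDerivAt_dx d1).const_mul c).sub (hasDerivAt_dx d2)).log (hM p hp)).deriv]
    have := hM p hp
    have e1 := hD.two_mul_Q0 p hp
    have e2 := hD.Q1_mul p hp
    have e3 := hD.Q2_mul p hp
    simp only [Prod.mk.eta, Pi.sub_apply]
    field_simp
    linear_combination -c * e1 - c * e2 + e3
  generalize hLP : (fun p => Real.log (c * Q1 p + Q2 p)) = P at *
  generalize hLM : (fun p => Real.log (c * Q1 p - Q2 p)) = M at *
  have eP : ∀ p, Real.log (c * Q1 p + Q2 p) = P p := fun p => congrFun hLP p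
  have eM : ∀ p, Real.log (c * Q1 p - Q2 p) = M p := fun p => congrFun hLM p
  simp only [eP, eM]
  set A : ℝ × ℝ → ℝ := fun p => (P p + M p) / 2 - Real.log c
  set B : ℝ × ℝ → ℝ := fun p => (P p - M p) / (2 * c)
  have sA : ContDiffOn ℝ ∞ A U := ((sP.add sM).div_const _).sub contDiffOn_const
  have sB : ContDiffOn ℝ ∞ B U := (sP.sub sM).div_const _
  -- `A_x = B_t` holds because the two contributions of `G` cancel in `B_t`; in `□a = A_t - c² B_x`
  -- they add up to `G`.
  obtain ⟨a, ha, hab⟩ := _root_.exists_potential hU hconv sA sB fun p hp => by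
    have dP := sP.smoothAt hU hp
    have dM := sM.smoothAt hU hp
    rw [show dx A p = _ from
        ((((hasDerivAt_dx dP).add (hasDerivAt_dx dM)).div_const 2).sub_const _).deriv,
      show dt B p = _ from (((hasDerivAt_dt dP).sub (hasDerivAt_dt dM)).div_const _).deriv,
      ht p hp, hx p hp]
    field_simp
    ring
  refine ⟨a, ha, fun p hp => ⟨(hab p hp).1, (hab p hp).2, ?_⟩⟩
  have dP := sP.smoothAt hU hp
  have dM := sM.smoothAt hU hp
  rw [box, EqOn.dt hU (fun p hp => (hab p hp).1) hp, EqOn.dx hU (fun p hp => (hab p hp).2) hp,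
    show dt A p = _ from
      ((((hasDerivAt_dt dP).add (hasDerivAt_dt dM)).div_const 2).sub_const _).deriv,
    show dx B p = _ from (((hasDerivAt_dx dP).sub (hasDerivAt_dx dM)).div_const _).deriv,
    ht p hp, hx p hp]
  field_simp
  ring

/-- Recovers `Q₁` and `Q₂` from `a`, since `e^{a_t + c a_x}` and `e^{a_t - c a_x}` are `P / c` and
`M / c`. -/
theorem exp_add_mul_cosh (hc : 0 < c) {P M : ℝ} (hP : 0 < P) (hM : 0 < M) :
    Real.exp ((Real.log P + Real.log M) / 2 - Real.log c) *
        Real.cosh (c * ((Real.log P - Real.log M) / (2 * c))) = (P + M) / (2 * c) ∧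
      Real.exp ((Real.log P + Real.log M) / 2 - Real.log c) *
        Real.sinh (c * ((Real.log P - Real.log M) / (2 * c))) = (P - M) / (2 * c) := by
  have e : c * ((Real.log P - Real.log M) / (2 * c)) = (Real.log P - Real.log M) / 2 := by
    field_simp
  have e1 : Real.exp ((Real.log P + Real.log M) / 2 - Real.log c) *
      Real.exp ((Real.log P - Real.log M) / 2) = P / c := by
    rw [← Real.exp_add, ← Real.exp_log hP, ← Real.exp_log hc, ← Real.exp_sub]
    simp only [Real.exp_log hP, Real.exp_log hc]
    ring_nf
  have e2 : Real.exp ((Real.log P + Real.log M) / 2 - Real.log c) *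
      Real.exp (-((Real.log P - Real.log M) / 2)) = M / c := by
    rw [← Real.exp_add, ← Real.exp_log hM, ← Real.exp_log hc, ← Real.exp_sub]
    simp only [Real.exp_log hM, Real.exp_log hc]
    ring_nf
  rw [e, Real.cosh_eq, Real.sinh_eq]
  constructor
  · linear_combination (e1 + e2) / 2
  · linear_combination (e1 - e2) / 2

/-- `ε` and `δ` are the signs of `c Q₁ + Q₂` and `c Q₁ - Q₂`. Equal signs make `Q₁` half the sum of
absolute values over `c`, up to `ε`, hence a `cosh`; opposite signs give a `sinh`. The constant `κ`
is `ε`. The label of the flow with slope `Q₂ / Q₁` is `b₀`, and `b` solves the transport equation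
with right-hand side `G = □a`. -/
theorem exists_caseIV (hc : 0 < c) (hn : 1 ≤ n) (hU : IsOpen U)
    (hg : ContDiffOn ℝ n g (U ×ˢ univ)) (hD : DampingEquations c U Q1 Q2 Q0 G)
    (haff : ∀ p ∈ U, ∀ u v, g (p, u, v) = G p * v + g (p, u, 0))
    (hS : SourceEquation c U Q1 Q2 Q0 G fun z => g (z.1, z.2, 0)) (hp : p₀ ∈ U)
    (h1 : ∀ p ∈ U, Q1 p ≠ 0) {ε δ : ℝ} (hε : ε = 1 ∨ ε = -1) (hδ : δ = ε ∨ δ = -ε)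
    (hP : ∀ p ∈ U, 0 < ε * (c * Q1 p + Q2 p)) (hM : ∀ p ∈ U, 0 < δ * (c * Q1 p - Q2 p)) :
    ∃ V, IsOpen V ∧ p₀ ∈ V ∧ V ⊆ U ∧ CaseIV n c V g Q1 Q2 Q0 := by
  obtain ⟨r, hr, hrU⟩ := Metric.isOpen_iff.1 hU p₀ hp
  have hε2 : ε * ε = 1 := by rcases hε with rfl | rfl <;> norm_num
  have hlog : ∀ η : ℝ, (η = 1 ∨ η = -1) → ∀ x, Real.log (η * x) = Real.log x := by
    rintro η (rfl | rfl) x <;> simp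
  have hδ' : δ = 1 ∨ δ = -1 := by rcases hε with rfl | rfl <;> rcases hδ with rfl | rfl <;> simp
  have hball : IsOpen (Metric.ball p₀ r) := Metric.isOpen_ball
  have hD1 := hD.mono hrU
  obtain ⟨a, ha, hae⟩ := hD1.exists_potential hc.ne' hball (convex_ball _ _)
    (fun p hp h => by simpa [h] using hP p (hrU hp)) fun p hp h => by simpa [h] using hM p (hrU hp)
  have hCS : ∃ C S : ℝ → ℝ, ((C = Real.cosh ∧ S = Real.sinh) ∨ (C = Real.sinh ∧ S = Real.cosh)) ∧
      ∀ p ∈ Metric.ball p₀ r, Q1 p = ε * (Real.exp (dt a p) * C (c * dx a p)) ∧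
        Q2 p = ε * (Real.exp (dt a p) * (c * S (c * dx a p))) := by
    have key := fun p (hp : p ∈ Metric.ball p₀ r) =>
      exp_add_mul_cosh hc (hP p (hrU hp)) (hM p (hrU hp))
    simp only [hlog ε hε, hlog δ hδ'] at key
    rcases hδ with rfl | rfl
    · refine ⟨Real.cosh, Real.sinh, Or.inl ⟨rfl, rfl⟩, fun p hp => ?_⟩
      rw [(hae p hp).1, (hae p hp).2.1, mul_left_comm _ c, (key p hp).1, (key p hp).2]
      constructor <;> field_simp
      · linear_combination -2 * c * Q1 p * hε2
      · linear_combination -2 * Q2 p * hε2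
    · refine ⟨Real.sinh, Real.cosh, Or.inr ⟨rfl, rfl⟩, fun p hp => ?_⟩
      rw [(hae p hp).1, (hae p hp).2.1, mul_left_comm _ c, (key p hp).1, (key p hp).2]
      constructor <;> field_simp
      · linear_combination -2 * c * Q1 p * hε2
      · linear_combination -2 * Q2 p * hε2
  obtain ⟨C, S, hCS, hQ12⟩ := hCS
  obtain ⟨V, I, J, ψ, b0, hpV, hVr, hB⟩ := exists_flowBox (q := fun p => Q2 p / Q1 p) hball
    (hD1.smooth2.div hD1.smooth1 fun p hp => h1 p (hrU hp)) (Metric.mem_ball_self hr)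
  have hV := hB.isOpen
  have hVU : V ⊆ U := hVr.trans hrU
  have hq : ∀ p ∈ V, Q2 p = Q2 p / Q1 p * Q1 p := fun p hp =>
    (div_mul_cancel₀ _ (h1 p (hVU hp))).symm
  have haV := ha.mono hVr
  have hε0 : ε ≠ 0 := by rintro rfl; simp at hε2
  have hQ : ∀ p ∈ V, Q1 p = ε * (Real.exp (dt a p) * C (c * dx a p)) ∧
      Q2 p = ε * (Real.exp (dt a p) * (c * S (c * dx a p))) ∧
      Q0 p = ε * (Real.exp (dt a p) * (C (c * dx a p) * (1 / 2 * box c a p))) := fun p hp => by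
    have h := hQ12 p (hVr hp)
    refine ⟨h.1, h.2, ?_⟩
    have := hD.Q1_mul p (hVU hp)
    rw [h.1, ← (hae p (hVr hp)).2.2] at this
    linarith
  obtain ⟨b, hb, hbq⟩ := hB.exists_transport (hD.smoothG.mono hVU)
  obtain ⟨hD', hF, hk⟩ := caseIV_equations hV hε0 hCS haV hb hB.smooth_label hQ
  have hflow : ∀ (w : ℝ × ℝ → ℝ) (d : ℝ), ∀ p ∈ V, dt w p + Q2 p / Q1 p * dx w p = d →
      C (c * dx a p) * dt w p + c * S (c * dx a p) * dx w p = C (c * dx a p) * d := by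
    intro w d p hp h
    have h0 := h1 p (hVU hp)
    have h' : Q1 p * dt w p + Q2 p * dx w p = Q1 p * d := by
      rw [← h]
      field_simp
    rw [(hQ p hp).1, (hQ p hp).2.1] at h'
    apply mul_left_cancel₀ (mul_ne_zero hε0 (Real.exp_pos (dt a p)).ne')
    linear_combination h'
  have f0 : ∀ p ∈ V, C (c * dx a p) * dt b0 p + c * S (c * dx a p) * dx b0 p = 0 := fun p hp => by
    rw [hflow b0 0 p hp (hB.dt_label_add hp), mul_zero]
  have fb : ∀ p ∈ V, C (c * dx a p) * dt b p + c * S (c * dx a p) * dx b p =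
      C (c * dx a p) * box c a p := fun p hp => by
    rw [hflow b (G p) p hp (hbq p hp), (hae p (hVr hp)).2.2]
  have hne : ∀ p ∈ V, Q1 p ≠ 0 := fun p hp => h1 p (hVU hp)
  have hGeq : EqOn G (box c a) V := fun p hp => (hae p (hVr hp)).2.2.symm
  obtain ⟨k, hks, hkl⟩ := hB.exists_linearTerm hD' hne hq
  obtain ⟨f, hf, hfe⟩ := hB.exists_canonical hD' hne hq (hF.1 ⟨f0, fb⟩) hks hkl hn
    (contDiffOn_source hg hVU) ((hS.mono hVU).congr hV hGeq)
  refine ⟨V, hV, hpV, hVU, C, S, ε, J, a, b, b0, k, f, hCS, hε0, hB.isOpen_label, hB.label_mem, haV,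
    hb, hB.smooth_label, hks, hf, f0, fb, (hk k).1 hkl, fun p hp u v => ?_, hQ⟩
  rw [haff p (hVU hp), hGeq hp, hfe p hp u]
  ring

end NormalForms

/-! ### Case distinction at a generic point, and density of generic points. -/

section Classification

variable {c : ℝ} {Ω : Set (ℝ × ℝ)} {n : ℕ∞} {g : (ℝ × ℝ) × ℝ × ℝ → ℝ} {Q1 Q2 Q0 : ℝ × ℝ → ℝ}

/-- Genericity turns each vanishing at `p` into vanishing nearby, so the case is decided by which of
`Q₁`, `Q₂`, `Q₂² - c² Q₁²` vanish at `p`. -/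
theorem IsMultiplier.exists_case (hm : IsMultiplier c Ω g Q1 Q2 Q0) (hc : 0 < c) (hn : 2 ≤ n)
    (hΩ : IsOpen Ω) (hg : ContDiffOn ℝ n g (Ω ×ˢ univ)) (s1 : ContDiffOn ℝ ∞ Q1 Ω)
    (s2 : ContDiffOn ℝ ∞ Q2 Ω) (s0 : ContDiffOn ℝ ∞ Q0 Ω) {p : ℝ × ℝ} (hp : p ∈ Ω)
    (hgen : IsGenericPointFor c Q1 Q2 p) :
    ∃ V : Set (ℝ × ℝ), IsOpen V ∧ p ∈ V ∧ V ⊆ Ω ∧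
      (CaseI n V g Q1 Q2 Q0 ∨ CaseII n V g Q1 Q2 Q0 ∨ CaseIII n c 1 V g Q1 Q2 Q0 ∨
        CaseIII n c (-1) V g Q1 Q2 Q0 ∨
        (CaseIV n c V g Q1 Q2 Q0 ∧ ∀ q ∈ V, Q1 q ≠ 0 ∧ Q2 q ≠ 0)) := by
  have hg2 : ContDiffOn ℝ 2 g (Ω ×ˢ univ) :=
    hg.of_le (WithTop.coe_le_coe.2 hn)
  have hn1 : 1 ≤ n := le_trans (by norm_num) hn
  have hmem : ∀ᶠ q in 𝓝 p, q ∈ Ω := hΩ.mem_nhds hp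
  have c1 : ContinuousAt Q1 p := s1.continuousOn.continuousAt hmem
  have c2 : ContinuousAt Q2 p := s2.continuousOn.continuousAt hmem
  obtain ⟨h12, g1, g2, g3⟩ := hgen
  have hdamp : ∀ {U}, IsOpen U → U ⊆ Ω → ((∀ p ∈ U, Q1 p ≠ 0) ∨ ∀ p ∈ U, Q1 p = 0 ∧ Q2 p ≠ 0) →
      ContDiffOn ℝ n g (U ×ˢ univ) ∧ ∃ G, DampingEquations c U Q1 Q2 Q0 G ∧
        (∀ p ∈ U, ∀ u v, g (p, u, v) = G p * v + g (p, u, 0)) ∧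
        SourceEquation c U Q1 Q2 Q0 G fun z => g (z.1, z.2, 0) := fun hU hUΩ hQ =>
    ⟨hg.mono (prod_mono hUΩ subset_rfl), hm.exists_damping hc hΩ hg2 s1 s2 s0 hU hUΩ hQ⟩
  have hpos : ∀ {F : ℝ × ℝ → ℝ}, ContinuousAt F p → F p ≠ 0 → ∀ᶠ q in 𝓝 p, 0 < F q / F p :=
    fun hF h0 => continuousAt_const.eventually_lt (hF.div_const _) (by simp [div_self h0])
  by_cases h1 : Q1 p = 0
  · have h2 : Q2 p ≠ 0 := h12.resolve_left (not_not.2 h1)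
    obtain ⟨U, hU, hUo, hpU⟩ := eventually_nhds_iff.1
      (hmem.and ((g1.resolve_left (not_not.2 h1)).and (hpos c2 h2)))
    obtain ⟨hgU, G, hD, haff, hS⟩ := hdamp hUo (fun q hq => (hU q hq).1)
      (Or.inr fun q hq => ⟨(hU q hq).2.1, fun h => by simpa [h] using (hU q hq).2.2⟩)
    obtain ⟨V, hV, hpV, hVU, hcase⟩ := exists_caseI hn1 hUo hgU hD haff hS hpU
      (fun q hq => (hU q hq).2.1) (fun q hq => (hU q hq).2.2)
    exact ⟨V, hV, hpV, fun q hq => (hU q (hVU hq)).1, Or.inl hcase⟩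
  by_cases h2 : Q2 p = 0
  · obtain ⟨U, hU, hUo, hpU⟩ := eventually_nhds_iff.1
      (hmem.and ((g2.resolve_left (not_not.2 h2)).and (hpos c1 h1)))
    obtain ⟨hgU, G, hD, haff, hS⟩ := hdamp hUo (fun q hq => (hU q hq).1)
      (Or.inl fun q hq h => by simpa [h] using (hU q hq).2.2)
    obtain ⟨V, hV, hpV, hVU, hcase⟩ := exists_caseII hc.ne' hn1 hUo hgU hD haff hS hpU
      (fun q hq => (hU q hq).2.1) (fun q hq => (hU q hq).2.2)
    exact ⟨V, hV, hpV, fun q hq => (hU q (hVU hq)).1, Or.inr (Or.inl hcase)⟩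
  by_cases h3 : Q2 p ^ 2 - c ^ 2 * Q1 p ^ 2 = 0
  · have hIII : ∀ σ : ℝ, σ ^ 2 = 1 → Q2 p = -(σ * c) * Q1 p →
        ∃ V, IsOpen V ∧ p ∈ V ∧ V ⊆ Ω ∧ CaseIII n c σ V g Q1 Q2 Q0 := by
      intro σ hσ h
      -- The other factor of `Q₂² - c² Q₁²` stays non-zero near `p`, so the same factor vanishes
      -- throughout a neighbourhood.
      have hne : ∀ᶠ q in 𝓝 p, Q2 q - σ * c * Q1 q ≠ 0 := by
        refine ContinuousAt.eventually_ne (by fun_prop) ?_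
        rw [h]
        have : σ ≠ 0 := by rintro rfl; norm_num at hσ
        intro h0
        have : σ * c * Q1 p = 0 := by linarith
        simp_all [hc.ne']
      obtain ⟨U, hU, hUo, hpU⟩ := eventually_nhds_iff.1
        (hmem.and ((g3.resolve_left (not_not.2 h3)).and (hne.and (hpos c1 h1))))
      obtain ⟨hgU, G, hD, haff, hS⟩ := hdamp hUo (fun q hq => (hU q hq).1)
        (Or.inl fun q hq h => by simpa [h] using (hU q hq).2.2.2)
      obtain ⟨V, hV, hpV, hVU, hcase⟩ := exists_caseIII hσ hn1 hUo hgU hD haff hS hpU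
        (fun q hq => by
          obtain ⟨-, e, e', -⟩ := hU q hq
          apply mul_left_cancel₀ e'
          linear_combination e - c ^ 2 * Q1 q ^ 2 * hσ) (fun q hq => (hU q hq).2.2.2)
      exact ⟨V, hV, hpV, fun q hq => (hU q (hVU hq)).1, hcase⟩
    have hfac : (Q2 p + c * Q1 p) * (Q2 p - c * Q1 p) = 0 := by linear_combination h3
    rcases mul_eq_zero.1 hfac with h | h
    · obtain ⟨V, hV, hpV, hVU, hcase⟩ := hIII 1 (by norm_num) (by linarith)
      exact ⟨V, hV, hpV, hVU, Or.inr (Or.inr (Or.inl hcase))⟩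
    · obtain ⟨V, hV, hpV, hVU, hcase⟩ := hIII (-1) (by norm_num) (by linarith)
      exact ⟨V, hV, hpV, hVU, Or.inr (Or.inr (Or.inr (Or.inl hcase)))⟩
  · have hsign : ∀ {x : ℝ}, x ≠ 0 → ∃ ε : ℝ, (ε = 1 ∨ ε = -1) ∧ 0 < ε * x := fun {x} hx => by
      rcases hx.lt_or_gt with h | h
      · exact ⟨-1, Or.inr rfl, by linarith⟩
      · exact ⟨1, Or.inl rfl, by linarith⟩
    obtain ⟨ε, hε, hP⟩ := hsign (x := c * Q1 p + Q2 p) fun h =>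
      h3 (by linear_combination (Q2 p - c * Q1 p) * h)
    obtain ⟨δ, hδ, hM⟩ := hsign (x := c * Q1 p - Q2 p) fun h =>
      h3 (by linear_combination -(Q2 p + c * Q1 p) * h)
    have hδ' : δ = ε ∨ δ = -ε := by rcases hε with rfl | rfl <;> rcases hδ with rfl | rfl <;> simp
    have eP : ∀ᶠ q in 𝓝 p, 0 < ε * (c * Q1 q + Q2 q) :=
      continuousAt_const.eventually_lt (by fun_prop) hP
    have eM : ∀ᶠ q in 𝓝 p, 0 < δ * (c * Q1 q - Q2 q) :=
      continuousAt_const.eventually_lt (by fun_prop) hM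
    obtain ⟨U, hU, hUo, hpU⟩ := eventually_nhds_iff.1
      (hmem.and (((c1.eventually_ne h1).and (c2.eventually_ne h2)).and (eP.and eM)))
    obtain ⟨hgU, G, hD, haff, hS⟩ := hdamp hUo (fun q hq => (hU q hq).1)
      (Or.inl fun q hq => (hU q hq).2.1.1)
    obtain ⟨V, hV, hpV, hVU, hcase⟩ := exists_caseIV hc hn1 hUo hgU hD haff hS hpU
      (fun q hq => (hU q hq).2.1.1) hε hδ' (fun q hq => (hU q hq).2.2.1)
      (fun q hq => (hU q hq).2.2.2)
    exact ⟨V, hV, hpV, fun q hq => (hU q (hVU hq)).1,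
      Or.inr (Or.inr (Or.inr (Or.inr ⟨hcase, fun q hq => (hU q (hVU hq)).2.1⟩)))⟩

theorem exists_open_subset_ne_zero_or_eq_zero {U : Set (ℝ × ℝ)} (hU : IsOpen U) (hne : U.Nonempty)
    {F : ℝ × ℝ → ℝ} (hF : ContinuousOn F U) :
    ∃ W ⊆ U, IsOpen W ∧ W.Nonempty ∧ ((∀ q ∈ W, F q ≠ 0) ∨ ∀ q ∈ W, F q = 0) := by
  by_cases h : ∀ q ∈ U, F q = 0
  · exact ⟨U, subset_rfl, hU, hne, Or.inr h⟩
  · push Not at h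
    obtain ⟨q, hq, hFq⟩ := h
    exact ⟨U ∩ F ⁻¹' {0}ᶜ, inter_subset_left,
      hF.isOpen_inter_preimage hU isOpen_compl_singleton, ⟨q, hq, hFq⟩, Or.inl fun z hz => hz.2⟩

/-- Shrink the open set where `(Q₁, Q₂) ≠ 0` three times; after each step one more of the three
functions is either nowhere zero or identically zero. Any remaining point is generic. -/
theorem exists_isGenericPointFor {U : Set (ℝ × ℝ)} (hU : IsOpen U)
    (h1 : ContinuousOn Q1 U) (h2 : ContinuousOn Q2 U) {q : ℝ × ℝ} (hq : q ∈ U)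
    (h12 : Q1 q ≠ 0 ∨ Q2 q ≠ 0) : ∃ p ∈ U, IsGenericPointFor c Q1 Q2 p := by
  have hU0 : IsOpen (U ∩ (fun z => (Q1 z, Q2 z)) ⁻¹' {0}ᶜ) :=
    (h1.prodMk h2).isOpen_inter_preimage hU isOpen_compl_singleton
  obtain ⟨W1, hW1, hW1o, hW1n, hd1⟩ := exists_open_subset_ne_zero_or_eq_zero hU0
    ⟨q, hq, by simpa [Prod.ext_iff, imp_iff_not_or] using h12⟩ (h1.mono inter_subset_left)
  obtain ⟨W2, hW2, hW2o, hW2n, hd2⟩ := exists_open_subset_ne_zero_or_eq_zero hW1o hW1n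
    (h2.mono (hW1.trans inter_subset_left))
  have hW2U : W2 ⊆ U := hW2.trans (hW1.trans inter_subset_left)
  obtain ⟨W3, hW3, hW3o, ⟨p, hp⟩, hd3⟩ := exists_open_subset_ne_zero_or_eq_zero hW2o hW2n
    (F := fun q => Q2 q ^ 2 - c ^ 2 * Q1 q ^ 2)
    (((h2.mono hW2U).pow 2).sub (((h1.mono hW2U).pow 2).const_mul _))
  have hev : ∀ {F : ℝ × ℝ → ℝ} {W : Set (ℝ × ℝ)}, IsOpen W → p ∈ W →
      ((∀ q ∈ W, F q ≠ 0) ∨ ∀ q ∈ W, F q = 0) → F p ≠ 0 ∨ ∀ᶠ q in 𝓝 p, F q = 0 :=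
    fun hW hpW h => h.imp (fun h => h p hpW) fun h => mem_of_superset (hW.mem_nhds hpW) h
  have hp1 := hW1 (hW2 (hW3 hp))
  exact ⟨p, hp1.1, by simpa [Prod.ext_iff, imp_iff_not_or] using hp1.2,
    hev hW1o (hW2 (hW3 hp)) hd1, hev hW2o (hW3 hp) hd2, hev hW3o hp hd3⟩

/-- If `Q₁` and `Q₂` both vanished near `p`, then `2 Q₀ = Q₁_t - Q₂_x` would make `Q₀(p)` vanish as
well. So points with `(Q₁, Q₂) ≠ 0` lie arbitrarily close to `p`. -/
theorem IsMultiplier.mem_closure_generic (hm : IsMultiplier c Ω g Q1 Q2 Q0) (hc : 0 < c)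
    (hΩ : IsOpen Ω) (hg : ContDiffOn ℝ 2 g (Ω ×ˢ univ)) (s1 : ContDiffOn ℝ ∞ Q1 Ω)
    (s2 : ContDiffOn ℝ ∞ Q2 Ω) (s0 : ContDiffOn ℝ ∞ Q0 Ω) {p : ℝ × ℝ} (hp : p ∈ Ω)
    (h : Q1 p ≠ 0 ∨ Q2 p ≠ 0 ∨ Q0 p ≠ 0) :
    p ∈ closure {q | q ∈ Ω ∧ IsGenericPointFor c Q1 Q2 q} := by
  rw [mem_closure_iff]
  intro o ho hpo
  have hU := ho.inter hΩ
  obtain ⟨q, hq, hq12⟩ : ∃ q ∈ o ∩ Ω, Q1 q ≠ 0 ∨ Q2 q ≠ 0 := by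
    by_contra! hcon
    have e1 : EqOn Q1 (fun _ => 0) (o ∩ Ω) := fun q hq => (hcon q hq).1
    have e2 : EqOn Q2 (fun _ => 0) (o ∩ Ω) := fun q hq => (hcon q hq).2
    have h0 := (hm.determining_equations hc hΩ hg s1 s2 s0 hp).1
    rw [e1.dt hU ⟨hpo, hp⟩, e2.dx hU ⟨hpo, hp⟩, dt_const, dx_const] at h0
    rcases h with h | h | h
    · exact h (e1 ⟨hpo, hp⟩)
    · exact h (e2 ⟨hpo, hp⟩)
    · exact h (by linarith)
  obtain ⟨z, hz, hgen⟩ := exists_isGenericPointFor (c := c) hU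
    (s1.continuousOn.mono inter_subset_right) (s2.continuousOn.mono inter_subset_right) hq hq12
  exact ⟨z, hz.1, hz.2, hgen⟩

end Classification

theorem proposition2 (c : ℝ) (hc : 0 < c) (n : ℕ∞) (hn : 2 ≤ n) :
    -- a multiplier occurs only in the four cases
    (∀ (Ω : Set (ℝ × ℝ)) (g : (ℝ × ℝ) × ℝ × ℝ → ℝ) (Q1 Q2 Q0 : ℝ × ℝ → ℝ),
      IsOpen Ω → ContDiffOn ℝ n g (Ω ×ˢ univ) →
      ContDiffOn ℝ ∞ Q1 Ω → ContDiffOn ℝ ∞ Q2 Ω → ContDiffOn ℝ ∞ Q0 Ω →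
      IsMultiplier c Ω g Q1 Q2 Q0 →
      (∀ p ∈ Ω, IsGenericPointFor c Q1 Q2 p →
        ∃ V : Set (ℝ × ℝ), IsOpen V ∧ p ∈ V ∧ V ⊆ Ω ∧
          (CaseI n V g Q1 Q2 Q0 ∨
            CaseII n V g Q1 Q2 Q0 ∨
            CaseIII n c 1 V g Q1 Q2 Q0 ∨
            CaseIII n c (-1) V g Q1 Q2 Q0 ∨
            (CaseIV n c V g Q1 Q2 Q0 ∧ ∀ q ∈ V, Q1 q ≠ 0 ∧ Q2 q ≠ 0))) ∧
      -- the generic points are dense where the multiplier does not vanish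
      (∀ p ∈ Ω, (Q1 p ≠ 0 ∨ Q2 p ≠ 0 ∨ Q0 p ≠ 0) →
        p ∈ closure {q | q ∈ Ω ∧ IsGenericPointFor c Q1 Q2 q})) ∧
    -- in each case the function `f` is arbitrary
    (∀ (V : Set (ℝ × ℝ)) (g : (ℝ × ℝ) × ℝ × ℝ → ℝ) (Q1 Q2 Q0 : ℝ × ℝ → ℝ),
      IsOpen V →
      (CaseI n V g Q1 Q2 Q0 ∨
        CaseII n V g Q1 Q2 Q0 ∨
        CaseIII n c 1 V g Q1 Q2 Q0 ∨
        CaseIII n c (-1) V g Q1 Q2 Q0 ∨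
        CaseIV n c V g Q1 Q2 Q0) →
      IsMultiplier c V g Q1 Q2 Q0) := by
  refine ⟨fun Ω g Q1 Q2 Q0 hΩ hg h1 h2 h0 hm =>
    ⟨fun p hp hgen => hm.exists_case hc hn hΩ hg h1 h2 h0 hp hgen, fun p hp h => ?_⟩,
    fun V g Q1 Q2 Q0 hV h => isMultiplier_of_cases (le_trans (by norm_num) hn) hV h⟩
  exact hm.mem_closure_generic hc hΩ (hg.of_le (WithTop.coe_le_coe.2 hn)) h1 h2 h0 hp h
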